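/- Call a set $C$ of vertices of a simple graph $G$ a *wide diamond* if there are distinct vertices $v,u\in V(G)\setminus C$ such that $N_G(c)=\{v,u\}$ for all $c\in C$. For a finite graph $G$ and an integer $k$, let $\#\mathrm{minDS}(G,k)$ be the number of minimum-cardinality dominating sets of $G$ that have size at most $k$ (so it is $0$ if the domination number of $G$ exceeds $k$). For a vertex set $X$, let $N_G(X)$ be the set of vertices outside $X$ with a neighbour in $X$, and $G-X$ the graph obtained by deleting $X$. **Lemma.** There are a polynomial-time algorithm and an absolute constant $c$ such that the following holds. Given a finite simple planar graph $G$, a wide diamond $C$ of $G$ and an integer $k$, the algorithm outputs a finite simple planar graph $G'$, obtained from $G$ by replacing $C$ with some vertex set $C'\subseteq V(G')$, and an integer $k'$, such that - $\#\mathrm{minDS}(G,k)=\#\mathrm{minDS}(G',k')$, - $G-C=G'-C'$, - $N_G(C)=N_{G'}(C')$, - $|C'|\le c\cdot\log^2(|C|+1)$, and - $k\le k'\le k+c\cdot\log^2(|C|+1)$. -/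

import Mathlib

/-! ## Graphs

A finite simple graph with vertices named by natural numbers is a subgraph of the complete graph
on `ℕ` (its finiteness is part of being encoded by a finite list, see below). Vertex names are
kept when vertices are deleted, so that `G - C = G' - C'` is an honest equality. -/

/-- Simple undirected graphs whose vertex set is a set of natural numbers. -/
abbrev NatGraph : Type := SimpleGraph.Subgraph (⊤ : SimpleGraph ℕ)

/-- The open neighbourhood `N_G(X)` of a vertex set. -/
def openNbhd (G : NatGraph) (X : Set ℕ) : Set ℕ :=
  {w | (∃ x ∈ X, G.Adj x w) ∧ w ∉ X}

/-- The closed neighbourhood `N_G[X]` of a vertex set `X ⊆ V(G)`. -/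
def closedNbhd (G : NatGraph) (X : Set ℕ) : Set ℕ :=
  {w | w ∈ X ∨ ∃ x ∈ X, G.Adj x w}

/-- A planar embedding: vertices are distinct points of the plane, every edge is a simple curve
joining its two endpoints, and edges meet vertices and each other only at common endpoints. -/
structure PlanarEmbedding (G : NatGraph) where
  pos : ℕ → ℝ × ℝ
  arc : Sym2 ℕ → unitInterval → ℝ × ℝ
  pos_injOn : Set.InjOn pos G.verts
  arc_continuous : ∀ e ∈ G.edgeSet, Continuous (arc e)
  arc_injective : ∀ e ∈ G.edgeSet, Function.Injective (arc e)
  arc_ends : ∀ e ∈ G.edgeSet, s(arc e 0, arc e 1) = Sym2.map pos e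
  arc_ne_pos : ∀ e ∈ G.edgeSet, ∀ t : unitInterval, t ≠ 0 → t ≠ 1 →
    ∀ v ∈ G.verts, arc e t ≠ pos v
  arc_ne_arc : ∀ e ∈ G.edgeSet, ∀ e' ∈ G.edgeSet, e ≠ e' →
    ∀ t t' : unitInterval, t ≠ 0 → t ≠ 1 → t' ≠ 0 → t' ≠ 1 → arc e t ≠ arc e' t'

/-- A graph is planar if it has a planar embedding. -/
def IsPlanar (G : NatGraph) : Prop := Nonempty (PlanarEmbedding G)

/-- `C` is a wide diamond of `G`: there are distinct vertices `v, u` outside `C` such that every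
vertex of `C` has neighbourhood exactly `{v, u}`. -/
def IsWideDiamond (G : NatGraph) (C : Finset ℕ) : Prop :=
  (C : Set ℕ) ⊆ G.verts ∧
    ∃ v u : ℕ, v ∈ G.verts \ (C : Set ℕ) ∧ u ∈ G.verts \ (C : Set ℕ) ∧ v ≠ u ∧
      ∀ c ∈ C, G.neighborSet c = {v, u}

/-! ## Dominating sets -/

/-- `D` is a dominating set of `G`. -/
def IsDominatingSet (G : NatGraph) (D : Finset ℕ) : Prop :=
  (D : Set ℕ) ⊆ G.verts ∧ closedNbhd G (D : Set ℕ) = G.verts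

/-- `D` is a dominating set of `G` of minimum size. -/
def IsMinDominatingSet (G : NatGraph) (D : Finset ℕ) : Prop :=
  IsDominatingSet G D ∧ ∀ D' : Finset ℕ, IsDominatingSet G D' → D.card ≤ D'.card

/-- The number of minimum dominating sets of `G` that have size at most `k`. -/
noncomputable def numMinDS (G : NatGraph) (k : ℤ) : ℕ :=
  Set.ncard {D : Finset ℕ | IsMinDominatingSet G D ∧ (D.card : ℤ) ≤ k}

/-! ## A random access machine

Registers and memory cells hold integers. The instructions are those of the usual unit-cost RAM
with addition and subtraction as only arithmetic (no multiplication), which is polynomially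
equivalent to Turing machines; control flow is structured. -/

namespace RAM

/-- Programs. Arguments of type `ℕ` are register names. -/
inductive Cmd : Type
  | skip : Cmd
  | const (r : ℕ) (z : ℤ) : Cmd
  | add (r s t : ℕ) : Cmd
  | sub (r s t : ℕ) : Cmd
  | load (r s : ℕ) : Cmd
  | store (r s : ℕ) : Cmd
  | write (r : ℕ) : Cmd
  | seq (a b : Cmd) : Cmd
  | ifPos (r : ℕ) (a b : Cmd) : Cmd
  | whilePos (r : ℕ) (a : Cmd) : Cmd

/-- A configuration: registers, memory, and the word written so far on the output tape. -/
structure State : Type where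
  reg : ℕ → ℤ
  mem : ℤ → ℤ
  out : List ℤ

/-- `Exec a σ n τ`: started in `σ`, the program `a` halts in `τ` after exactly `n` steps, where
each basic instruction and each test of a branch or a loop is one step. -/
inductive Exec : Cmd → State → ℕ → State → Prop
  | skip (σ : State) : Exec .skip σ 1 σ
  | const (σ : State) (r : ℕ) (z : ℤ) :
      Exec (.const r z) σ 1 { σ with reg := Function.update σ.reg r z }
  | add (σ : State) (r s t : ℕ) :
      Exec (.add r s t) σ 1 { σ with reg := Function.update σ.reg r (σ.reg s + σ.reg t) }
  | sub (σ : State) (r s t : ℕ) :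
      Exec (.sub r s t) σ 1 { σ with reg := Function.update σ.reg r (σ.reg s - σ.reg t) }
  | load (σ : State) (r s : ℕ) :
      Exec (.load r s) σ 1 { σ with reg := Function.update σ.reg r (σ.mem (σ.reg s)) }
  | store (σ : State) (r s : ℕ) :
      Exec (.store r s) σ 1 { σ with mem := Function.update σ.mem (σ.reg r) (σ.reg s) }
  | write (σ : State) (r : ℕ) :
      Exec (.write r) σ 1 { σ with out := σ.out ++ [σ.reg r] }
  | seq {a b : Cmd} {σ τ υ : State} {m n : ℕ} :
      Exec a σ m τ → Exec b τ n υ → Exec (.seq a b) σ (m + n) υ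
  | ifPos_true {r : ℕ} {a b : Cmd} {σ τ : State} {n : ℕ} :
      0 < σ.reg r → Exec a σ n τ → Exec (.ifPos r a b) σ (1 + n) τ
  | ifPos_false {r : ℕ} {a b : Cmd} {σ τ : State} {n : ℕ} :
      ¬ 0 < σ.reg r → Exec b σ n τ → Exec (.ifPos r a b) σ (1 + n) τ
  | while_true {r : ℕ} {a : Cmd} {σ τ υ : State} {m n : ℕ} :
      0 < σ.reg r → Exec a σ m τ → Exec (.whilePos r a) τ n υ →
      Exec (.whilePos r a) σ (1 + m + n) υ
  | while_false {r : ℕ} {a : Cmd} {σ : State} :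
      ¬ 0 < σ.reg r → Exec (.whilePos r a) σ 1 σ

/-- The initial configuration on input `w`: the word stands in the memory cells
`0, …, w.length - 1`, its length in register `0`; everything else is zero, the output is empty. -/
def init (w : List ℤ) : State where
  reg := fun r => if r = 0 then (w.length : ℤ) else 0
  mem := fun i => if 0 ≤ i then w.getD i.toNat 0 else 0
  out := []

/-- On input `w` the program halts within `n` steps with output `w'`. -/
def OutputsWithin (a : Cmd) (w : List ℤ) (n : ℕ) (w' : List ℤ) : Prop :=
  ∃ (t : ℕ) (τ : State), t ≤ n ∧ Exec a (init w) t τ ∧ τ.out = w'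

/-- The length of an input word: the total number of bits of its entries, with one extra symbol
per entry (sign or separator). -/
def inputSize (w : List ℤ) : ℕ := (w.map fun z => z.natAbs.size + 1).sum

end RAM

/-! ## Encodings

A list of naturals or of pairs is written down entry by entry and closed by `-1`. -/

/-- `w` is an encoding of the finite set `S`: its elements in some order, closed by `-1`. -/
def EncodesSet (w : List ℤ) (S : Set ℕ) : Prop :=
  ∃ L : List ℕ, L.Nodup ∧ (∀ a, a ∈ L ↔ a ∈ S) ∧ w = L.map (fun a : ℕ => (a : ℤ)) ++ [-1]

/-- `w` is an encoding of the finite edge set `S`: each edge once, given by its two endpoints in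
either order, and the whole closed by `-1`. -/
def EncodesEdges (w : List ℤ) (S : Set (Sym2 ℕ)) : Prop :=
  ∃ L : List (ℕ × ℕ), (L.map fun p => s(p.1, p.2)).Nodup ∧
    (∀ e, e ∈ L.map (fun p => s(p.1, p.2)) ↔ e ∈ S) ∧
    w = L.flatMap (fun p : ℕ × ℕ => [(p.1 : ℤ), (p.2 : ℤ)]) ++ [-1]

/-- `w` is an encoding of the finite graph `G`: its vertices, then its edges. -/
def EncodesGraph (w : List ℤ) (G : NatGraph) : Prop :=
  ∃ x y : List ℤ, EncodesSet x G.verts ∧ EncodesEdges y G.edgeSet ∧ w = x ++ y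

/-- `w` is an encoding of the input `(G, C, k)`. -/
def EncodesInput (w : List ℤ) (G : NatGraph) (C : Finset ℕ) (k : ℤ) : Prop :=
  ∃ x y : List ℤ, EncodesGraph x G ∧ EncodesSet y (C : Set ℕ) ∧ w = x ++ y ++ [k]

/-- `w` is an encoding of the output `(G, k)`. -/
def EncodesOutput (w : List ℤ) (G : NatGraph) (k : ℤ) : Prop :=
  ∃ x : List ℤ, EncodesGraph x G ∧ w = x ++ [k]

/-! Let H = G - C, and let t be the least size of a dominating set of H that contains v or u.
Suppose C has at least three vertices. A dominating set of G that avoids v and u must contain all of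
C, and exchanging C for v and u makes it smaller; so every minimum dominating set contains v or u
and thereby dominates C. It then either misses C and is one of the A dominating sets of H that
contain v or u and have size t, or it contains exactly one vertex of C, whose only use is to
dominate the missing one of v and u. In the second case the rest is one of B sets of size t - 1 that
contain v or u and dominate H outside {v, u}. The number of minimum dominating sets is therefore A +
B * |C|, and A and B depend on H only. All that has to be preserved is the number |C|.

The replacement keeps some vertices of C as roots and hangs legs from them, that is, paths x, y, z
with x next to the root. Each leg costs exactly one vertex in a minimum dominating set, because z
has to be dominated. If the root is not chosen, this vertex must be y; if the root is chosen, it may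
be y or z. Hence domination numbers grow by the number of legs, and a root with b legs contributes 2
^ b ways instead of one: the count becomes A + B * ∑ 2 ^ b (`IsGadget.numMinDS_eq`). Two roots
without legs, together with the binary expansion of |C| - 2, give at least three roots of total
weight |C| on O(log² |C|) vertices, and k grows by the number of legs. For |C| ≥ 128 all names can
be taken from C; smaller diamonds are left as they are, which only affects the constant.

Planarity is a statement about topological drawings. The two edges at a root form an arc from v to
u, and an arc has empty interior (`interior_range_arc_eq_empty`), so close to the root there is a
point off the arc. The point of the drawing nearest to it lies on the arc; the root is slid there
(`PlanarEmbedding.exists_slide`), so that it lies on the boundary of an open disc free of the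
drawing (`PlanarEmbedding.exists_accessible`). All its legs are drawn in that disc as straight rays
(`isPlanar_of_attach`).

The algorithm is an explicit RAM program. It stores a flag for every name at a negative address: -1
for deleted vertices, 0 for roots and for vertices outside C, and the predecessor plus one for
vertices of legs. `Layout` relates the flags to the gadget, `RAM.halts_program` bounds the running
time quadratically, and `RAM.encodesOutput_replace` identifies the printed word with the graph
`IsNaming.replace`. -/

section

/-! ### Arcs, discs and rays in the plane. -/

open Set Metric

/-- A simple arc in the plane has empty interior. -/
theorem interior_range_arc_eq_empty {γ : unitInterval → ℝ × ℝ} (hc : Continuous γ)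
    (hi : Function.Injective γ) : interior (range γ) = ∅ := by
  by_contra hne
  obtain ⟨x, hx⟩ := nonempty_iff_ne_empty.mpr hne
  obtain ⟨ε, hε, hball⟩ := Metric.mem_nhds_iff.mp (mem_interior_iff_mem_nhds.mp hx)
  have hemb := (hc.isClosedEmbedding hi).isEmbedding
  set g : ℝ × ℝ → unitInterval := Function.invFun γ with hg
  have hleft : ∀ t, g (γ t) = t := Function.leftInverse_invFun hi
  -- The arc is a closed embedding, since its domain is compact, so the inverse parametrization is
  -- continuous on its image.
  have hgc : ContinuousOn g (range γ) := by
    rw [continuousOn_iff_continuous_domRestrict]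
    have : (range γ).domRestrict g = hemb.toHomeomorph.symm := by
      funext ⟨y, t, ht⟩
      subst ht
      have h2 : hemb.toHomeomorph.symm ⟨γ t, t, rfl⟩ = t := by
        rw [Homeomorph.symm_apply_eq]; rfl
      rw [h2]; exact hleft t
    rw [this]
    exact hemb.toHomeomorph.symm.continuous
  have hright : ∀ y ∈ range γ, γ (g y) = y := by
    rintro _ ⟨t, rfl⟩; rw [hleft]
  have hrank : 1 < Module.rank ℝ (ℝ × ℝ) := by
    simp only [rank_prod', Module.rank_self]; norm_num
  have hsp := isPreconnected_sphere hrank x (ε / 2)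
  have hsub : sphere x (ε / 2) ⊆ range γ := fun y hy => hball (by
    rw [mem_sphere] at hy; rw [mem_ball, hy]; linarith)
  have hanti : ∀ y ∈ sphere x (ε / 2), (x + x - y) ∈ sphere x (ε / 2) := by
    intro y hy
    rw [mem_sphere, dist_eq_norm] at hy ⊢
    rw [← hy, ← norm_neg]; congr 1; abel
  have hne : (sphere x (ε / 2)).Nonempty := by
    apply NormedSpace.sphere_nonempty.mpr; positivity
  obtain ⟨a, ha⟩ := hne
  have hc1 : ContinuousOn g (sphere x (ε / 2)) := hgc.mono hsub
  have hc2 : ContinuousOn (fun y => g (x + x - y)) (sphere x (ε / 2)) :=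
    hc1.comp (by fun_prop) hanti
  -- Borsuk–Ulam in dimension one: on the connected sphere, which lies in the image of the arc, the
  -- inverse takes the same value at some pair of antipodes. As `γ ∘ g` is the identity on the
  -- image, the antipodes coincide.
  have key : ∃ c ∈ sphere x (ε / 2), g c = g (x + x - c) := by
    rcases le_total (g a) (g (x + x - a)) with h | h
    · exact hsp.intermediate_value₂ ha (hanti a ha) hc1 hc2 h (by simpa using h)
    · exact hsp.intermediate_value₂ (hanti a ha) ha hc1 hc2 (by simpa using h) h
  obtain ⟨c, hcs, hceq⟩ := key
  have h1 : c = x + x - c := by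
    calc c = γ (g c) := (hright c (hsub hcs)).symm
      _ = γ (g (x + x - c)) := by rw [hceq]
      _ = _ := hright _ (hsub (hanti c hcs))
  have h2 : (2 : ℝ) • (c - x) = 0 := by
    rw [two_smul]; nth_rewrite 1 [h1]; abel
  have h3 : c = x := by
    rw [smul_eq_zero] at h2
    rcases h2 with h2 | h2
    · norm_num at h2
    · exact sub_eq_zero.mp h2
  rw [mem_sphere, h3, dist_self] at hcs
  linarith

/-- Rays into a disc from a point of its boundary. -/
theorem exists_rays {p y : ℝ × ℝ} {r : ℝ} (hr : 0 < r) (hp : dist y p = r) :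
    ∃ w : ℕ → ℝ × ℝ, (∀ n (s : ℝ), 0 < s → s ≤ 3 → p + s • w n ∈ ball y r) ∧
      ∀ n n' (s s' : ℝ), 0 < s → 0 < s' → p + s • w n = p + s' • w n' → n = n' ∧ s = s' := by
  obtain ⟨p1, p2⟩ := p
  obtain ⟨y1, y2⟩ := y
  rw [Prod.dist_eq] at hp
  simp only [Real.dist_eq] at hp
  have hα : |y1 - p1| ≤ r := hp ▸ le_max_left _ _
  have hβ : |y2 - p2| ≤ r := hp ▸ le_max_right _ _
  have hpos : 0 < (y1 - p1) ^ 2 + (y2 - p2) ^ 2 := by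
    by_contra hcon
    have h1 : y1 - p1 = 0 := by nlinarith [sq_nonneg (y1 - p1), sq_nonneg (y2 - p2)]
    have h2 : y2 - p2 = 0 := by nlinarith [sq_nonneg (y1 - p1), sq_nonneg (y2 - p2)]
    rw [h1, h2] at hp
    simp at hp
    linarith
  generalize hA : y1 - p1 = α at *
  generalize hB : y2 - p2 = β at *
  -- The metric is the maximum metric, so the disc is a square. With d = (α, β) the vector from p to
  -- the centre and d' = (-β, α), the n-th direction is (d + a d') / 3 for the slope a = 1 / (n + 2)
  -- < 1.
  refine ⟨fun n => ((1 / 3) * (α - (1 / ((n : ℝ) + 2)) * β),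
    (1 / 3) * (β + (1 / ((n : ℝ) + 2)) * α)), ?_, ?_⟩
  · intro n s hs hs3
    have ha : 0 < 1 / ((n : ℝ) + 2) := by positivity
    have ha1 : 1 / ((n : ℝ) + 2) < 1 := by
      rw [div_lt_one (by positivity)]; linarith [(Nat.cast_nonneg n : (0 : ℝ) ≤ n)]
    beta_reduce
    generalize 1 / ((n : ℝ) + 2) = a at ha ha1 ⊢
    -- Each coordinate of the offset from the centre is bounded by (1 - s/3) r + (s/3) a r, which is
    -- less than r because a < 1.
    have key : ∀ X Y : ℝ, |X| ≤ r → |Y| ≤ r → |-(1 - s / 3) * X + (s / 3) * a * Y| < r := by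
      intro X Y hX hY
      have h1 : |-(1 - s / 3) * X| ≤ (1 - s / 3) * r := by
        rw [abs_mul, abs_neg, abs_of_nonneg (by linarith)]
        exact mul_le_mul_of_nonneg_left hX (by linarith)
      have h2 : |(s / 3) * a * Y| ≤ (s / 3) * a * r := by
        rw [abs_mul, abs_of_pos (by positivity)]
        exact mul_le_mul_of_nonneg_left hY (by positivity)
      have h3 : (s / 3) * a * r < (s / 3) * r := by
        have : 0 < (s / 3) * r := by positivity
        nlinarith
      calc _ ≤ _ := abs_add_le _ _
        _ < r := by linarith
    rw [mem_ball, Prod.dist_eq, max_lt_iff]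
    simp only [Real.dist_eq, Prod.smul_mk, Prod.mk_add_mk, smul_eq_mul]
    constructor
    · have := key α (-β) hα (by rwa [abs_neg])
      calc _ = |-(1 - s / 3) * α + s / 3 * a * -β| := by rw [← hA]; congr 1; ring
        _ < r := this
    · have := key β α hβ hα
      calc _ = |-(1 - s / 3) * β + s / 3 * a * α| := by rw [← hB]; congr 1; ring
        _ < r := this
  · intro n n' s s' hs hs' h
    have h := add_left_cancel h
    simp only [Prod.smul_mk, smul_eq_mul, Prod.mk.injEq] at h
    obtain ⟨h1, h2⟩ := h
    generalize ha : 1 / ((n : ℝ) + 2) = a at *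
    generalize ha' : 1 / ((n' : ℝ) + 2) = a' at *
    -- The inner products with d and d' recover s and s * a, hence the ray and the position on it.
    have e1 : (s - s') * (α ^ 2 + β ^ 2) = 0 := by linear_combination 3 * α * h1 + 3 * β * h2
    have e2 : (s * a - s' * a') * (α ^ 2 + β ^ 2) = 0 := by
      linear_combination 3 * α * h2 - 3 * β * h1
    have f1 : s = s' := by
      rcases mul_eq_zero.mp e1 with h | h
      · linarith
      · linarith
    have f2 : s * a = s' * a' := by
      rcases mul_eq_zero.mp e2 with h | h
      · linarith
      · linarith
    refine ⟨?_, f1⟩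
    rw [← f1] at f2
    have f3 : a = a' := mul_left_cancel₀ hs.ne' f2
    rw [← ha, ← ha', one_div, one_div, inv_inj] at f3
    have : (n : ℝ) = n' := by linarith
    exact_mod_cast this

namespace PlanarEmbedding

variable {G : NatGraph}

/-- The points of the plane covered by a planar embedding. -/
def drawing (E : PlanarEmbedding G) : Set (ℝ × ℝ) :=
  E.pos '' G.verts ∪ ⋃ e ∈ G.edgeSet, range (E.arc e)

/-- Restriction of a planar embedding to a subgraph. -/
def restrict {H : NatGraph} (E : PlanarEmbedding G) (h : H ≤ G) : PlanarEmbedding H where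
  pos := E.pos
  arc := E.arc
  pos_injOn := E.pos_injOn.mono h.1
  arc_continuous e he := E.arc_continuous e (SimpleGraph.Subgraph.edgeSet_mono h he)
  arc_injective e he := E.arc_injective e (SimpleGraph.Subgraph.edgeSet_mono h he)
  arc_ends e he := E.arc_ends e (SimpleGraph.Subgraph.edgeSet_mono h he)
  arc_ne_pos e he t h0 h1 v hv :=
    E.arc_ne_pos e (SimpleGraph.Subgraph.edgeSet_mono h he) t h0 h1 v (h.1 hv)
  arc_ne_arc e he e' he' := E.arc_ne_arc e (SimpleGraph.Subgraph.edgeSet_mono h he) e'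
    (SimpleGraph.Subgraph.edgeSet_mono h he')

/-- An edge, traversed from a given endpoint. -/
theorem exists_oriented (E : PlanarEmbedding G) {a b : ℕ} (h : G.Adj a b) :
    ∃ η : Path (E.pos a) (E.pos b), Function.Injective η ∧ range η = range (E.arc s(a, b)) ∧
      ∀ t, t ≠ 0 → t ≠ 1 → ∃ t', t' ≠ 0 ∧ t' ≠ 1 ∧ η t = E.arc s(a, b) t' := by
  have he : s(a, b) ∈ G.edgeSet := h
  have hends := E.arc_ends _ he
  rw [Sym2.map_mk, Sym2.eq_iff] at hends
  rcases hends with ⟨h0, h1⟩ | ⟨h0, h1⟩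
  · exact ⟨⟨⟨E.arc s(a, b), E.arc_continuous _ he⟩, h0, h1⟩, E.arc_injective _ he, rfl,
      fun t ht0 ht1 => ⟨t, ht0, ht1, rfl⟩⟩
  · refine ⟨⟨⟨fun t => E.arc s(a, b) (unitInterval.symm t),
      (E.arc_continuous _ he).comp unitInterval.continuous_symm⟩, ?_, ?_⟩, ?_, ?_, ?_⟩
    · simpa using h1
    · simpa using h0
    · exact (E.arc_injective _ he).comp unitInterval.symm_bijective.injective
    · exact unitInterval.symm_bijective.surjective.range_comp _
    · intro t ht0 ht1
      refine ⟨unitInterval.symm t, ?_, ?_, rfl⟩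
      · simpa [unitInterval.symm_eq_zero] using ht1
      · simpa [unitInterval.symm_eq_one] using ht0

end PlanarEmbedding

end

/-! ### Sliding a vertex of degree two to a point accessible from a disc. -/

section

open Set Metric

/-- Two arcs that share only the end of the first and the start of the second form an arc. -/
theorem Path.injective_trans {X : Type*} [TopologicalSpace X] {a b c : X} (η : Path a b)
    (θ : Path b c) (hη : Function.Injective η) (hθ : Function.Injective θ)
    (h : ∀ s t, η s = θ t → s = 1 ∧ t = 0) : Function.Injective (η.trans θ) := by
  intro s t hst
  rw [Path.trans_apply, Path.trans_apply] at hst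
  split_ifs at hst with h1 h2 h2
  · have := congrArg Subtype.val (hη hst)
    apply Subtype.ext
    simp only at this
    linarith
  · obtain ⟨e1, e2⟩ := h _ _ hst
    have e1 := congrArg Subtype.val e1
    have e2 := congrArg Subtype.val e2
    simp only [Set.Icc.coe_one, Set.Icc.coe_zero] at e1 e2
    exfalso; apply h2; linarith
  · obtain ⟨e1, e2⟩ := h _ _ hst.symm
    have e1 := congrArg Subtype.val e1
    have e2 := congrArg Subtype.val e2
    simp only [Set.Icc.coe_one, Set.Icc.coe_zero] at e1 e2
    exfalso; apply h1; linarith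
  · have := congrArg Subtype.val (hθ hst)
    apply Subtype.ext
    simp only at this
    linarith

/-- The cases are the parameters below, at and above one half. They reduce claims about the joined
curve to the two edges and the vertex between them. -/
theorem Path.trans_cases {X : Type*} [TopologicalSpace X] {a b c : X} (η : Path a b)
    (θ : Path b c) {t : unitInterval} (h0 : t ≠ 0) (h1 : t ≠ 1) :
    (∃ s, s ≠ 0 ∧ s ≠ 1 ∧ η.trans θ t = η s) ∨ η.trans θ t = b ∨
      ∃ s, s ≠ 0 ∧ s ≠ 1 ∧ η.trans θ t = θ s := by
  have h0' : (t : ℝ) ≠ 0 := fun h => h0 (Subtype.ext h)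
  have h1' : (t : ℝ) ≠ 1 := fun h => h1 (Subtype.ext h)
  rcases lt_trichotomy (t : ℝ) (1 / 2) with h | h | h
  · left
    refine ⟨⟨2 * (t : ℝ), (unitInterval.mul_pos_mem_iff zero_lt_two).2 ⟨t.2.1, h.le⟩⟩,
      ?_, ?_, by rw [Path.trans_apply, dif_pos h.le]⟩
    · intro hh
      have hh := congrArg Subtype.val hh
      simp at hh; exact h0 hh
    · intro hh
      have hh := congrArg Subtype.val hh
      simp at hh; linarith
  · right; left
    rw [Path.trans_apply, dif_pos h.le]
    have : (⟨2 * (t : ℝ), (unitInterval.mul_pos_mem_iff zero_lt_two).2 ⟨t.2.1, h.le⟩⟩ : unitInterval) = 1 :=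
      Subtype.ext (by simp [h])
    rw [this]; exact η.target
  · right; right
    refine ⟨⟨2 * (t : ℝ) - 1, unitInterval.two_mul_sub_one_mem_iff.2 ⟨h.le, t.2.2⟩⟩,
      ?_, ?_, by rw [Path.trans_apply, dif_neg (not_le.mpr h)]⟩
    · intro hh
      have hh := congrArg Subtype.val hh
      simp at hh; linarith
    · intro hh
      have hh := congrArg Subtype.val hh
      simp at hh; apply h1'; linarith

theorem unitInterval.mul_ne_one {s t : unitInterval} (h : t ≠ 1) : s * t ≠ 1 := by
  intro hh
  have : s * t ≤ t := unitInterval.mul_le_right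
  rw [hh] at this
  exact h (le_antisymm unitInterval.le_one' this)

namespace PlanarEmbedding

variable {G : NatGraph}

/-- The drawing without the two edges at a vertex `c` of degree two and `c` itself. -/
def drawingAway (E : PlanarEmbedding G) (c : ℕ) : Set (ℝ × ℝ) :=
  E.pos '' (G.verts \ {c}) ∪ ⋃ e ∈ {e ∈ G.edgeSet | c ∉ e}, range (E.arc e)

theorem edgeSet_finite (hfin : G.verts.Finite) : G.edgeSet.Finite := by
  apply ((hfin.prod hfin).image (fun p : ℕ × ℕ => s(p.1, p.2))).subset
  intro e
  induction e with
  | h a b => exact fun h => ⟨(a, b), ⟨G.edge_vert h, G.edge_vert (SimpleGraph.Subgraph.Adj.symm h)⟩, rfl⟩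

/-- Finiteness of the graph enters planarity here: closedness provides a disc around the vertex free
of the other edges, and nearest points of the drawing. -/
theorem isClosed_drawingAway (E : PlanarEmbedding G) (hfin : G.verts.Finite) (c : ℕ) :
    IsClosed (E.drawingAway c) := by
  apply IsClosed.union
  · exact ((hfin.subset sdiff_subset).image _).isClosed
  · apply Set.Finite.isClosed_biUnion ((edgeSet_finite hfin).subset (sep_subset _ _))
    intro e he
    exact (isCompact_range (E.arc_continuous e he.1)).isClosed

theorem arc_mem_pos (E : PlanarEmbedding G) {e : Sym2 ℕ} (he : e ∈ G.edgeSet) {t : unitInterval}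
    (ht : t = 0 ∨ t = 1) : ∃ a ∈ e, E.arc e t = E.pos a := by
  have hends := E.arc_ends e he
  have h1 : E.arc e t ∈ s(E.arc e 0, E.arc e 1) := by
    rcases ht with rfl | rfl <;> simp
  rw [hends, Sym2.mem_map] at h1
  obtain ⟨a, ha, h⟩ := h1
  exact ⟨a, ha, h.symm⟩

theorem mem_verts_of_mem_edge {e : Sym2 ℕ} (he : e ∈ G.edgeSet) {a : ℕ} (ha : a ∈ e) :
    a ∈ G.verts := by
  induction e with
  | h b d =>
    rcases Sym2.mem_iff.mp ha with rfl | rfl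
    · exact G.edge_vert he
    · exact G.edge_vert (SimpleGraph.Subgraph.Adj.symm he)

theorem pos_notMem_drawingAway (E : PlanarEmbedding G) {c : ℕ} (hc : c ∈ G.verts) :
    E.pos c ∉ E.drawingAway c := by
  rintro (⟨a, ⟨ha, hac⟩, h⟩ | h)
  · exact hac (E.pos_injOn ha hc h)
  · simp only [mem_iUnion, mem_range] at h
    obtain ⟨e, ⟨he, hce⟩, t, ht⟩ := h
    by_cases h01 : t = 0 ∨ t = 1
    · obtain ⟨a, ha, h⟩ := E.arc_mem_pos he h01
      rw [ht] at h
      exact hce (E.pos_injOn hc (mem_verts_of_mem_edge he ha) h ▸ ha)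
    · push Not at h01
      exact E.arc_ne_pos e he t h01.1 h01.2 c hc ht

theorem arc_notMem_drawingAway (E : PlanarEmbedding G) {c a : ℕ} (h : G.Adj c a)
    {t : unitInterval} (h0 : t ≠ 0) (h1 : t ≠ 1) : E.arc s(c, a) t ∉ E.drawingAway c := by
  have he : s(c, a) ∈ G.edgeSet := h
  rintro (⟨b, ⟨hb, -⟩, h⟩ | h)
  · exact E.arc_ne_pos _ he t h0 h1 b hb h.symm
  · simp only [mem_iUnion, mem_range] at h
    obtain ⟨e, ⟨he', hce⟩, t', ht⟩ := h
    by_cases h01 : t' = 0 ∨ t' = 1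
    · obtain ⟨b, hb, h⟩ := E.arc_mem_pos he' h01
      exact E.arc_ne_pos _ he t h0 h1 b (mem_verts_of_mem_edge he' hb) (ht.symm.trans h)
    · push Not at h01
      exact E.arc_ne_arc e he' _ he (by rintro rfl; simp at hce) t' t h01.1 h01.2 h0 h1 ht

/-- A vertex of degree two can be moved along the curve formed by its two edges. -/
theorem exists_slide (E : PlanarEmbedding G) {c v u : ℕ} (hvu : v ≠ u)
    (hc : ∀ a, G.Adj c a ↔ a = v ∨ a = u) :
    ∃ γ : Path (E.pos v) (E.pos u), Function.Injective γ ∧ E.pos c ∈ range γ ∧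
      (∀ t, t ≠ 0 → t ≠ 1 → γ t ∉ E.drawingAway c) ∧
      ∀ τ, τ ≠ 0 → τ ≠ 1 → ∃ E' : PlanarEmbedding G, E'.pos c = γ τ ∧
        E'.drawing ⊆ E.drawingAway c ∪ range γ := by
  have hcv : G.Adj c v := (hc v).mpr (Or.inl rfl)
  have hcu : G.Adj c u := (hc u).mpr (Or.inr rfl)
  have hcV := G.edge_vert hcv
  have hvV := G.edge_vert (SimpleGraph.Subgraph.Adj.symm hcv)
  have huV := G.edge_vert (SimpleGraph.Subgraph.Adj.symm hcu)
  have hcnv : c ≠ v := fun h => (G.adj_sub hcv).ne h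
  have hcnu : c ≠ u := fun h => (G.adj_sub hcu).ne h
  obtain ⟨η, hηi, -, hηin⟩ := E.exists_oriented (SimpleGraph.Subgraph.Adj.symm hcv)
  obtain ⟨θ, hθi, -, hθin⟩ := E.exists_oriented hcu
  rw [Sym2.eq_swap] at hηin
  have hne : s(c, v) ≠ s(c, u) := by
    intro h; rw [Sym2.eq_iff] at h; rcases h with ⟨-, h⟩ | ⟨h, -⟩
    · exact hvu h
    · exact hcnu h
  -- The two edges share no point except the vertex between them: interiors of edges avoid vertices
  -- and each other, and the far ends differ as v ≠ u.
  have hηθ : ∀ s t, η s = θ t → s = 1 ∧ t = 0 := by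
    have hηp : ∀ s, s ≠ 0 → s ≠ 1 → ∀ b ∈ G.verts, η s ≠ E.pos b := by
      intro s h0 h1 b hb h
      obtain ⟨s', h0', h1', hs'⟩ := hηin s h0 h1
      exact E.arc_ne_pos _ hcv s' h0' h1' b hb (hs' ▸ h)
    have hθp : ∀ s, s ≠ 0 → s ≠ 1 → ∀ b ∈ G.verts, θ s ≠ E.pos b := by
      intro s h0 h1 b hb h
      obtain ⟨s', h0', h1', hs'⟩ := hθin s h0 h1
      exact E.arc_ne_pos _ hcu s' h0' h1' b hb (hs' ▸ h)
    intro s t hst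
    by_cases hs0 : s = 0
    · exfalso
      rw [hs0, η.source] at hst
      by_cases ht0 : t = 0
      · rw [ht0, θ.source] at hst
        exact hcnv (E.pos_injOn hvV hcV hst).symm
      by_cases ht1 : t = 1
      · rw [ht1, θ.target] at hst
        exact hvu (E.pos_injOn hvV huV hst)
      exact hθp t ht0 ht1 v hvV hst.symm
    by_cases hs1 : s = 1
    · refine ⟨hs1, ?_⟩
      rw [hs1, η.target] at hst
      exact (hθi (θ.source.trans hst)).symm
    exfalso
    by_cases ht0 : t = 0
    · rw [ht0, θ.source] at hst
      exact hηp s hs0 hs1 c hcV hst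
    by_cases ht1 : t = 1
    · rw [ht1, θ.target] at hst
      exact hηp s hs0 hs1 u huV hst
    obtain ⟨s', h0', h1', hs'⟩ := hηin s hs0 hs1
    obtain ⟨t', h0'', h1'', ht'⟩ := hθin t ht0 ht1
    exact E.arc_ne_arc _ hcv _ hcu hne s' t' h0' h1' h0'' h1'' (by rw [← hs', ← ht', hst])
  set γ := η.trans θ with hγ
  have hγi : Function.Injective γ := Path.injective_trans η θ hηi hθi hηθ
  have hγaway : ∀ t, t ≠ 0 → t ≠ 1 → γ t ∉ E.drawingAway c := by
    intro t h0 h1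
    rcases Path.trans_cases η θ h0 h1 with ⟨s, s0, s1, hs⟩ | hs | ⟨s, s0, s1, hs⟩
    · obtain ⟨s', h0', h1', hs'⟩ := hηin s s0 s1
      rw [hγ, hs, hs']
      exact E.arc_notMem_drawingAway hcv h0' h1'
    · rw [hγ, hs]; exact E.pos_notMem_drawingAway hcV
    · obtain ⟨s', h0', h1', hs'⟩ := hθin s s0 s1
      rw [hγ, hs, hs']
      exact E.arc_notMem_drawingAway hcu h0' h1'
  refine ⟨γ, hγi, ?_, hγaway, ?_⟩
  · rw [hγ, Path.trans_range]; exact Or.inl ⟨1, η.target⟩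
  intro τ hτ0 hτ1
  have hσ0 : unitInterval.symm τ ≠ 0 := by simpa [unitInterval.symm_eq_zero] using hτ1
  have hσ1 : unitInterval.symm τ ≠ 1 := by simpa [unitInterval.symm_eq_one] using hτ0
  -- the parameters of the two new arcs
  let φ : unitInterval → unitInterval := fun t => t * τ
  let ψ : unitInterval → unitInterval := fun t => unitInterval.symm (unitInterval.symm t * unitInterval.symm τ)
  have hφc : Continuous φ := by fun_prop
  have hψc : Continuous ψ := by
    exact unitInterval.continuous_symm.comp (unitInterval.continuous_symm.mul continuous_const)
  have hφi : Function.Injective φ := fun s t h => mul_right_cancel₀ hτ0 h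
  have hψi : Function.Injective ψ := fun s t h =>
    unitInterval.symm_bijective.injective
      (mul_right_cancel₀ hσ0 (unitInterval.symm_bijective.injective h))
  have hφ0 : φ 0 = 0 := zero_mul _
  have hφ1 : φ 1 = τ := one_mul _
  have hψ0 : ψ 0 = τ := by simp [ψ]
  have hψ1 : ψ 1 = 1 := by simp [ψ]
  have hφn0 : ∀ t, t ≠ 0 → φ t ≠ 0 := fun t h => mul_ne_zero h hτ0
  have hφn1 : ∀ t, φ t ≠ 1 := fun t => unitInterval.mul_ne_one hτ1
  have hψn0 : ∀ t, ψ t ≠ 0 := fun t h => by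
    rw [unitInterval.symm_eq_zero] at h
    exact unitInterval.mul_ne_one hσ1 h
  have hψn1 : ∀ t, t ≠ 1 → ψ t ≠ 1 := fun t h h' => by
    rw [unitInterval.symm_eq_one] at h'
    exact mul_ne_zero (by simpa [unitInterval.symm_eq_zero] using h) hσ0 h'
  -- `φ` stays in [0, τ], while `ψ t` exceeds τ as soon as t > 0.
  have hφψ : ∀ s t, t ≠ 0 → φ s ≠ ψ t := by
    intro s t ht h
    have h := congrArg Subtype.val h
    have hs := s.2.2
    have hτ := lt_of_le_of_ne τ.2.2 (fun h => hτ1 (Subtype.ext h))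
    have ht := lt_of_le_of_ne t.2.1 (fun h => ht (Subtype.ext h.symm))
    simp only [φ, ψ, unitInterval.coe_symm_eq, Set.Icc.coe_mul] at h
    nlinarith [τ.2.1, mul_pos ht (sub_pos.mpr hτ), mul_nonneg (sub_nonneg.mpr hs) τ.2.1]
  have hcase : ∀ e ∈ G.edgeSet, e = s(c, v) ∨ e = s(c, u) ∨ c ∉ e := by
    intro e he
    by_cases hce : c ∈ e
    · obtain ⟨a, rfl⟩ := Sym2.mem_iff_exists.mp hce
      rcases (hc a).mp he with rfl | rfl <;> simp
    · exact Or.inr (Or.inr hce)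
  have harc_away : ∀ e ∈ G.edgeSet, c ∉ e → ∀ t, E.arc e t ∈ E.drawingAway c := fun e he hce t =>
    Or.inr (mem_biUnion (x := e) ⟨he, hce⟩ ⟨t, rfl⟩)
  have hpos_away : ∀ a ∈ G.verts, a ≠ c → E.pos a ∈ E.drawingAway c := fun a ha hac =>
    Or.inl ⟨a, ⟨ha, hac⟩, rfl⟩
  -- The curve runs from v to u. With the vertex moved to parameter τ, the piece before τ becomes
  -- its edge to v and the piece after τ its edge to u.
  let arc' : Sym2 ℕ → unitInterval → ℝ × ℝ := fun e =>
    if e = s(c, v) then γ ∘ φ else if e = s(c, u) then γ ∘ ψ else E.arc e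
  have harc1 : arc' s(c, v) = γ ∘ φ := if_pos rfl
  have harc2 : arc' s(c, u) = γ ∘ ψ := by
    change (if s(c, u) = s(c, v) then _ else if s(c, u) = s(c, u) then _ else _) = _
    rw [if_neg hne.symm, if_pos rfl]
  have harc3 : ∀ e, c ∉ e → arc' e = E.arc e := by
    intro e he
    simp only [arc']; rw [if_neg, if_neg]
    · rintro rfl; simp at he
    · rintro rfl; simp at he
  have hγV : ∀ t, t ≠ 0 → t ≠ 1 → ∀ a ∈ G.verts, a ≠ c → γ t ≠ E.pos a :=
    fun t h0 h1 a ha hac h => hγaway t h0 h1 (h ▸ hpos_away a ha hac)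
  let E' : PlanarEmbedding G :=
    { pos := Function.update E.pos c (γ τ)
      arc := arc'
      pos_injOn := by
        intro a ha b hb hab
        by_cases hac : a = c <;> by_cases hbc : b = c
        · rw [hac, hbc]
        · subst hac
          rw [Function.update_self, Function.update_of_ne hbc] at hab
          exact absurd hab (hγV τ hτ0 hτ1 b hb hbc)
        · subst hbc
          rw [Function.update_self, Function.update_of_ne hac] at hab
          exact absurd hab.symm (hγV τ hτ0 hτ1 a ha hac)
        · rw [Function.update_of_ne hac, Function.update_of_ne hbc] at hab
          exact E.pos_injOn ha hb hab
      arc_continuous := by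
        intro e he
        rcases hcase e he with rfl | rfl | h
        · rw [harc1]; exact γ.continuous.comp hφc
        · rw [harc2]; exact γ.continuous.comp hψc
        · rw [harc3 e h]; exact E.arc_continuous e he
      arc_injective := by
        intro e he
        rcases hcase e he with rfl | rfl | h
        · rw [harc1]; exact hγi.comp hφi
        · rw [harc2]; exact hγi.comp hψi
        · rw [harc3 e h]; exact E.arc_injective e he
      arc_ends := by
        intro e he
        rcases hcase e he with rfl | rfl | h
        · rw [harc1, Sym2.map_mk, Function.comp_apply, Function.comp_apply, hφ0, hφ1,
            Function.update_self, Function.update_of_ne hcnv.symm, γ.source, Sym2.eq_swap]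
        · rw [harc2, Sym2.map_mk, Function.comp_apply, Function.comp_apply, hψ0, hψ1,
            Function.update_self, Function.update_of_ne hcnu.symm, γ.target]
        · rw [harc3 e h, E.arc_ends e he]
          apply Sym2.map_congr
          intro a ha
          rw [Function.update_of_ne]
          rintro rfl; exact h ha
      arc_ne_pos := by
        intro e he t h0 h1 a ha
        by_cases hac : a = c
        · subst hac
          rw [Function.update_self]
          rcases hcase e he with rfl | rfl | h
          · rw [harc1]; intro h
            exact h1 (hφi ((hγi h).trans hφ1.symm))
          · rw [harc2]; intro h
            exact h0 (hψi ((hγi h).trans hψ0.symm))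
          · rw [harc3 e h]
            exact fun h' => hγaway τ hτ0 hτ1 (h' ▸ harc_away e he h t)
        · rw [Function.update_of_ne hac]
          rcases hcase e he with rfl | rfl | h
          · rw [harc1]; exact hγV _ (hφn0 t h0) (hφn1 t) a ha hac
          · rw [harc2]; exact hγV _ (hψn0 t) (hψn1 t h1) a ha hac
          · rw [harc3 e h]; exact E.arc_ne_pos e he t h0 h1 a ha
      arc_ne_arc := by
        have H1 : ∀ e ∈ G.edgeSet, c ∉ e → ∀ t t', t ≠ 0 → t ≠ 1 → γ t ≠ E.arc e t' :=
          fun e he hce t t' h0 h1 h => hγaway t h0 h1 (h ▸ harc_away e he hce t')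
        intro e he e' he' hee t t' h0 h1 h0' h1'
        rcases hcase e he with rfl | rfl | h <;> rcases hcase e' he' with rfl | rfl | h'
        · exact absurd rfl hee
        · rw [harc1, harc2]; exact fun h => hφψ t t' h0' (hγi h)
        · rw [harc1, harc3 e' h']; exact H1 e' he' h' _ _ (hφn0 t h0) (hφn1 t)
        · rw [harc1, harc2]; exact fun h => hφψ t' t h0 (hγi h).symm
        · exact absurd rfl hee
        · rw [harc2, harc3 e' h']; exact H1 e' he' h' _ _ (hψn0 t) (hψn1 t h1)
        · rw [harc1, harc3 e h]; exact (H1 e he h _ _ (hφn0 t' h0') (hφn1 t')).symm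
        · rw [harc2, harc3 e h]; exact (H1 e he h _ _ (hψn0 t') (hψn1 t' h1')).symm
        · rw [harc3 e h, harc3 e' h']; exact E.arc_ne_arc e he e' he' hee t t' h0 h1 h0' h1' }
  refine ⟨E', Function.update_self .., ?_⟩
  apply union_subset
  · rintro _ ⟨a, ha, rfl⟩
    by_cases hac : a = c
    · subst hac; exact Or.inr ⟨τ, (Function.update_self (f := E.pos) ..).symm⟩
    · left
      change Function.update E.pos c (γ τ) a ∈ _
      rw [Function.update_of_ne hac]
      exact hpos_away a ha hac
  · apply iUnion₂_subset
    rintro e he _ ⟨t, rfl⟩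
    change arc' e t ∈ _
    rcases hcase e he with rfl | rfl | h
    · rw [harc1]; exact Or.inr ⟨_, rfl⟩
    · rw [harc2]; exact Or.inr ⟨_, rfl⟩
    · rw [harc3 e h]; exact Or.inl (harc_away e he h t)

/-- A vertex of degree two can be placed on the boundary of a disc avoiding the drawing. -/
theorem exists_accessible (E : PlanarEmbedding G) (hfin : G.verts.Finite) {c v u : ℕ}
    (hvu : v ≠ u) (hc : ∀ a, G.Adj c a ↔ a = v ∨ a = u) :
    ∃ (E' : PlanarEmbedding G) (y : ℝ × ℝ) (r : ℝ), 0 < r ∧ dist y (E'.pos c) = r ∧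
      Disjoint (ball y r) E'.drawing := by
  obtain ⟨γ, hγi, hcγ, hγaway, hslide⟩ := E.exists_slide hvu hc
  have hcv : G.Adj c v := (hc v).mpr (Or.inl rfl)
  have hcu : G.Adj c u := (hc u).mpr (Or.inr rfl)
  have hcV := G.edge_vert hcv
  have hvV := G.edge_vert hcv.symm
  have huV := G.edge_vert hcu.symm
  have hcl := E.isClosed_drawingAway hfin c
  obtain ⟨δ, hδ, hball⟩ := Metric.mem_nhds_iff.mp
    (hcl.isOpen_compl.mem_nhds (E.pos_notMem_drawingAway hcV))
  have hint := interior_range_arc_eq_empty γ.continuous hγi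
  rw [interior_eq_empty_iff_dense_compl] at hint
  -- An arc has empty interior, so some point y off the curve lies within δ / 2 of the vertex.
  obtain ⟨y, hyb, hyγ⟩ := hint.exists_mem_open (isOpen_ball (x := E.pos c) (ε := δ / 2))
    ⟨E.pos c, mem_ball_self (by positivity)⟩ |>.imp fun _ h => h.symm
  have hγcomp : IsCompact (range γ) := isCompact_range γ.continuous
  have hDcl : IsClosed (E.drawingAway c ∪ range γ) := hcl.union hγcomp.isClosed
  -- The nearest point p is no farther from y than the old position of the vertex, hence within δ of
  -- that position. It avoids the other parts of the drawing, so it is an interior point of the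
  -- curve, and the open disc around y through p is free.
  obtain ⟨p, hp, hdist⟩ := hDcl.exists_infDist_eq_dist ⟨_, Or.inr hcγ⟩ y
  have hmin : ∀ z ∈ E.drawingAway c ∪ range γ, dist y p ≤ dist y z := fun z hz =>
    hdist ▸ infDist_le_dist_of_mem hz
  rw [mem_ball] at hyb
  have h1 : dist y p < δ / 2 := (hmin _ (Or.inr hcγ)).trans_lt hyb
  have hpaway : p ∉ E.drawingAway c := by
    have : dist p (E.pos c) < δ := by
      calc dist p (E.pos c) ≤ dist p y + dist y (E.pos c) := dist_triangle _ _ _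
        _ < δ := by rw [dist_comm p y]; linarith
    exact hball this
  obtain ⟨τ, rfl⟩ := hp.resolve_left hpaway
  have hτ0 : τ ≠ 0 := by
    rintro rfl
    rw [γ.source] at hpaway
    exact hpaway (Or.inl ⟨v, ⟨hvV, (G.adj_sub hcv).ne'⟩, rfl⟩)
  have hτ1 : τ ≠ 1 := by
    rintro rfl
    rw [γ.target] at hpaway
    exact hpaway (Or.inl ⟨u, ⟨huV, (G.adj_sub hcu).ne'⟩, rfl⟩)
  obtain ⟨E', hE'c, hE'd⟩ := hslide τ hτ0 hτ1
  refine ⟨E', y, dist y (γ τ), ?_, by rw [hE'c], ?_⟩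
  · rw [dist_pos]; rintro rfl
    exact hyγ ⟨τ, rfl⟩
  · rw [Set.disjoint_left]
    intro z hz hzd
    have := hmin z (hE'd hzd)
    rw [mem_ball, dist_comm] at hz
    linarith

end PlanarEmbedding

end

/-! ### Drawing legs inside the free disc. -/

section

open Set Metric

/-- An edge of a leg is determined by its outer end. A match with reversed ends would make each
index the successor of the other, or identify the root with a new vertex. -/
theorem leg_edge_unique {ι : Type*} {J : Set ι} {W : Set ℕ} {c : ℕ} {node : ι → ℕ → ℕ}
    (hcW : c ∈ W) (h0 : ∀ j ∈ J, node j 0 = c)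
    (hnew : ∀ j ∈ J, ∀ k < 3, node j (k + 1) ∉ W)
    (hinj : ∀ j ∈ J, ∀ j' ∈ J, ∀ k < 3, ∀ k' < 3, node j (k + 1) = node j' (k' + 1) →
      j = j' ∧ k = k') {j j' : ι} (hj : j ∈ J) (hj' : j' ∈ J) {k k' : ℕ} (hk : k < 3)
    (hk' : k' < 3) (h : s(node j k, node j (k + 1)) = s(node j' k', node j' (k' + 1))) :
    j = j' ∧ k = k' := by
  rcases Sym2.eq_iff.mp h with ⟨-, h2⟩ | ⟨h1, h2⟩
  · exact hinj j hj j' hj' k hk k' hk' h2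
  · exfalso
    rcases k with _ | k
    · rw [h0 j hj] at h1
      exact hnew j' hj' k' hk' (h1 ▸ hcW)
    · rcases k' with _ | k'
      · rw [h0 j' hj'] at h2
        exact hnew j hj _ hk (h2 ▸ hcW)
      · have := (hinj j hj j' hj' k (by omega) (k' + 1) hk' h1).2
        have := (hinj j hj j' hj' (k + 1) hk k' (by omega) h2).2
        omega

/-- Attaching paths with three edges to a vertex of degree two keeps a graph planar. -/
theorem isPlanar_of_attach {G K : NatGraph} (hfin : K.verts.Finite) (hK : IsPlanar K) {c v u : ℕ}
    (hvu : v ≠ u) (hc : ∀ a, K.Adj c a ↔ a = v ∨ a = u) {ι : Type*} (J : Set ι)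
    (node : ι → ℕ → ℕ) (h0 : ∀ j ∈ J, node j 0 = c)
    (hnew : ∀ j ∈ J, ∀ k < 3, node j (k + 1) ∉ K.verts)
    (hinj : ∀ j ∈ J, ∀ j' ∈ J, ∀ k < 3, ∀ k' < 3, node j (k + 1) = node j' (k' + 1) →
      j = j' ∧ k = k')
    (hverts : ∀ a ∈ G.verts, a ∈ K.verts ∨ ∃ j ∈ J, ∃ k < 3, a = node j (k + 1))
    (hedges : ∀ e ∈ G.edgeSet, e ∈ K.edgeSet ∨
      ∃ j ∈ J, ∃ k < 3, e = s(node j k, node j (k + 1))) : IsPlanar G := by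
  obtain ⟨E₀⟩ := hK
  obtain ⟨E, y, r, hr, hdist, hdisj⟩ := E₀.exists_accessible hfin hvu hc
  obtain ⟨w, hw, hwinj⟩ := exists_rays hr hdist
  have hcK : c ∈ K.verts := K.edge_vert ((hc v).mpr (Or.inl rfl))
  set p := E.pos c with hp
  have hout : ∀ n (s : ℝ), 0 < s → s ≤ 3 → ∀ z ∈ E.drawing, p + s • w n ≠ z :=
    fun n s h1 h2 z hz h => Set.disjoint_left.mp hdisj (hw n s h1 h2) (h ▸ hz)
  have hw0 : ∀ n, w n ≠ 0 := by
    intro n hn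
    have := (hwinj n n 1 2 one_pos two_pos (by rw [hn]; simp)).2
    norm_num at this
  have hpd : ∀ a ∈ K.verts, E.pos a ∈ E.drawing := fun a ha => Or.inl ⟨a, ha, rfl⟩
  have had : ∀ e ∈ K.edgeSet, ∀ t, E.arc e t ∈ E.drawing := fun e he t =>
    Or.inr (mem_biUnion he ⟨t, rfl⟩)
  have huniq : ∀ {j j' : ι}, j ∈ J → j' ∈ J → ∀ {k k' : ℕ}, k < 3 → k' < 3 →
      s(node j k, node j (k + 1)) = s(node j' k', node j' (k' + 1)) → j = j' ∧ k = k' :=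
    fun hj hj' _ _ hk hk' => leg_edge_unique hcK h0 hnew hinj hj hj' hk hk'
  have hnewe : ∀ j ∈ J, ∀ k < 3, s(node j k, node j (k + 1)) ∉ K.edgeSet := fun j hj k hk h =>
    hnew j hj k hk (K.edge_vert (SimpleGraph.Subgraph.Adj.symm h))
  -- The ray of a leg is numbered by the name of its first vertex, which differs between legs.
  -- Vertex number k + 1 sits at parameter k + 1 of the ray, and the edge leading to it covers the
  -- parameters from k to k + 1.
  have hpos : ∀ a, ∃ q : ℝ × ℝ, (a ∈ K.verts → q = E.pos a) ∧
      ∀ j ∈ J, ∀ k < 3, a = node j (k + 1) → q = p + ((k : ℝ) + 1) • w (node j 1) := by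
    intro a
    by_cases ha : a ∈ K.verts
    · refine ⟨E.pos a, fun _ => rfl, fun j hj k hk h => ?_⟩
      exact absurd (h ▸ ha) (hnew j hj k hk)
    by_cases h : ∃ j ∈ J, ∃ k < 3, a = node j (k + 1)
    · obtain ⟨j, hj, k, hk, rfl⟩ := h
      refine ⟨p + ((k : ℝ) + 1) • w (node j 1), fun h => absurd h ha, fun j' hj' k' hk' h => ?_⟩
      obtain ⟨rfl, rfl⟩ := hinj j hj j' hj' k hk k' hk' h
      rfl
    · exact ⟨0, fun h => absurd h ha, fun j hj k hk h' => absurd ⟨j, hj, k, hk, h'⟩ h⟩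
  choose pos' hpos_old hpos_new using hpos
  have harc : ∀ e, ∃ f : unitInterval → ℝ × ℝ, (e ∈ K.edgeSet → f = E.arc e) ∧
      ∀ j ∈ J, ∀ k < 3, e = s(node j k, node j (k + 1)) →
        f = fun t : unitInterval => p + ((k : ℝ) + t) • w (node j 1) := by
    intro e
    by_cases he : e ∈ K.edgeSet
    · exact ⟨E.arc e, fun _ => rfl, fun j hj k hk h => absurd (h ▸ he) (hnewe j hj k hk)⟩
    by_cases h : ∃ j ∈ J, ∃ k < 3, e = s(node j k, node j (k + 1))
    · obtain ⟨j, hj, k, hk, rfl⟩ := h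
      refine ⟨fun t : unitInterval => p + ((k : ℝ) + t) • w (node j 1), fun h => absurd h he,
        fun j' hj' k' hk' h => ?_⟩
      obtain ⟨rfl, rfl⟩ := huniq hj hj' hk hk' h
      rfl
    · exact ⟨0, fun h => absurd h he, fun j hj k hk h' => absurd ⟨j, hj, k, hk, h'⟩ h⟩
  choose arc' harc_old harc_new using harc
  have hpos_node : ∀ j ∈ J, ∀ k ≤ 3, pos' (node j k) = p + (k : ℝ) • w (node j 1) := by
    intro j hj k hk
    rcases k with _ | k
    · rw [h0 j hj, hpos_old c hcK]; simp [hp]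
    · rw [hpos_new _ j hj k hk rfl]; simp
  have hlt : ∀ k : ℕ, k < 3 → (k : ℝ) ≤ 2 := fun k hk => by
    exact_mod_cast Nat.lt_succ_iff.mp hk
  have hI : ∀ t : unitInterval, t ≠ 0 → t ≠ 1 → 0 < (t : ℝ) ∧ (t : ℝ) < 1 := fun t h h' =>
    ⟨lt_of_le_of_ne t.2.1 fun e => h (Subtype.ext e.symm),
      lt_of_le_of_ne t.2.2 fun e => h' (Subtype.ext e)⟩
  refine ⟨⟨pos', arc', ?_, ?_, ?_, ?_, ?_, ?_⟩⟩
  · intro a ha b hb hab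
    rcases hverts a ha with ha | ⟨j, hj, k, hk, rfl⟩ <;>
      rcases hverts b hb with hb | ⟨j', hj', k', hk', rfl⟩
    · rw [hpos_old a ha, hpos_old b hb] at hab
      exact E.pos_injOn ha hb hab
    · rw [hpos_old a ha, hpos_new _ j' hj' k' hk' rfl] at hab
      exact absurd hab.symm (hout _ _ (by positivity) (by linarith [hlt k' hk']) _ (hpd a ha))
    · rw [hpos_old b hb, hpos_new _ j hj k hk rfl] at hab
      exact absurd hab (hout _ _ (by positivity) (by linarith [hlt k hk]) _ (hpd b hb))
    · rw [hpos_new _ j hj k hk rfl, hpos_new _ j' hj' k' hk' rfl] at hab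
      obtain ⟨h1, h2⟩ := hwinj _ _ _ _ (by positivity) (by positivity) hab
      obtain ⟨rfl, -⟩ := hinj j hj j' hj' 0 (by norm_num) 0 (by norm_num) h1
      have h2 : k = k' := by exact_mod_cast add_right_cancel h2
      rw [h2]
  · intro e he
    rcases hedges e he with he | ⟨j, hj, k, hk, rfl⟩
    · rw [harc_old e he]; exact E.arc_continuous e he
    · rw [harc_new _ j hj k hk rfl]; fun_prop
  · intro e he
    rcases hedges e he with he | ⟨j, hj, k, hk, rfl⟩
    · rw [harc_old e he]; exact E.arc_injective e he
    · rw [harc_new _ j hj k hk rfl]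
      intro s t hst
      have h1 := smul_left_injective ℝ (hw0 (node j 1)) (add_left_cancel hst)
      exact Subtype.ext (add_left_cancel h1)
  · intro e he
    rcases hedges e he with he | ⟨j, hj, k, hk, rfl⟩
    · rw [harc_old e he, E.arc_ends e he]
      apply Sym2.map_congr
      intro a ha
      exact (hpos_old a (PlanarEmbedding.mem_verts_of_mem_edge he ha)).symm
    · rw [harc_new _ j hj k hk rfl, Sym2.map_mk, hpos_node j hj k hk.le,
        hpos_node j hj (k + 1) hk]
      simp
  · intro e he t ht0 ht1 a ha
    obtain ⟨ht0', ht1'⟩ := hI t ht0 ht1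
    rcases hedges e he with he | ⟨j, hj, k, hk, rfl⟩ <;>
      rcases hverts a ha with ha | ⟨j', hj', k', hk', rfl⟩
    · rw [harc_old e he, hpos_old a ha]; exact E.arc_ne_pos e he t ht0 ht1 a ha
    · rw [harc_old e he, hpos_new _ j' hj' k' hk' rfl]
      exact (hout _ _ (by positivity) (by linarith [hlt k' hk']) _ (had e he t)).symm
    · rw [harc_new _ j hj k hk rfl, hpos_old a ha]
      exact hout _ _ (by positivity) (by linarith [hlt k hk]) _ (hpd a ha)
    · rw [harc_new _ j hj k hk rfl, hpos_new _ j' hj' k' hk' rfl]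
      intro h
      -- Equal points have equal parameters on their rays, and no integer lies strictly between k
      -- and k + 1.
      have h2 := (hwinj _ _ _ _ (by positivity) (by positivity) h).2
      have h3 : (k : ℝ) < ((k' + 1 : ℕ) : ℝ) := by push_cast; linarith
      have h4 : ((k' : ℕ) : ℝ) < (k : ℝ) := by linarith
      rw [Nat.cast_lt] at h3 h4
      omega
  · intro e he e' he' hee t t' ht0 ht1 ht0' ht1'
    obtain ⟨hp0, hp1⟩ := hI t ht0 ht1
    obtain ⟨hp0', hp1'⟩ := hI t' ht0' ht1'
    rcases hedges e he with he | ⟨j, hj, k, hk, rfl⟩ <;>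
      rcases hedges e' he' with he' | ⟨j', hj', k', hk', rfl⟩
    · rw [harc_old e he, harc_old e' he']
      exact E.arc_ne_arc e he e' he' hee t t' ht0 ht1 ht0' ht1'
    · rw [harc_old e he, harc_new _ j' hj' k' hk' rfl]
      exact (hout _ _ (by positivity) (by linarith [hlt k' hk']) _ (had e he t)).symm
    · rw [harc_old e' he', harc_new _ j hj k hk rfl]
      exact hout _ _ (by positivity) (by linarith [hlt k hk]) _ (had e' he' t')
    · rw [harc_new _ j hj k hk rfl, harc_new _ j' hj' k' hk' rfl]
      intro h
      obtain ⟨h1, h2⟩ := hwinj _ _ _ _ (by positivity) (by positivity) h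
      obtain ⟨rfl, -⟩ := hinj j hj j' hj' 0 (by norm_num) 0 (by norm_num) h1
      have h3 : (k : ℝ) < ((k' + 1 : ℕ) : ℝ) := by push_cast; linarith
      have h4 : (k' : ℝ) < ((k + 1 : ℕ) : ℝ) := by push_cast; linarith
      rw [Nat.cast_lt] at h3 h4
      obtain rfl : k = k' := by omega
      exact hee rfl

end

/-! ### Gadgets and the dominating sets assembled from them. -/

section

open Set

/-- A gadget between `v` and `u`: every root in `R` is adjacent to `v` and `u`, and each leg
`j ∈ J` is a path `node j 1, node j 2, node j 3` hanging from the root `node j 0`. -/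
structure IsGadget (G : NatGraph) (C : Finset ℕ) (v u : ℕ) (R : Finset ℕ) {ι : Type*}
    (J : Finset ι) (node : ι → ℕ → ℕ) : Prop where
  ne : v ≠ u
  v_mem : v ∈ G.verts
  v_notMem : v ∉ C
  u_mem : u ∈ G.verts
  u_notMem : u ∉ C
  subset : (C : Set ℕ) ⊆ G.verts
  mem_iff : ∀ a, a ∈ C ↔ a ∈ R ∨ ∃ j ∈ J, ∃ k < 3, a = node j (k + 1)
  root_mem : ∀ j ∈ J, node j 0 ∈ R
  notMem_root : ∀ j ∈ J, ∀ k < 3, node j (k + 1) ∉ R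
  inj : ∀ j ∈ J, ∀ j' ∈ J, ∀ k < 3, ∀ k' < 3, node j (k + 1) = node j' (k' + 1) → j = j' ∧ k = k'
  adj_root : ∀ c ∈ R, ∀ a, G.Adj c a ↔ a = v ∨ a = u ∨ ∃ j ∈ J, node j 0 = c ∧ a = node j 1
  adj_one : ∀ j ∈ J, ∀ a, G.Adj (node j 1) a ↔ a = node j 0 ∨ a = node j 2
  adj_two : ∀ j ∈ J, ∀ a, G.Adj (node j 2) a ↔ a = node j 1 ∨ a = node j 3
  adj_three : ∀ j ∈ J, ∀ a, G.Adj (node j 3) a ↔ a = node j 2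

/-- `D` dominates all vertices of `H` outside `X`. -/
def DominatesOff (H : NatGraph) (X : Set ℕ) (D : Finset ℕ) : Prop :=
  ∀ a ∈ H.verts, a ∉ X → a ∈ D ∨ ∃ d ∈ D, H.Adj d a

/-- The dominating sets of `H` that contain `v` or `u`. -/
def touchingDS (H : NatGraph) (v u : ℕ) : Set (Finset ℕ) :=
  {D | (D : Set ℕ) ⊆ H.verts ∧ (v ∈ D ∨ u ∈ D) ∧ DominatesOff H ∅ D}

/-- The least size of a dominating set of `H` that contains `v` or `u`. -/
noncomputable def touchingNumber (H : NatGraph) (v u : ℕ) : ℕ :=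
  sInf (Finset.card '' touchingDS H v u)

/-- The minimum dominating sets of `H` among those containing `v` or `u`. -/
def minTouchingDS (H : NatGraph) (v u : ℕ) : Set (Finset ℕ) :=
  {D | D ∈ touchingDS H v u ∧ D.card = touchingNumber H v u}

/-- The sets containing `v` or `u` that dominate the rest of `H` and save one vertex. -/
def savingSets (H : NatGraph) (v u : ℕ) : Set (Finset ℕ) :=
  {D | (D : Set ℕ) ⊆ H.verts ∧ (v ∈ D ∨ u ∈ D) ∧ DominatesOff H {v, u} D ∧
    D.card + 1 = touchingNumber H v u}

theorem isDominatingSet_iff {G : NatGraph} {D : Finset ℕ} : IsDominatingSet G D ↔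
    (D : Set ℕ) ⊆ G.verts ∧ ∀ a ∈ G.verts, a ∈ D ∨ ∃ d ∈ D, G.Adj d a := by
  refine and_congr_right fun hD => ⟨fun h a ha => ?_, fun h => ?_⟩
  · rw [← h] at ha
    simpa [closedNbhd] using ha
  · ext a
    refine ⟨?_, fun ha => by simpa [closedNbhd] using h a ha⟩
    rintro (ha | ⟨d, -, hd⟩)
    · exact hD ha
    · exact G.edge_vert hd.symm

theorem touchingNumber_le {H : NatGraph} {v u : ℕ} {D : Finset ℕ} (h : D ∈ touchingDS H v u) :
    touchingNumber H v u ≤ D.card := Nat.sInf_le ⟨D, h, rfl⟩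

theorem exists_minTouchingDS {H : NatGraph} {v u : ℕ} (hfin : H.verts.Finite) (hv : v ∈ H.verts) :
    ∃ D, D ∈ minTouchingDS H v u := by
  have hne : (Finset.card '' touchingDS H v u).Nonempty := by
    refine ⟨_, hfin.toFinset, ⟨by simp, ?_, ?_⟩, rfl⟩
    · left; simpa using hv
    · intro a ha _
      left; simpa using ha
  obtain ⟨D, hD, hc⟩ := Nat.sInf_mem hne
  exact ⟨D, hD, hc⟩

namespace IsGadget

variable {G : NatGraph} {C : Finset ℕ} {v u : ℕ} {R : Finset ℕ} {ι : Type*} {J : Finset ι}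
  {node : ι → ℕ → ℕ}

/-- The number of vertices of a leg that belong to `D`. -/
def legCount (node : ι → ℕ → ℕ) (D : Finset ℕ) (j : ι) : ℕ :=
  ((Finset.range 3).filter fun k => node j (k + 1) ∈ D).card

theorem legCount_eq (node : ι → ℕ → ℕ) (D : Finset ℕ) (j : ι) : legCount node D j =
    (if node j 1 ∈ D then 1 else 0) + (if node j 2 ∈ D then 1 else 0) +
      (if node j 3 ∈ D then 1 else 0) := by
  rw [legCount, Finset.card_filter, Finset.sum_range_succ, Finset.sum_range_succ,
    Finset.sum_range_succ, Finset.sum_range_zero, zero_add]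

theorem root_mem_C (h : IsGadget G C v u R J node) {c : ℕ} (hc : c ∈ R) : c ∈ C :=
  (h.mem_iff c).mpr (Or.inl hc)

theorem leg_mem_C (h : IsGadget G C v u R J node) {j : ι} (hj : j ∈ J) {k : ℕ} (hk : k < 3) :
    node j (k + 1) ∈ C := (h.mem_iff _).mpr (Or.inr ⟨j, hj, k, hk, rfl⟩)

/-- Legs are closed off from the rest of the graph, so the choice inside the gadget matters outside
only for v and u. -/
theorem adj_outside (h : IsGadget G C v u R J node) {a d : ℕ} (ha : a ∈ C) (hd : d ∉ C)
    (had : G.Adj a d) : a ∈ R ∧ (d = v ∨ d = u) := by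
  rcases (h.mem_iff a).mp ha with haR | ⟨j, hj, k, hk, rfl⟩
  · refine ⟨haR, ?_⟩
    rcases (h.adj_root a haR d).mp had with e | e | ⟨j, hj, -, rfl⟩
    · exact Or.inl e
    · exact Or.inr e
    · exact absurd (h.leg_mem_C hj (k := 0) (by norm_num)) hd
  · exfalso
    apply hd
    interval_cases k
    · rcases (h.adj_one j hj d).mp had with rfl | rfl
      · exact h.root_mem_C (h.root_mem j hj)
      · exact h.leg_mem_C hj (k := 1) (by norm_num)
    · rcases (h.adj_two j hj d).mp had with rfl | rfl
      · exact h.leg_mem_C hj (k := 0) (by norm_num)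
      · exact h.leg_mem_C hj (k := 2) (by norm_num)
    · obtain rfl := (h.adj_three j hj d).mp had
      exact h.leg_mem_C hj (k := 1) (by norm_num)

/-- Splits a set into the part outside the gadget, the roots and the legs. Each part is then bounded
separately, and equality in the sum forces equality in every part. -/
theorem card_eq (h : IsGadget G C v u R J node) (D : Finset ℕ) :
    D.card = (D.filter (· ∉ C)).card + ((R.filter (· ∈ D)).card + ∑ j ∈ J, legCount node D j) := by
  classical
  have h1 : D.filter (· ∈ C) = R.filter (· ∈ D) ∪ J.biUnion fun j =>
      ((Finset.range 3).filter fun k => node j (k + 1) ∈ D).image fun k => node j (k + 1) := by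
    ext a
    simp only [Finset.mem_filter, Finset.mem_union, Finset.mem_biUnion, Finset.mem_image,
      Finset.mem_range, h.mem_iff]
    constructor
    · rintro ⟨haD, haR | ⟨j, hj, k, hk, rfl⟩⟩
      · exact Or.inl ⟨haR, haD⟩
      · exact Or.inr ⟨j, hj, k, ⟨hk, haD⟩, rfl⟩
    · rintro (⟨haR, haD⟩ | ⟨j, hj, k, ⟨hk, haD⟩, rfl⟩)
      · exact ⟨haD, Or.inl haR⟩
      · exact ⟨haD, Or.inr ⟨j, hj, k, hk, rfl⟩⟩
  rw [← Finset.card_filter_add_card_filter_not (s := D) (· ∈ C), add_comm, h1,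
    Finset.card_union_of_disjoint, Finset.card_biUnion]
  · congr 2
    refine Finset.sum_congr rfl fun j hj => ?_
    rw [Finset.card_image_of_injOn, legCount]
    intro k hk k' hk' hkk
    simp only [Finset.coe_filter, Finset.mem_range, Set.mem_ofPred_eq] at hk hk'
    exact (h.inj j hj j hj k hk.1 k' hk'.1 hkk).2
  · intro j hj j' hj' hne
    rw [Function.onFun, Finset.disjoint_left]
    intro a ha ha'
    simp only [Finset.mem_image, Finset.mem_filter, Finset.mem_range] at ha ha'
    obtain ⟨k, ⟨hk, -⟩, rfl⟩ := ha
    obtain ⟨k', ⟨hk', -⟩, hkk⟩ := ha'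
    exact hne (h.inj j hj j' hj' k hk k' hk' hkk.symm).1
  · rw [Finset.disjoint_left]
    intro a ha ha'
    simp only [Finset.mem_biUnion, Finset.mem_image, Finset.mem_filter, Finset.mem_range] at ha ha'
    obtain ⟨j, hj, k, ⟨hk, -⟩, rfl⟩ := ha'
    exact h.notMem_root j hj k hk ha.1

/-- The middle vertices of the legs, with some legs represented by their ends instead. -/
def legSet [DecidableEq ι] (J : Finset ι) (node : ι → ℕ → ℕ) (T : Finset ι) : Finset ℕ :=
  J.image fun j => if j ∈ T then node j 3 else node j 2

theorem mem_legSet_iff [DecidableEq ι] {T : Finset ι} {a : ℕ} : a ∈ legSet J node T ↔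
    ∃ j ∈ J, (j ∈ T ∧ a = node j 3) ∨ (j ∉ T ∧ a = node j 2) := by
  simp only [legSet, Finset.mem_image]
  refine exists_congr fun j => and_congr_right fun _ => ?_
  split_ifs with hT <;> simp [hT, eq_comm]

theorem legSet_subset [DecidableEq ι] (h : IsGadget G C v u R J node) (T : Finset ι) :
    legSet J node T ⊆ C := by
  intro a ha
  obtain ⟨j, hj, ⟨-, rfl⟩ | ⟨-, rfl⟩⟩ := mem_legSet_iff.mp ha
  · exact h.leg_mem_C hj (k := 2) (by norm_num)
  · exact h.leg_mem_C hj (k := 1) (by norm_num)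

/-- Each leg contributes one vertex whichever is selected, so all choices have the same size. -/
theorem card_legSet [DecidableEq ι] (h : IsGadget G C v u R J node) (T : Finset ι) :
    (legSet J node T).card = J.card := by
  apply Finset.card_image_of_injOn
  intro j hj j' hj' hjj
  dsimp only at hjj
  split_ifs at hjj
  · exact (h.inj j hj j' hj' 2 (by norm_num) 2 (by norm_num) hjj).1
  · exact (h.inj j hj j' hj' 2 (by norm_num) 1 (by norm_num) hjj).1
  · exact (h.inj j hj j' hj' 1 (by norm_num) 2 (by norm_num) hjj).1
  · exact (h.inj j hj j' hj' 1 (by norm_num) 1 (by norm_num) hjj).1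

theorem root_notMem_legSet [DecidableEq ι] (h : IsGadget G C v u R J node) (T : Finset ι) {c : ℕ}
    (hc : c ∈ R) : c ∉ legSet J node T := by
  intro hcm
  obtain ⟨j, hj, ⟨-, rfl⟩ | ⟨-, rfl⟩⟩ := mem_legSet_iff.mp hcm
  · exact h.notMem_root j hj 2 (by norm_num) hc
  · exact h.notMem_root j hj 1 (by norm_num) hc

/-- This makes the selection `T` readable from the set, as the count of the choices at a root
requires. -/
theorem three_mem_legSet_iff [DecidableEq ι] (h : IsGadget G C v u R J node) {T : Finset ι} {j : ι}
    (hj : j ∈ J) : node j 3 ∈ legSet J node T ↔ j ∈ T := by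
  rw [mem_legSet_iff]
  constructor
  · rintro ⟨j', hj', ⟨hT, e⟩ | ⟨hT, e⟩⟩
    · rwa [(h.inj j hj j' hj' 2 (by norm_num) 2 (by norm_num) e).1]
    · have := (h.inj j hj j' hj' 2 (by norm_num) 1 (by norm_num) e).2
      omega
  · exact fun hT => ⟨j, hj, Or.inl ⟨hT, rfl⟩⟩

theorem mem_deleteVerts {a : ℕ} : a ∈ (G.deleteVerts (C : Set ℕ)).verts ↔ a ∈ G.verts ∧ a ∉ C := by
  simp

theorem adj_deleteVerts {a b : ℕ} :
    (G.deleteVerts (C : Set ℕ)).Adj a b ↔ G.Adj a b ∧ a ∉ C ∧ b ∉ C := by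
  rw [SimpleGraph.Subgraph.deleteVerts_adj]
  constructor
  · rintro ⟨-, h1, -, h2, h3⟩; exact ⟨h3, by simpa using h1, by simpa using h2⟩
  · rintro ⟨h, h1, h2⟩
    exact ⟨G.edge_vert h, by simpa using h1, G.edge_vert h.symm, by simpa using h2, h⟩

/-- Sets that dominate outside the gadget, contain `v` or `u`, and represent every leg. -/
theorem isDominatingSet_union [DecidableEq ι] (h : IsGadget G C v u R J node) {D₀ S : Finset ℕ}
    {T : Finset ι} (hD₀ : (D₀ : Set ℕ) ⊆ (G.deleteVerts (C : Set ℕ)).verts)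
    (hvu : v ∈ D₀ ∨ u ∈ D₀) {X : Set ℕ} (hdom : DominatesOff (G.deleteVerts (C : Set ℕ)) X D₀)
    (hSC : S ⊆ C) (hTS : legSet J node T ⊆ S) (hX : ∀ a ∈ X, ∃ d ∈ S, G.Adj d a)
    (hT : ∀ j ∈ J, j ∈ T → node j 0 ∈ S) : IsDominatingSet G (D₀ ∪ S) := by
  rw [isDominatingSet_iff]
  refine ⟨?_, fun a ha => ?_⟩
  · rw [Finset.coe_union]
    exact union_subset (fun a ha => (mem_deleteVerts.mp (hD₀ ha)).1)
      (fun a ha => h.subset (hSC ha))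
  simp only [Finset.mem_union]
  by_cases haC : a ∈ C
  · rcases (h.mem_iff a).mp haC with haR | ⟨j, hj, k, hk, rfl⟩
    · right
      rcases hvu with hv | hu
      · exact ⟨v, Or.inl hv, ((h.adj_root a haR v).mpr (Or.inl rfl)).symm⟩
      · exact ⟨u, Or.inl hu, ((h.adj_root a haR u).mpr (Or.inr (Or.inl rfl))).symm⟩
    -- On a leg in `T` the end dominates the last two vertices and the selected root the first; on
    -- any other leg the middle vertex dominates all three.
    · by_cases hjT : j ∈ T
      · have h3 : node j 3 ∈ S := hTS (mem_legSet_iff.mpr ⟨j, hj, Or.inl ⟨hjT, rfl⟩⟩)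
        interval_cases k
        · exact Or.inr ⟨node j 0, Or.inr (hT j hj hjT),
            ((h.adj_one j hj _).mpr (Or.inl rfl)).symm⟩
        · exact Or.inr ⟨node j 3, Or.inr h3, (h.adj_three j hj _).mpr rfl⟩
        · exact Or.inl (Or.inr h3)
      · have h2 : node j 2 ∈ S := hTS (mem_legSet_iff.mpr ⟨j, hj, Or.inr ⟨hjT, rfl⟩⟩)
        interval_cases k
        · exact Or.inr ⟨node j 2, Or.inr h2, (h.adj_two j hj _).mpr (Or.inl rfl)⟩
        · exact Or.inl (Or.inr h2)
        · exact Or.inr ⟨node j 2, Or.inr h2, (h.adj_two j hj _).mpr (Or.inr rfl)⟩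
  · by_cases haX : a ∈ X
    · obtain ⟨d, hd, hda⟩ := hX a haX
      exact Or.inr ⟨d, Or.inr hd, hda⟩
    · rcases hdom a (mem_deleteVerts.mpr ⟨ha, haC⟩) haX with h1 | ⟨d, hd, hda⟩
      · exact Or.inl (Or.inl h1)
      · exact Or.inr ⟨d, Or.inl hd, (adj_deleteVerts.mp hda).1⟩

end IsGadget

end

/-! ### The shape of minimum dominating sets in the presence of a gadget. -/

section

open Set

namespace IsGadget

variable {G : NatGraph} {C : Finset ℕ} {v u : ℕ} {R : Finset ℕ} {ι : Type*} {J : Finset ι}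
  {node : ι → ℕ → ℕ}

/-- The end of a leg can only be dominated by itself or by the middle vertex. -/
theorem one_le_legCount (h : IsGadget G C v u R J node) {D : Finset ℕ} (hD : IsDominatingSet G D)
    {j : ι} (hj : j ∈ J) : 1 ≤ legCount node D j := by
  have hz := (isDominatingSet_iff.mp hD).2 _ (h.subset (h.leg_mem_C hj (k := 2) (by norm_num)))
  rw [legCount_eq]
  rcases hz with hz | ⟨d, hd, hda⟩
  · rw [if_pos hz]; omega
  · obtain rfl := (h.adj_three j hj d).mp hda.symm
    rw [if_pos hd]; omega

/-- The end must be dominated, so the only selected vertex is the middle or the end. If it is the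
end, the first vertex has no dominator left but the root. -/
theorem legCount_eq_one (h : IsGadget G C v u R J node) {D : Finset ℕ} (hD : IsDominatingSet G D)
    {j : ι} (hj : j ∈ J) (h1 : legCount node D j = 1) :
    node j 1 ∉ D ∧ ((node j 2 ∈ D ∧ node j 3 ∉ D) ∨ (node j 2 ∉ D ∧ node j 3 ∈ D ∧ node j 0 ∈ D)) := by
  have hz := (isDominatingSet_iff.mp hD).2 _ (h.subset (h.leg_mem_C hj (k := 2) (by norm_num)))
  have hx := (isDominatingSet_iff.mp hD).2 _ (h.subset (h.leg_mem_C hj (k := 0) (by norm_num)))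
  have hz' : node j 3 ∈ D ∨ node j 2 ∈ D := by
    rcases hz with hz | ⟨d, hd, hda⟩
    · exact Or.inl hz
    · obtain rfl := (h.adj_three j hj d).mp hda.symm
      exact Or.inr hd
  have hx' : node j 1 ∈ D ∨ node j 0 ∈ D ∨ node j 2 ∈ D := by
    rcases hx with hx | ⟨d, hd, hda⟩
    · exact Or.inl hx
    · rcases (h.adj_one j hj d).mp hda.symm with rfl | rfl
      · exact Or.inr (Or.inl hd)
      · exact Or.inr (Or.inr hd)
  rw [legCount_eq] at h1
  split_ifs at h1 <;> first | omega | tauto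

theorem card_le_sum_legCount (h : IsGadget G C v u R J node) {D : Finset ℕ}
    (hD : IsDominatingSet G D) : J.card ≤ ∑ j ∈ J, legCount node D j := by
  rw [Finset.card_eq_sum_ones]
  exact Finset.sum_le_sum fun j hj => h.one_le_legCount hD hj

/-- Dominating sets avoiding both `v` and `u` pay for every root. -/
theorem card_root_add_le (h : IsGadget G C v u R J node) {D : Finset ℕ}
    (hD : IsDominatingSet G D) (hv : v ∉ D) (hu : u ∉ D) :
    R.card + J.card ≤ (R.filter (· ∈ D)).card + ∑ j ∈ J, legCount node D j := by
  classical
  -- Without v and u, a root outside `D` is dominated by the first vertex of one of its legs.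
  have h1 : R ⊆ R.filter (· ∈ D) ∪ (J.filter fun j => node j 1 ∈ D).image fun j => node j 0 := by
    intro c hc
    rcases (isDominatingSet_iff.mp hD).2 c (h.subset (h.root_mem_C hc)) with hcD | ⟨d, hd, hda⟩
    · exact Finset.mem_union_left _ (Finset.mem_filter.mpr ⟨hc, hcD⟩)
    · rcases (h.adj_root c hc d).mp hda.symm with rfl | rfl | ⟨j, hj, rfl, rfl⟩
      · exact absurd hd hv
      · exact absurd hd hu
      · exact Finset.mem_union_right _
          (Finset.mem_image_of_mem _ (Finset.mem_filter.mpr ⟨hj, hd⟩))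
  -- A leg whose first vertex is selected contains a second selected vertex, which pays for its
  -- root.
  have h2 : J.card + (J.filter fun j => node j 1 ∈ D).card ≤ ∑ j ∈ J, legCount node D j := by
    rw [Finset.card_filter, Finset.card_eq_sum_ones, ← Finset.sum_add_distrib]
    refine Finset.sum_le_sum fun j hj => ?_
    by_contra hlt
    have h1 := h.one_le_legCount hD hj
    split_ifs at hlt with hx
    · exact (h.legCount_eq_one hD hj (by omega)).1 hx
    · omega
  have h3 := (Finset.card_le_card h1).trans (Finset.card_union_le _ _)
  have h4 := Finset.card_image_le (s := J.filter fun j => node j 1 ∈ D) (f := fun j => node j 0)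
  omega

/-- The gadget can help to dominate only v and u. -/
theorem dominatesOff_of_isDominatingSet (h : IsGadget G C v u R J node) {D : Finset ℕ}
    (hD : IsDominatingSet G D) :
    DominatesOff (G.deleteVerts (C : Set ℕ)) {v, u} (D.filter (· ∉ C)) := by
  intro a ha hna
  obtain ⟨haG, haC⟩ := mem_deleteVerts.mp ha
  rcases (isDominatingSet_iff.mp hD).2 a haG with haD | ⟨d, hd, hda⟩
  · exact Or.inl (Finset.mem_filter.mpr ⟨haD, haC⟩)
  · by_cases hdC : d ∈ C
    · exact absurd (h.adj_outside hdC haC hda).2 hna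
    · exact Or.inr ⟨d, Finset.mem_filter.mpr ⟨hd, hdC⟩, adj_deleteVerts.mpr ⟨hda, hdC, haC⟩⟩

theorem filter_subset_verts {D : Finset ℕ} (hD : IsDominatingSet G D) :
    ((D.filter (· ∉ C) : Finset ℕ) : Set ℕ) ⊆ (G.deleteVerts (C : Set ℕ)).verts := by
  intro a ha
  have ha := Finset.mem_filter.mp (Finset.mem_coe.mp ha)
  exact mem_deleteVerts.mpr ⟨hD.1 ha.1, ha.2⟩

theorem dominatesOff_empty_of_subset {H : NatGraph} {v u : ℕ} {D : Finset ℕ}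
    (h : DominatesOff H {v, u} D) {D' : Finset ℕ} (hDD : D ⊆ D') (hv : v ∈ D') (hu : u ∈ D') :
    DominatesOff H ∅ D' := by
  intro a ha _
  by_cases hva : a = v
  · exact Or.inl (hva ▸ hv)
  by_cases hua : a = u
  · exact Or.inl (hua ▸ hu)
  rcases h a ha (by simp [hva, hua]) with h1 | ⟨d, hd, hda⟩
  · exact Or.inl (hDD h1)
  · exact Or.inr ⟨d, hDD hd, hda⟩

/-- The dominating sets of minimum size, seen from the gadget. -/
theorem card_dominatingSet [DecidableEq ι] (h : IsGadget G C v u R J node) (hR : 3 ≤ R.card)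
    {D : Finset ℕ} (hD : IsDominatingSet G D) :
    touchingNumber (G.deleteVerts (C : Set ℕ)) v u + J.card ≤ D.card ∧
    (D.card = touchingNumber (G.deleteVerts (C : Set ℕ)) v u + J.card →
      (D.filter (· ∉ C) ∈ minTouchingDS (G.deleteVerts (C : Set ℕ)) v u ∧
        D.filter (· ∈ C) = legSet J node ∅) ∨
      (D.filter (· ∉ C) ∈ savingSets (G.deleteVerts (C : Set ℕ)) v u ∧
        ∃ c ∈ R, ∃ T ⊆ J.filter (fun j => node j 0 = c),
          D.filter (· ∈ C) = insert c (legSet J node T))) := by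
  set H := G.deleteVerts (C : Set ℕ) with hH
  have hcard := h.card_eq D
  have hleg := h.card_le_sum_legCount hD
  have hoff := h.dominatesOff_of_isDominatingSet hD
  have hsub := filter_subset_verts (C := C) hD
  rw [← hH] at hoff hsub
  set D₀ := D.filter (· ∉ C) with hD₀
  have hvH : v ∈ H.verts := mem_deleteVerts.mpr ⟨h.v_mem, h.v_notMem⟩
  have huH : u ∈ H.verts := mem_deleteVerts.mpr ⟨h.u_mem, h.u_notMem⟩
  have hvD : v ∈ D₀ ↔ v ∈ D := by simp [hD₀, h.v_notMem]
  have huD : u ∈ D₀ ↔ u ∈ D := by simp [hD₀, h.u_notMem]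
  by_cases hvu : v ∈ D ∨ u ∈ D
  swap
  -- Avoiding v and u costs at least three vertices for the roots, whereas adding both to the outer
  -- part costs at most two. Such sets are never minimum.
  · push Not at hvu
    have h1 := h.card_root_add_le hD hvu.1 hvu.2
    have h2 : insert v (insert u D₀) ∈ touchingDS H v u := by
      refine ⟨?_, Or.inl (Finset.mem_insert_self _ _), dominatesOff_empty_of_subset hoff ?_ ?_ ?_⟩
      · rw [Finset.coe_insert, Finset.coe_insert]
        exact insert_subset hvH (insert_subset huH hsub)
      · exact (Finset.subset_insert _ _).trans (Finset.subset_insert _ _)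
      · simp
      · simp
    have h3 := touchingNumber_le h2
    have h4 := Finset.card_insert_le v (insert u D₀)
    have h5 := Finset.card_insert_le u D₀
    constructor
    · omega
    · intro; omega
  have hvu₀ : v ∈ D₀ ∨ u ∈ D₀ := by rwa [hvD, huD]
  have hmemS : ∀ a, a ∈ D.filter (· ∈ C) ↔ (a ∈ R ∧ a ∈ D) ∨
      ∃ j ∈ J, (a = node j 1 ∧ node j 1 ∈ D) ∨ (a = node j 2 ∧ node j 2 ∈ D) ∨
        (a = node j 3 ∧ node j 3 ∈ D) := by
    intro a
    rw [Finset.mem_filter, h.mem_iff]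
    constructor
    · rintro ⟨haD, haR | ⟨j, hj, k, hk, rfl⟩⟩
      · exact Or.inl ⟨haR, haD⟩
      · right
        refine ⟨j, hj, ?_⟩
        interval_cases k
        · exact Or.inl ⟨rfl, haD⟩
        · exact Or.inr (Or.inl ⟨rfl, haD⟩)
        · exact Or.inr (Or.inr ⟨rfl, haD⟩)
    · rintro (⟨haR, haD⟩ | ⟨j, hj, ⟨rfl, haD⟩ | ⟨rfl, haD⟩ | ⟨rfl, haD⟩⟩)
      · exact ⟨haD, Or.inl haR⟩
      · exact ⟨haD, Or.inr ⟨j, hj, 0, by norm_num, rfl⟩⟩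
      · exact ⟨haD, Or.inr ⟨j, hj, 1, by norm_num, rfl⟩⟩
      · exact ⟨haD, Or.inr ⟨j, hj, 2, by norm_num, rfl⟩⟩
  have hsumone : ∑ j ∈ J, legCount node D j = J.card → ∀ j ∈ J, legCount node D j = 1 := by
    intro hs j hj
    rw [Finset.card_eq_sum_ones] at hs
    exact ((Finset.sum_eq_sum_iff_of_le fun j hj => h.one_le_legCount hD hj).mp hs.symm j hj).symm
  -- If the outer part dominates H, it has at least `touchingNumber` vertices and each leg at least
  -- one. Equality leaves nothing for roots, which forces the middle vertex on every leg.
  by_cases hdom : DominatesOff H ∅ D₀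
  · have hmem : D₀ ∈ touchingDS H v u := ⟨hsub, hvu₀, hdom⟩
    have h1 := touchingNumber_le hmem
    refine ⟨by omega, fun heq => Or.inl ⟨⟨hmem, by omega⟩, ?_⟩⟩
    have hR0 : R.filter (· ∈ D) = ∅ := Finset.card_eq_zero.mp (by omega)
    have hnR : ∀ c ∈ R, c ∉ D := fun c hc hcD => by
      have : c ∈ R.filter (· ∈ D) := Finset.mem_filter.mpr ⟨hc, hcD⟩
      rw [hR0] at this; simp at this
    have hone := hsumone (by omega)
    have hstr : ∀ j ∈ J, node j 1 ∉ D ∧ node j 2 ∈ D ∧ node j 3 ∉ D := by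
      intro j hj
      obtain ⟨a1, a2 | ⟨-, -, a2⟩⟩ := h.legCount_eq_one hD hj (hone j hj)
      · exact ⟨a1, a2⟩
      · exact absurd a2 (hnR _ (h.root_mem j hj))
    ext a
    rw [hmemS, mem_legSet_iff]
    constructor
    · rintro (⟨haR, haD⟩ | ⟨j, hj, ⟨rfl, haD⟩ | ⟨rfl, haD⟩ | ⟨rfl, haD⟩⟩)
      · exact absurd haD (hnR a haR)
      · exact absurd haD (hstr j hj).1
      · exact ⟨j, hj, Or.inr ⟨by simp, rfl⟩⟩
      · exact absurd haD (hstr j hj).2.2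
    · rintro ⟨j, hj, ⟨hT, -⟩ | ⟨-, rfl⟩⟩
      · simp at hT
      · exact Or.inr ⟨j, hj, Or.inr (Or.inl ⟨rfl, (hstr j hj).2.1⟩)⟩
  -- Otherwise one of v and u, called a, is dominated only from a root. Adding a to the outer part
  -- repairs it, so the outer part falls short of `touchingNumber` by at most one, and this is made
  -- up by the root. Equality leaves exactly one root.
  · obtain ⟨a, haH, ha⟩ : ∃ a ∈ H.verts, ¬ (a ∈ D₀ ∨ ∃ d ∈ D₀, H.Adj d a) := by
      by_contra hcon
      push Not at hcon
      exact hdom fun a ha _ => by by_contra hc; exact hc (by have := hcon a ha; tauto)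
    have hauv : a = v ∨ a = u := by
      by_contra hcon
      exact ha (hoff a haH (by simpa using hcon))
    obtain ⟨haG, haC⟩ := mem_deleteVerts.mp haH
    obtain ⟨c, hcR, hcD⟩ : ∃ c ∈ R, c ∈ D := by
      rcases (isDominatingSet_iff.mp hD).2 a haG with haD | ⟨d, hd, hda⟩
      · exact absurd (Or.inl (Finset.mem_filter.mpr ⟨haD, haC⟩)) ha
      · by_cases hdC : d ∈ C
        · exact ⟨d, (h.adj_outside hdC haC hda).1, hd⟩
        · exact absurd (Or.inr ⟨d, Finset.mem_filter.mpr ⟨hd, hdC⟩,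
            adj_deleteVerts.mpr ⟨hda, hdC, haC⟩⟩) ha
    have hins : insert a D₀ ∈ touchingDS H v u := by
      have haD₀ : a ∉ D₀ := fun h => ha (Or.inl h)
      refine ⟨?_, ?_, dominatesOff_empty_of_subset hoff (Finset.subset_insert _ _) ?_ ?_⟩
      · rw [Finset.coe_insert]; exact insert_subset haH hsub
      · rcases hauv with rfl | rfl <;> simp
      · rcases hauv with rfl | rfl
        · simp
        · exact Finset.mem_insert_of_mem (hvu₀.resolve_right haD₀)
      · rcases hauv with rfl | rfl
        · exact Finset.mem_insert_of_mem (hvu₀.resolve_left haD₀)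
        · simp
    have h1 := touchingNumber_le hins
    have h2 := Finset.card_insert_le a D₀
    have hcm : c ∈ R.filter (· ∈ D) := Finset.mem_filter.mpr ⟨hcR, hcD⟩
    have h3 : 0 < (R.filter (· ∈ D)).card := Finset.card_pos.mpr ⟨c, hcm⟩
    -- The selection consists of the legs at c whose end is in `D`; a leg at any other root has its
    -- middle vertex selected.
    refine ⟨by omega, fun heq => Or.inr ⟨⟨hsub, hvu₀, hoff, by omega⟩, c, hcR,
      J.filter (fun j => node j 0 = c ∧ node j 3 ∈ D), ?_, ?_⟩⟩
    · intro j hj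
      rw [Finset.mem_filter] at hj ⊢
      exact ⟨hj.1, hj.2.1⟩
    have h4 : (R.filter (· ∈ D)).card ≤ 1 := by omega
    have hR1 : ∀ c' ∈ R, c' ∈ D → c' = c := fun c' hc' hcD' =>
      Finset.card_le_one.mp h4 c' (Finset.mem_filter.mpr ⟨hc', hcD'⟩) c hcm
    have hone := hsumone (by omega)
    ext b
    rw [hmemS, Finset.mem_insert, mem_legSet_iff]
    constructor
    · rintro (⟨haR, haD⟩ | ⟨j, hj, ⟨rfl, haD⟩ | ⟨rfl, haD⟩ | ⟨rfl, haD⟩⟩)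
      · exact Or.inl (hR1 b haR haD)
      · exact absurd haD (h.legCount_eq_one hD hj (hone j hj)).1
      · refine Or.inr ⟨j, hj, Or.inr ⟨?_, rfl⟩⟩
        rcases (h.legCount_eq_one hD hj (hone j hj)).2 with h5 | h5
        · simp [h5.2]
        · exact absurd haD h5.1
      · refine Or.inr ⟨j, hj, Or.inl ⟨?_, rfl⟩⟩
        rcases (h.legCount_eq_one hD hj (hone j hj)).2 with h5 | h5
        · exact absurd haD h5.2
        · exact Finset.mem_filter.mpr ⟨hj, hR1 _ (h.root_mem j hj) h5.2.2, haD⟩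
    · rintro (rfl | ⟨j, hj, ⟨hT, rfl⟩ | ⟨hT, rfl⟩⟩)
      · exact Or.inl ⟨hcR, hcD⟩
      · exact Or.inr ⟨j, hj, Or.inr (Or.inr ⟨rfl, (Finset.mem_filter.mp hT).2.2⟩)⟩
      · refine Or.inr ⟨j, hj, Or.inr (Or.inl ⟨rfl, ?_⟩)⟩
        rcases (h.legCount_eq_one hD hj (hone j hj)).2 with h5 | h5
        · exact h5.1
        · exact absurd (Finset.mem_filter.mpr ⟨hj, hR1 _ (h.root_mem j hj) h5.2.2, h5.2.1⟩) hT

end IsGadget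

end

/-! ### Counting minimum dominating sets. -/

section

open Set

/-- The number of minimum dominating sets in terms of the graph without the gadget, where `n` is the
number of ways in which the gadget dominates the missing one of `v` and `u`. -/
noncomputable def gadgetCount (H : NatGraph) (v u : ℕ) (k : ℤ) (n : ℕ) : ℕ :=
  if (touchingNumber H v u : ℤ) ≤ k then (minTouchingDS H v u).ncard + (savingSets H v u).ncard * n
  else 0

theorem finite_setOf_subset {H : NatGraph} (hfin : H.verts.Finite) {𝒟 : Set (Finset ℕ)}
    (h : ∀ D ∈ 𝒟, (D : Set ℕ) ⊆ H.verts) : 𝒟.Finite := by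
  apply (hfin.toFinset.powerset.finite_toSet).subset
  intro D hD
  rw [Finset.mem_coe, Finset.mem_powerset]
  intro a ha
  simpa using h D hD ha

theorem disjoint_minTouchingDS_savingSets (H : NatGraph) (v u : ℕ) :
    Disjoint (minTouchingDS H v u) (savingSets H v u) := by
  rw [Set.disjoint_left]
  intro D h1 h2
  have := h1.2
  have := h2.2.2.2
  omega

namespace IsGadget

variable {G : NatGraph} {C : Finset ℕ} {v u : ℕ} {R : Finset ℕ} {ι : Type*} {J : Finset ι}
  {node : ι → ℕ → ℕ}

/-- The ways to choose one root and, for each of its legs, the middle vertex or the end. -/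
def rootSets [DecidableEq ι] (R : Finset ℕ) (J : Finset ι) (node : ι → ℕ → ℕ) :
    Finset (Finset ℕ) :=
  (R.sigma fun c => (J.filter fun j => node j 0 = c).powerset).image
    fun p => insert p.1 (legSet J node p.2)

theorem mem_rootSets_iff [DecidableEq ι] {S : Finset ℕ} : S ∈ rootSets R J node ↔
    ∃ c ∈ R, ∃ T ⊆ J.filter (fun j => node j 0 = c), S = insert c (legSet J node T) := by
  simp only [rootSets, Finset.mem_image, Finset.mem_sigma, Finset.mem_powerset]
  constructor
  · rintro ⟨⟨c, T⟩, ⟨hc, hT⟩, rfl⟩; exact ⟨c, hc, T, hT, rfl⟩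
  · rintro ⟨c, hc, T, hT, rfl⟩; exact ⟨⟨c, T⟩, ⟨hc, hT⟩, rfl⟩

/-- The choice of root and legs is recovered from the set: c is the only root in it, and the ends in
it determine `T`. Each leg at c offers two options. -/
theorem card_rootSets [DecidableEq ι] (h : IsGadget G C v u R J node) :
    (rootSets R J node).card = ∑ c ∈ R, 2 ^ (J.filter fun j => node j 0 = c).card := by
  rw [rootSets, Finset.card_image_of_injOn, Finset.card_sigma]
  · simp only [Finset.card_powerset]
  · rintro ⟨c, T⟩ hp ⟨c', T'⟩ hp' heq
    rw [Finset.mem_coe, Finset.mem_sigma, Finset.mem_powerset] at hp hp'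
    dsimp only at hp hp' heq
    have hcc : c = c' := by
      have : c ∈ insert c' (legSet J node T') := heq ▸ Finset.mem_insert_self _ _
      exact (Finset.mem_insert.mp this).resolve_right (h.root_notMem_legSet T' hp.1)
    subst hcc
    have hTT : T = T' := by
      have key : ∀ {T₁ T₂ : Finset ι}, T₁ ⊆ J.filter (fun j => node j 0 = c) →
          insert c (legSet J node T₁) = insert c (legSet J node T₂) → T₁ ⊆ T₂ := by
        intro T₁ T₂ hT e j hj
        have hjJ := (Finset.mem_filter.mp (hT hj)).1
        have h1 : node j 3 ∈ insert c (legSet J node T₂) :=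
          e ▸ Finset.mem_insert_of_mem ((h.three_mem_legSet_iff hjJ).mpr hj)
        rcases Finset.mem_insert.mp h1 with h2 | h2
        · exact absurd (h2 ▸ hp.1) (h.notMem_root j hjJ 2 (by norm_num))
        · exact (h.three_mem_legSet_iff hjJ).mp h2
      exact Finset.Subset.antisymm (key hp.2 heq) (key hp'.2 heq.symm)
    rw [hTT]

theorem isDominatingSet_of_minTouching [DecidableEq ι] (h : IsGadget G C v u R J node)
    {D₀ : Finset ℕ} (hD₀ : D₀ ∈ touchingDS (G.deleteVerts (C : Set ℕ)) v u) :
    IsDominatingSet G (D₀ ∪ legSet J node ∅) :=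
  h.isDominatingSet_union (T := ∅) hD₀.1 hD₀.2.1 hD₀.2.2 (h.legSet_subset _) (Finset.Subset.refl _)
    (by simp) (by simp)

/-- The selected root dominates both v and u, so it completes the outer set at the price of the one
vertex saved there. -/
theorem isDominatingSet_of_saving [DecidableEq ι] (h : IsGadget G C v u R J node)
    {D₀ S : Finset ℕ} (hD₀ : D₀ ∈ savingSets (G.deleteVerts (C : Set ℕ)) v u)
    (hS : S ∈ rootSets R J node) : S ⊆ C ∧ S.card = J.card + 1 ∧ IsDominatingSet G (D₀ ∪ S) := by
  obtain ⟨c, hc, T, hT, rfl⟩ := mem_rootSets_iff.mp hS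
  have hSC : insert c (legSet J node T) ⊆ C :=
    Finset.insert_subset (h.root_mem_C hc) (h.legSet_subset T)
  refine ⟨hSC, ?_, ?_⟩
  · rw [Finset.card_insert_of_notMem (h.root_notMem_legSet T hc), h.card_legSet]
  · refine h.isDominatingSet_union (T := T) hD₀.1 hD₀.2.1 hD₀.2.2.1 hSC (Finset.subset_insert _ _)
      ?_ ?_
    · rintro a (rfl | rfl)
      · exact ⟨c, Finset.mem_insert_self _ _, (h.adj_root c hc _).mpr (Or.inl rfl)⟩
      · exact ⟨c, Finset.mem_insert_self _ _, (h.adj_root c hc _).mpr (Or.inr (Or.inl rfl))⟩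
    · intro j hj hjT
      rw [(Finset.mem_filter.mp (hT hjT)).2]
      exact Finset.mem_insert_self _ _

theorem disjoint_of_subset_deleteVerts {D₀ S : Finset ℕ}
    (hD₀ : (D₀ : Set ℕ) ⊆ (G.deleteVerts (C : Set ℕ)).verts) (hS : S ⊆ C) : Disjoint D₀ S := by
  rw [Finset.disjoint_left]
  exact fun a ha haS => (mem_deleteVerts.mp (hD₀ ha)).2 (hS haS)

theorem filter_union {D₀ S : Finset ℕ}
    (hD₀ : (D₀ : Set ℕ) ⊆ (G.deleteVerts (C : Set ℕ)).verts) (hS : S ⊆ C) :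
    (D₀ ∪ S).filter (· ∉ C) = D₀ ∧ (D₀ ∪ S).filter (· ∈ C) = S := by
  have h1 : ∀ a ∈ D₀, a ∉ C := fun a ha => (mem_deleteVerts.mp (hD₀ ha)).2
  have h2 : ∀ a ∈ S, a ∈ C := fun a ha => hS ha
  constructor <;> ext a <;> simp only [Finset.mem_filter, Finset.mem_union]
  · exact ⟨fun ⟨h, h'⟩ => h.resolve_right fun hs => h' (h2 a hs), fun h => ⟨Or.inl h, h1 a h⟩⟩
  · exact ⟨fun ⟨h, h'⟩ => h.resolve_left fun hs => h1 a hs h', fun h => ⟨Or.inr h, h2 a h⟩⟩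

/-- The number of minimum dominating sets of a graph with a gadget. -/
theorem numMinDS_eq (h : IsGadget G C v u R J node) (hfin : G.verts.Finite) (hR : 3 ≤ R.card)
    (k : ℤ) : numMinDS G (k + J.card) = gadgetCount (G.deleteVerts (C : Set ℕ)) v u k
      (∑ c ∈ R, 2 ^ (J.filter fun j => node j 0 = c).card) := by
  classical
  set H := G.deleteVerts (C : Set ℕ) with hH
  have hHfin : H.verts.Finite := hfin.subset fun a ha => (mem_deleteVerts.mp ha).1
  have hvH : v ∈ H.verts := mem_deleteVerts.mpr ⟨h.v_mem, h.v_notMem⟩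
  obtain ⟨D₁, hD₁⟩ := exists_minTouchingDS (u := u) hHfin hvH
  have hcardA : ∀ D₀ ∈ minTouchingDS H v u,
      (D₀ ∪ legSet J node ∅).card = touchingNumber H v u + J.card := fun D₀ hD₀ => by
    rw [Finset.card_union_of_disjoint (disjoint_of_subset_deleteVerts hD₀.1.1 (h.legSet_subset _)),
      h.card_legSet, hD₀.2]
  -- The lower bound for dominating sets is attained by a minimum touching set together with all
  -- middle vertices.
  have hmin : ∀ D, IsMinDominatingSet G D ↔
      IsDominatingSet G D ∧ D.card = touchingNumber H v u + J.card := by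
    refine fun D => and_congr_right fun hD => ⟨fun hm => ?_, fun he D' hD' => ?_⟩
    · apply le_antisymm
      · rw [← hcardA D₁ hD₁]
        exact hm _ (h.isDominatingSet_of_minTouching hD₁.1)
      · exact (h.card_dominatingSet hR hD).1
    · rw [he]; exact (h.card_dominatingSet hR hD').1
  rw [numMinDS, gadgetCount]
  split_ifs with hk
  swap
  · rw [Set.ncard_eq_zero (finite_setOf_subset hfin fun D hD => hD.1.1.1),
      Set.eq_empty_iff_forall_notMem]
    rintro D ⟨hD, hDk⟩
    rw [((hmin D).mp hD).2] at hDk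
    push_cast at hDk
    omega
  -- Minimum dominating sets correspond to pairs of an outer set and a gadget part. Both are
  -- recovered by intersecting with the complement of `C` and with `C`, hence the union map is
  -- injective.
  have hset : {D : Finset ℕ | IsMinDominatingSet G D ∧ (D.card : ℤ) ≤ k + J.card} =
      (fun p : Finset ℕ × Finset ℕ => p.1 ∪ p.2) ''
        (minTouchingDS H v u ×ˢ {legSet J node ∅} ∪ savingSets H v u ×ˢ ↑(rootSets R J node)) := by
    ext D
    simp only [Set.mem_ofPred_eq, hmin]
    constructor
    · rintro ⟨⟨hD, hc⟩, -⟩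
      refine ⟨(D.filter (· ∉ C), D.filter (· ∈ C)), ?_, ?_⟩
      · rcases (h.card_dominatingSet hR hD).2 hc with ⟨h1, h2⟩ | ⟨h1, h2⟩
        · exact Or.inl ⟨h1, h2⟩
        · exact Or.inr ⟨h1, mem_rootSets_iff.mpr h2⟩
      · dsimp only
        rw [Finset.union_comm, Finset.filter_union_filter_not_eq]
    · rintro ⟨⟨D₀, S⟩, ⟨h1, h2⟩ | ⟨h1, h2⟩, rfl⟩ <;> dsimp only at h1 h2 ⊢
      · rw [Set.mem_singleton_iff] at h2
        subst h2
        refine ⟨⟨h.isDominatingSet_of_minTouching h1.1, hcardA D₀ h1⟩, ?_⟩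
        rw [hcardA D₀ h1]; push_cast; omega
      · obtain ⟨hSC, hSc, hdom⟩ := h.isDominatingSet_of_saving h1 h2
        have hc : (D₀ ∪ S).card = touchingNumber H v u + J.card := by
          rw [Finset.card_union_of_disjoint (disjoint_of_subset_deleteVerts h1.1 hSC), hSc,
            ← h1.2.2.2]
          omega
        refine ⟨⟨hdom, hc⟩, ?_⟩
        rw [hc]; push_cast; omega
  have hP : ∀ p ∈ minTouchingDS H v u ×ˢ {legSet J node ∅} ∪
      savingSets H v u ×ˢ ↑(rootSets R J node), (p.1 : Set ℕ) ⊆ H.verts ∧ p.2 ⊆ C := by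
    rintro ⟨D₀, S⟩ (⟨h1, h2⟩ | ⟨h1, h2⟩)
    · exact ⟨h1.1.1, by rw [show S = _ from h2]; exact h.legSet_subset _⟩
    · exact ⟨h1.1, (h.isDominatingSet_of_saving h1 h2).1⟩
  have hinj : Set.InjOn (fun p : Finset ℕ × Finset ℕ => p.1 ∪ p.2)
      (minTouchingDS H v u ×ˢ {legSet J node ∅} ∪ savingSets H v u ×ˢ ↑(rootSets R J node)) := by
    rintro p hp q hq hpq
    obtain ⟨p1, p2⟩ := filter_union (hP p hp).1 (hP p hp).2
    obtain ⟨q1, q2⟩ := filter_union (hP q hq).1 (hP q hq).2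
    dsimp only at hpq
    rw [hpq] at p1 p2
    exact Prod.ext (p1.symm.trans q1) (p2.symm.trans q2)
  have hfA : (minTouchingDS H v u ×ˢ {legSet J node ∅}).Finite :=
    (finite_setOf_subset hHfin fun D hD => hD.1.1).prod (Set.finite_singleton _)
  have hfB : (savingSets H v u ×ˢ (rootSets R J node : Set (Finset ℕ))).Finite :=
    (finite_setOf_subset hHfin fun D hD => hD.1).prod (Finset.finite_toSet _)
  rw [hset, hinj.ncard_image, Set.ncard_union_eq
    ((disjoint_minTouchingDS_savingSets H v u).set_prod_left _ _) hfA hfB, Set.ncard_prod,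
    Set.ncard_prod, Set.ncard_singleton, mul_one, Set.ncard_coe_finset, h.card_rootSets]

/-- A wide diamond is a gadget without legs. -/
theorem of_isWideDiamond {G : NatGraph} {C : Finset ℕ} (h : IsWideDiamond G C) :
    ∃ v u, IsGadget G C v u C (∅ : Finset Empty) (fun _ _ => 0) := by
  obtain ⟨hC, v, u, hv, hu, hne, hN⟩ := h
  refine ⟨v, u, hne, hv.1, fun h => hv.2 h, hu.1, fun h => hu.2 h, hC, by simp, by simp, by simp,
    by simp, ?_, by simp, by simp, by simp⟩
  intro c hc a
  have := congrArg (a ∈ ·) (hN c hc)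
  simpa using this

end IsGadget

end

/-! ### Planarity of gadgets, and replacing a wide diamond by a gadget. -/

section

open Set

theorem IsPlanar.mono {G H : NatGraph} (h : H ≤ G) (hG : IsPlanar G) : IsPlanar H :=
  hG.map fun E => E.restrict h

/-- The vertices of legs. -/
def legVerts {ι : Type*} (J : Set ι) (node : ι → ℕ → ℕ) : Set ℕ :=
  {a | ∃ j ∈ J, ∃ k < 3, a = node j (k + 1)}

theorem deleteVerts_adj_iff {G : NatGraph} {X : Set ℕ} {a b : ℕ} :
    (G.deleteVerts X).Adj a b ↔ G.Adj a b ∧ a ∉ X ∧ b ∉ X := by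
  rw [SimpleGraph.Subgraph.deleteVerts_adj]
  exact ⟨fun ⟨_, h1, _, h2, h3⟩ => ⟨h3, h1, h2⟩,
    fun ⟨h, h1, h2⟩ => ⟨G.edge_vert h, h1, G.edge_vert h.symm, h2, h⟩⟩

namespace IsGadget

variable {G : NatGraph} {C : Finset ℕ} {v u : ℕ} {R : Finset ℕ} {ι : Type*} {J : Finset ι}
  {node : ι → ℕ → ℕ}

/-- The edges at a leg are those of the path. -/
theorem edge_of_leg (h : IsGadget G C v u R J node) {j : ι} (hj : j ∈ J) {k : ℕ} (hk : k < 3)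
    {b : ℕ} (hb : G.Adj (node j (k + 1)) b) :
    ∃ k' < 3, s(node j (k + 1), b) = s(node j k', node j (k' + 1)) := by
  interval_cases k
  · rcases (h.adj_one j hj b).mp hb with rfl | rfl
    · exact ⟨0, by norm_num, Sym2.eq_swap⟩
    · exact ⟨1, by norm_num, rfl⟩
  · rcases (h.adj_two j hj b).mp hb with rfl | rfl
    · exact ⟨1, by norm_num, Sym2.eq_swap⟩
    · exact ⟨2, by norm_num, rfl⟩
  · obtain rfl := (h.adj_three j hj b).mp hb
    exact ⟨2, by norm_num, Sym2.eq_swap⟩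

theorem notMem_legVerts_of_root (h : IsGadget G C v u R J node) {c : ℕ} (hc : c ∈ R) {X : Set ι}
    (hX : X ⊆ J) : c ∉ legVerts X node := by
  rintro ⟨j, hj, k, hk, rfl⟩
  exact h.notMem_root j (hX hj) k hk hc

theorem notMem_legVerts (h : IsGadget G C v u R J node) {a : ℕ} (ha : a ∉ C) {X : Set ι}
    (hX : X ⊆ J) : a ∉ legVerts X node := by
  rintro ⟨j, hj, k, hk, rfl⟩
  exact ha (h.leg_mem_C (hX hj) hk)

/-- A graph with a gadget is planar if it is planar without the legs. -/
theorem isPlanar (h : IsGadget G C v u R J node) (hfin : G.verts.Finite)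
    (hG : IsPlanar (G.deleteVerts (legVerts (J : Set ι) node))) : IsPlanar G := by
  classical
  -- Induction on the set S of roots that already carry their legs. A root still without legs has
  -- degree two, as sliding requires.
  have key : ∀ S ⊆ R, IsPlanar (G.deleteVerts (legVerts {j ∈ (J : Set ι) | node j 0 ∉ S} node)) := by
    intro S hS
    induction S using Finset.induction_on with
    | empty => simpa using hG
    | insert c S hcS ih =>
      have hcR : c ∈ R := hS (Finset.mem_insert_self _ _)
      have ih := ih ((Finset.subset_insert _ _).trans hS)
      set X : Set ι := {j ∈ (J : Set ι) | node j 0 ∉ S} with hX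
      set X' : Set ι := {j ∈ (J : Set ι) | node j 0 ∉ insert c S} with hX'
      have hXJ : X ⊆ J := fun j hj => hj.1
      have hlegs : ∀ a, a ∉ legVerts X' node → a ∉ legVerts X node ∨
          ∃ j ∈ {j ∈ (J : Set ι) | node j 0 = c}, ∃ k < 3, a = node j (k + 1) := by
        intro a ha
        by_cases haX : a ∈ legVerts X node
        · obtain ⟨j, hj, k, hk, rfl⟩ := haX
          refine Or.inr ⟨j, ⟨hj.1, ?_⟩, k, hk, rfl⟩
          by_contra hne
          exact ha ⟨j, ⟨hj.1, by rw [Finset.mem_insert]; exact fun hh => hh.elim hne hj.2⟩,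
            k, hk, rfl⟩
        · exact Or.inl haX
      refine isPlanar_of_attach (K := G.deleteVerts (legVerts X node))
        (J := {j ∈ (J : Set ι) | node j 0 = c}) (node := node) (c := c) (v := v) (u := u)
        (hfin.subset fun a ha => ha.1) ih h.ne ?_ (fun j hj => hj.2) ?_ ?_ ?_ ?_
      · intro a
        rw [deleteVerts_adj_iff, h.adj_root c hcR]
        constructor
        · rintro ⟨rfl | rfl | ⟨j, hj, rfl, rfl⟩, -, ha⟩
          · exact Or.inl rfl
          · exact Or.inr rfl
          · exact absurd ⟨j, ⟨hj, hcS⟩, 0, by norm_num, rfl⟩ ha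
        · rintro (rfl | rfl)
          · exact ⟨Or.inl rfl, h.notMem_legVerts_of_root hcR hXJ, h.notMem_legVerts h.v_notMem hXJ⟩
          · exact ⟨Or.inr (Or.inl rfl), h.notMem_legVerts_of_root hcR hXJ,
              h.notMem_legVerts h.u_notMem hXJ⟩
      · rintro j ⟨hj, hjc⟩ k hk ⟨-, hmem⟩
        exact hmem ⟨j, ⟨hj, hjc ▸ hcS⟩, k, hk, rfl⟩
      · exact fun j hj j' hj' => h.inj j hj.1 j' hj'.1
      · rintro a ⟨haG, ha⟩
        exact (hlegs a ha).imp (fun h => ⟨haG, h⟩) id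
      · intro e he
        induction e with
        | h a b =>
          obtain ⟨hab, ha, hb⟩ := deleteVerts_adj_iff.mp he
          rcases hlegs a ha with ha' | ⟨j, hj, k, hk, rfl⟩
          · rcases hlegs b hb with hb' | ⟨j, hj, k, hk, rfl⟩
            · exact Or.inl (deleteVerts_adj_iff.mpr ⟨hab, ha', hb'⟩)
            · obtain ⟨k', hk', e⟩ := h.edge_of_leg hj.1 hk hab.symm
              exact Or.inr ⟨j, hj, k', hk', by rw [Sym2.eq_swap, e]⟩
          · obtain ⟨k', hk', e⟩ := h.edge_of_leg hj.1 hk hab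
            exact Or.inr ⟨j, hj, k', hk', e⟩
  have hR := key R (Finset.Subset.refl _)
  have hX : ∀ a, a ∉ legVerts {j ∈ (J : Set ι) | node j 0 ∉ R} node := by
    rintro a ⟨j, hj, -⟩
    exact hj.2 (h.root_mem j hj.1)
  refine hR.mono ⟨?_, fun a b hab => deleteVerts_adj_iff.mpr ⟨hab, hX a, hX b⟩⟩
  intro a ha
  exact ⟨ha, hX a⟩

theorem openNbhd_eq (h : IsGadget G C v u R J node) (hR : R.Nonempty) :
    openNbhd G (C : Set ℕ) = {v, u} := by
  obtain ⟨c, hc⟩ := hR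
  ext a
  constructor
  · rintro ⟨⟨x, hx, hxa⟩, ha⟩
    exact (h.adj_outside hx ha hxa).2
  · rintro (rfl | rfl)
    · exact ⟨⟨c, h.root_mem_C hc, (h.adj_root c hc _).mpr (Or.inl rfl)⟩, h.v_notMem⟩
    · exact ⟨⟨c, h.root_mem_C hc, (h.adj_root c hc _).mpr (Or.inr (Or.inl rfl))⟩, h.u_notMem⟩

end IsGadget

/-- Names, taken from `C`, for the roots and the legs of a gadget. -/
structure IsNaming (C R : Finset ℕ) {ι : Type*} (J : Finset ι) (node : ι → ℕ → ℕ) : Prop where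
  root_mem : ∀ j ∈ J, node j 0 ∈ R
  subset : R ⊆ C
  leg_mem : ∀ j ∈ J, ∀ k < 3, node j (k + 1) ∈ C
  notMem_root : ∀ j ∈ J, ∀ k < 3, node j (k + 1) ∉ R
  inj : ∀ j ∈ J, ∀ j' ∈ J, ∀ k < 3, ∀ k' < 3, node j (k + 1) = node j' (k' + 1) → j = j' ∧ k = k'

/-- The vertices of the gadget. -/
def gadgetVerts (R : Finset ℕ) {ι : Type*} (J : Finset ι) (node : ι → ℕ → ℕ) : Finset ℕ :=
  R ∪ (J ×ˢ Finset.range 3).image fun p => node p.1 (p.2 + 1)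

theorem mem_gadgetVerts {R : Finset ℕ} {ι : Type*} {J : Finset ι} {node : ι → ℕ → ℕ} {a : ℕ} :
    a ∈ gadgetVerts R J node ↔ a ∈ R ∨ ∃ j ∈ J, ∃ k < 3, a = node j (k + 1) := by
  simp only [gadgetVerts, Finset.mem_union, Finset.mem_image, Finset.mem_product, Finset.mem_range,
    Prod.exists]
  refine or_congr_right ⟨?_, ?_⟩
  · rintro ⟨j, k, ⟨hj, hk⟩, rfl⟩; exact ⟨j, hj, k, hk, rfl⟩
  · rintro ⟨j, hj, k, hk, rfl⟩; exact ⟨j, k, ⟨hj, hk⟩, rfl⟩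

/-- The edges of the legs, from the root outwards. -/
def LegEdge {ι : Type*} (J : Finset ι) (node : ι → ℕ → ℕ) (a b : ℕ) : Prop :=
  ∃ j ∈ J, ∃ k < 3, a = node j k ∧ b = node j (k + 1)

namespace IsNaming

variable {C R : Finset ℕ} {ι : Type*} {J : Finset ι} {node : ι → ℕ → ℕ}

theorem node_mem (h : IsNaming C R J node) {j : ι} (hj : j ∈ J) {k : ℕ} (hk : k ≤ 3) :
    node j k ∈ gadgetVerts R J node := by
  rw [mem_gadgetVerts]
  rcases k with _ | k
  · exact Or.inl (h.root_mem j hj)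
  · exact Or.inr ⟨j, hj, k, hk, rfl⟩

theorem gadgetVerts_subset (h : IsNaming C R J node) : gadgetVerts R J node ⊆ C := by
  intro a ha
  rcases mem_gadgetVerts.mp ha with ha | ⟨j, hj, k, hk, rfl⟩
  · exact h.subset ha
  · exact h.leg_mem j hj k hk

theorem legEdge_ne (h : IsNaming C R J node) {a b : ℕ} (hab : LegEdge J node a b) : a ≠ b := by
  obtain ⟨j, hj, k, hk, rfl, rfl⟩ := hab
  intro e
  rcases k with _ | k
  · exact h.notMem_root j hj 0 hk (e ▸ h.root_mem j hj)
  · have := (h.inj j hj j hj k (by omega) (k + 1) hk e).2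
    omega

theorem legEdge_mem (h : IsNaming C R J node) {a b : ℕ} (hab : LegEdge J node a b) :
    a ∈ gadgetVerts R J node ∧ b ∈ gadgetVerts R J node := by
  obtain ⟨j, hj, k, hk, rfl, rfl⟩ := hab
  exact ⟨h.node_mem hj hk.le, h.node_mem hj hk⟩

/-- The graph in which `C` has been replaced by a gadget. -/
def replace (h : IsNaming C R J node) (G : NatGraph) (hC : (C : Set ℕ) ⊆ G.verts) : NatGraph where
  verts := {a | a ∈ G.verts ∧ (a ∈ C → a ∈ gadgetVerts R J node)}
  -- Of the old edges at `C` only those at roots are kept; the remaining names of `C` are isolated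
  -- and become leg vertices or disappear.
  Adj a b := (G.Adj a b ∧ (a ∈ C → a ∈ R) ∧ (b ∈ C → b ∈ R)) ∨ LegEdge J node a b ∨
    LegEdge J node b a
  adj_sub := by
    rintro a b (⟨hab, -⟩ | hab | hab)
    · exact G.adj_sub hab
    · exact h.legEdge_ne hab
    · exact (h.legEdge_ne hab).symm
  edge_vert := by
    rintro a b (⟨hab, ha, -⟩ | hab | hab)
    · exact ⟨G.edge_vert hab, fun haC => mem_gadgetVerts.mpr (Or.inl (ha haC))⟩
    · exact ⟨hC (h.gadgetVerts_subset (h.legEdge_mem hab).1), fun _ => (h.legEdge_mem hab).1⟩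
    · exact ⟨hC (h.gadgetVerts_subset (h.legEdge_mem hab).2), fun _ => (h.legEdge_mem hab).2⟩
  symm := ⟨by
    rintro a b (⟨hab, ha, hb⟩ | hab | hab)
    · exact Or.inl ⟨hab.symm, hb, ha⟩
    · exact Or.inr (Or.inr hab)
    · exact Or.inr (Or.inl hab)⟩

variable {G : NatGraph} {v u : ℕ} {κ : Type*} {node₀ : κ → ℕ → ℕ}

theorem replace_deleteVerts (h : IsNaming C R J node) (hC : (C : Set ℕ) ⊆ G.verts) :
    (h.replace G hC).deleteVerts (gadgetVerts R J node : Set ℕ) = G.deleteVerts (C : Set ℕ) := by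
  apply SimpleGraph.Subgraph.ext
  · ext a
    constructor
    · rintro ⟨⟨haG, haC⟩, ha⟩; exact ⟨haG, fun hh => ha (haC hh)⟩
    · rintro ⟨haG, haC⟩; exact ⟨⟨haG, fun hh => absurd hh haC⟩, fun hh => haC (h.gadgetVerts_subset hh)⟩
  · ext a b
    rw [deleteVerts_adj_iff, deleteVerts_adj_iff]
    constructor
    · rintro ⟨⟨hab, haR, hbR⟩ | hab | hab, ha, hb⟩
      · exact ⟨hab, fun hh => ha (mem_gadgetVerts.mpr (Or.inl (haR hh))),
          fun hh => hb (mem_gadgetVerts.mpr (Or.inl (hbR hh)))⟩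
      · exact absurd (h.legEdge_mem hab).1 ha
      · exact absurd (h.legEdge_mem hab).2 ha
    · rintro ⟨hab, ha, hb⟩
      exact ⟨Or.inl ⟨hab, fun hh => absurd hh ha, fun hh => absurd hh hb⟩,
        fun hh => ha (h.gadgetVerts_subset hh), fun hh => hb (h.gadgetVerts_subset hh)⟩

theorem legEdge_succ_right (h : IsNaming C R J node) {j : ι} (hj : j ∈ J) {k : ℕ} (hk : k < 3)
    {a : ℕ} : LegEdge J node a (node j (k + 1)) ↔ a = node j k := by
  constructor
  · rintro ⟨j', hj', k', hk', rfl, e⟩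
    obtain ⟨rfl, rfl⟩ := h.inj j hj j' hj' k hk k' hk' e
    rfl
  · rintro rfl; exact ⟨j, hj, k, hk, rfl, rfl⟩

theorem legEdge_succ_left (h : IsNaming C R J node) {j : ι} (hj : j ∈ J) {k : ℕ} (hk : k < 3)
    {b : ℕ} : LegEdge J node (node j (k + 1)) b ↔ k + 1 < 3 ∧ b = node j (k + 2) := by
  constructor
  · rintro ⟨j', hj', k', hk', e, rfl⟩
    rcases k' with _ | k'
    · exact absurd (e ▸ h.root_mem j' hj') (h.notMem_root j hj k hk)
    · obtain ⟨rfl, rfl⟩ := h.inj j hj j' hj' k hk k' (by omega) e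
      exact ⟨hk', rfl⟩
  · rintro ⟨hk', rfl⟩; exact ⟨j, hj, k + 1, hk', rfl, rfl⟩

theorem replace_isGadget (h : IsNaming C R J node)
    (hG : IsGadget G C v u C (∅ : Finset κ) node₀) :
    IsGadget (h.replace G hG.subset) (gadgetVerts R J node) v u R J node := by
  -- The name of a leg vertex lies in `C` and is not a root, so no old edge survives at it.
  have hleg : ∀ j ∈ J, ∀ k < 3, ∀ a, (h.replace G hG.subset).Adj (node j (k + 1)) a ↔
      (k + 1 < 3 ∧ a = node j (k + 2)) ∨ a = node j k := by
    intro j hj k hk a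
    rw [← h.legEdge_succ_left hj hk, ← h.legEdge_succ_right hj hk]
    refine ⟨fun hh => hh.resolve_left ?_, Or.inr⟩
    rintro ⟨-, ha, -⟩
    exact h.notMem_root j hj k hk (ha (h.leg_mem j hj k hk))
  refine
    { ne := hG.ne
      v_mem := ⟨hG.v_mem, fun hh => absurd hh hG.v_notMem⟩
      v_notMem := fun hh => hG.v_notMem (h.gadgetVerts_subset hh)
      u_mem := ⟨hG.u_mem, fun hh => absurd hh hG.u_notMem⟩
      u_notMem := fun hh => hG.u_notMem (h.gadgetVerts_subset hh)
      subset := fun a ha => ⟨hG.subset (h.gadgetVerts_subset ha), fun _ => ha⟩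
      mem_iff := fun a => mem_gadgetVerts
      root_mem := h.root_mem
      notMem_root := h.notMem_root
      inj := h.inj
      adj_root := ?_
      adj_one := ?_
      adj_two := ?_
      adj_three := ?_ }
  · intro c hc a
    constructor
    · rintro (⟨hca, -, -⟩ | ⟨j, hj, k, hk, e, rfl⟩ | ⟨j, hj, k, hk, rfl, e⟩)
      · simpa using (hG.adj_root c (h.subset hc) a).mp hca |>.imp_right
          (fun hh => Or.inl (hh.resolve_right (by simp)))
      · rcases k with _ | k
        · exact Or.inr (Or.inr ⟨j, hj, e.symm, rfl⟩)
        · exact absurd (e ▸ hc) (h.notMem_root j hj k (by omega))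
      · exact absurd (e ▸ hc) (h.notMem_root j hj k hk)
    · rintro (rfl | rfl | ⟨j, hj, rfl, rfl⟩)
      · exact Or.inl ⟨(hG.adj_root c (h.subset hc) _).mpr (Or.inl rfl), fun _ => hc,
          fun hh => absurd hh hG.v_notMem⟩
      · exact Or.inl ⟨(hG.adj_root c (h.subset hc) _).mpr (Or.inr (Or.inl rfl)), fun _ => hc,
          fun hh => absurd hh hG.u_notMem⟩
      · exact Or.inr (Or.inl ⟨j, hj, 0, by norm_num, rfl, rfl⟩)
  · intro j hj a
    rw [show node j 1 = node j (0 + 1) from rfl, hleg j hj 0 (by norm_num)]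
    norm_num [or_comm]
  · intro j hj a
    rw [show node j 2 = node j (1 + 1) from rfl, hleg j hj 1 (by norm_num)]
    norm_num [or_comm]
  · intro j hj a
    rw [show node j 3 = node j (2 + 1) from rfl, hleg j hj 2 (by norm_num)]
    norm_num

/-- Without its legs the new graph is a subgraph of the old one. -/
theorem replace_isPlanar (h : IsNaming C R J node)
    (hG : IsGadget G C v u C (∅ : Finset κ) node₀) (hfin : G.verts.Finite) (hpl : IsPlanar G) :
    IsPlanar (h.replace G hG.subset) := by
  refine (h.replace_isGadget hG).isPlanar (hfin.subset fun a ha => ha.1) (hpl.mono ⟨?_, ?_⟩)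
  · exact fun a ha => ha.1.1
  · intro a b hab
    obtain ⟨hab, ha, hb⟩ := deleteVerts_adj_iff.mp hab
    rcases hab with hab | ⟨j, hj, k, hk, rfl, rfl⟩ | ⟨j, hj, k, hk, rfl, rfl⟩
    · exact hab.1
    · exact absurd ⟨j, hj, k, hk, rfl⟩ hb
    · exact absurd ⟨j, hj, k, hk, rfl⟩ ha

/-- Replacing a wide diamond by a gadget of the same weight preserves the number of minimum
dominating sets. -/
theorem numMinDS_replace (h : IsNaming C R J node)
    (hG : IsGadget G C v u C (∅ : Finset κ) node₀) (hfin : G.verts.Finite) (hC : 3 ≤ C.card)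
    (hR : 3 ≤ R.card) [DecidableEq ι]
    (hw : ∑ c ∈ R, 2 ^ (J.filter fun j => node j 0 = c).card = C.card) (k : ℤ) :
    numMinDS G k = numMinDS (h.replace G hG.subset) (k + J.card) := by
  -- Both counts are the same `gadgetCount` of the common graph without gadget; the diamond itself
  -- is a gadget with no legs and weight `C.card`.
  rw [(h.replace_isGadget hG).numMinDS_eq (hfin.subset fun a ha => ha.1) hR, hw,
    h.replace_deleteVerts]
  have := hG.numMinDS_eq hfin hC k
  simpa using this

end IsNaming

end

/-! ### Halting and running time of RAM programs. -/

namespace RAM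

/-- A sequence of commands. -/
def block (l : List Cmd) : Cmd := l.foldr Cmd.seq Cmd.skip

/-- Commands that take one step. -/
def IsBasic : Cmd → Prop
  | .seq _ _ => False
  | .ifPos _ _ _ => False
  | .whilePos _ _ => False
  | _ => True

/-- The effect of a basic command. -/
def step (σ : State) : Cmd → State
  | .const r z => { σ with reg := Function.update σ.reg r z }
  | .add r s t => { σ with reg := Function.update σ.reg r (σ.reg s + σ.reg t) }
  | .sub r s t => { σ with reg := Function.update σ.reg r (σ.reg s - σ.reg t) }
  | .load r s => { σ with reg := Function.update σ.reg r (σ.mem (σ.reg s)) }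
  | .store r s => { σ with mem := Function.update σ.mem (σ.reg r) (σ.reg s) }
  | .write r => { σ with out := σ.out ++ [σ.reg r] }
  | _ => σ

theorem Exec.step {c : Cmd} (hc : IsBasic c) (σ : State) : Exec c σ 1 (RAM.step σ c) := by
  cases c with
  | skip => exact .skip σ
  | const r z => exact .const σ r z
  | add r s t => exact .add σ r s t
  | sub r s t => exact .sub σ r s t
  | load r s => exact .load σ r s
  | store r s => exact .store σ r s
  | write r => exact .write σ r
  | seq => exact hc.elim
  | ifPos => exact hc.elim
  | whilePos => exact hc.elim

/-- Started in `σ`, the program halts within `n` steps in a configuration satisfying `Q`. -/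
def Halts (c : Cmd) (σ : State) (n : ℕ) (Q : State → Prop) : Prop :=
  ∃ t ≤ n, ∃ τ, Exec c σ t τ ∧ Q τ

namespace Halts

variable {a b : Cmd} {σ : State} {m n : ℕ} {Q Q' : State → Prop}

theorem mono (h : Halts a σ m Q) (hmn : m ≤ n) (hQ : ∀ τ, Q τ → Q' τ) : Halts a σ n Q' := by
  obtain ⟨t, ht, τ, he, hτ⟩ := h
  exact ⟨t, ht.trans hmn, τ, he, hQ τ hτ⟩

theorem seq (h : Halts a σ m Q) (h' : ∀ τ, Q τ → Halts b τ n Q') :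
    Halts (.seq a b) σ (m + n) Q' := by
  obtain ⟨t, ht, τ, he, hτ⟩ := h
  obtain ⟨t', ht', υ, he', hυ⟩ := h' τ hτ
  exact ⟨t + t', Nat.add_le_add ht ht', υ, .seq he he', hυ⟩

theorem skip (h : Q σ) : Halts .skip σ 1 Q := ⟨1, le_rfl, σ, .skip σ, h⟩

theorem block {l : List Cmd} (hl : ∀ c ∈ l, IsBasic c) (h : Q (l.foldl step σ)) :
    Halts (block l) σ (l.length + 1) Q := by
  induction l generalizing σ with
  | nil => exact ⟨1, le_rfl, σ, .skip σ, h⟩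
  | cons c l ih =>
    obtain ⟨t, ht, τ, he, hτ⟩ := ih (σ := step σ c) (fun c hc => hl c (List.mem_cons_of_mem _ hc)) h
    refine ⟨1 + t, ?_, τ, .seq (Exec.step (hl c List.mem_cons_self) σ) he, hτ⟩
    simp only [List.length_cons]; omega

theorem ifPos {r : ℕ} (h1 : 0 < σ.reg r → Halts a σ n Q) (h2 : ¬ 0 < σ.reg r → Halts b σ n Q) :
    Halts (.ifPos r a b) σ (1 + n) Q := by
  by_cases h : 0 < σ.reg r
  · obtain ⟨t, ht, τ, he, hτ⟩ := h1 h
    exact ⟨1 + t, by omega, τ, .ifPos_true h he, hτ⟩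
  · obtain ⟨t, ht, τ, he, hτ⟩ := h2 h
    exact ⟨1 + t, by omega, τ, .ifPos_false h he, hτ⟩

/-- A loop with an invariant and a bound on the number of remaining rounds. -/
theorem whilePos {r : ℕ} {K : ℕ} (Inv : ℕ → State → Prop)
    (hstep : ∀ m σ, Inv m σ → 0 < σ.reg r → Halts a σ K fun τ => ∃ m' < m, Inv m' τ)
    {m : ℕ} (h : Inv m σ) :
    Halts (.whilePos r a) σ ((K + 1) * m + 1) fun τ => (∃ m', Inv m' τ) ∧ ¬ 0 < τ.reg r := by
  -- A round costs at most K steps and one test and lowers the measure; one more step is the final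
  -- failing test.
  induction m using Nat.strong_induction_on generalizing σ with
  | _ m ih =>
    by_cases hr : 0 < σ.reg r
    · obtain ⟨t, ht, τ, he, m', hm', hτ⟩ := hstep m σ h hr
      obtain ⟨t', ht', υ, he', hυ⟩ := ih m' hm' hτ
      refine ⟨1 + t + t', ?_, υ, .while_true hr he he', hυ⟩
      have : (K + 1) * (m' + 1) ≤ (K + 1) * m := Nat.mul_le_mul_left _ hm'
      have h2 : (K + 1) * (m' + 1) = (K + 1) * m' + (K + 1) := by ring
      omega
    · exact ⟨1, by omega, σ, .while_false hr, ⟨m, h⟩, hr⟩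

end Halts

/-- Registers given by a list. -/
def regs (l : List ℤ) : ℕ → ℤ := fun i => l.getD i 0

theorem update_regs {l : List ℤ} {r : ℕ} (h : r < l.length) (z : ℤ) :
    Function.update (regs l) r z = regs (l.set r z) := by
  funext i
  by_cases hi : i = r
  · subst hi
    simp [regs, h]
  · rw [Function.update_of_ne hi]
    simp [regs, List.getD_eq_getElem?_getD, List.getElem?_set_ne (Ne.symm hi)]

/-- A memory with the input word at the nonnegative addresses and a value for each name at the
negative ones. -/
def memOf (w : List ℤ) (f : ℕ → ℤ) : ℤ → ℤ :=
  fun i => if 0 ≤ i then w.getD i.toNat 0 else f (-1 - i).toNat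

theorem memOf_nat (w : List ℤ) (f : ℕ → ℤ) (i : ℕ) : memOf w f i = w.getD i 0 := by
  simp [memOf]

theorem memOf_neg (w : List ℤ) (f : ℕ → ℤ) (a : ℕ) : memOf w f (0 - (a : ℤ) - 1) = f a := by
  rw [memOf, if_neg (by omega)]
  congr 1; omega

theorem update_memOf (w : List ℤ) (f : ℕ → ℤ) (a : ℕ) (z : ℤ) :
    Function.update (memOf w f) (0 - (a : ℤ) - 1) z = memOf w (Function.update f a z) := by
  funext i
  by_cases hi : i = 0 - (a : ℤ) - 1
  · subst hi
    rw [Function.update_self, memOf_neg, Function.update_self]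
  · rw [Function.update_of_ne hi, memOf, memOf]
    split_ifs with h
    · rfl
    · rw [Function.update_of_ne]; omega

/-- The list has fourteen entries because the program uses the registers 0 to 13. -/
theorem init_eq (w : List ℤ) :
    init w = ⟨regs [w.length, 0, 0, 0, 0, 0, 0, 0, 0, 0, 0, 0, 0, 0], memOf w fun _ => 0, []⟩ := by
  simp only [init, State.mk.injEq, and_true]
  constructor
  · funext r
    rcases r with _ | r
    · simp [regs]
    · simp only [regs, Nat.add_eq_zero_iff, one_ne_zero, and_false, if_false, List.getD_cons_succ]
      by_cases h : r < 13
      · interval_cases r <;> rfl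
      · rw [List.getD_eq_default]; simpa using h
  · funext i; rfl

/-- The word `l` stands in `w` at position `i`. -/
def At (w : List ℤ) (i : ℕ) (l : List ℤ) : Prop := ∃ pre post, w = pre ++ l ++ post ∧ pre.length = i

theorem At.getD {w : List ℤ} {i : ℕ} {a : ℤ} {l : List ℤ} (h : At w i (a :: l)) :
    w.getD i 0 = a := by
  obtain ⟨pre, post, rfl, rfl⟩ := h
  simp [List.getD_eq_getElem?_getD]

theorem At.right {w : List ℤ} {i : ℕ} {l l' : List ℤ} (h : At w i (l ++ l')) :
    At w (i + l.length) l' := by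
  obtain ⟨pre, post, rfl, rfl⟩ := h
  exact ⟨pre ++ l, post, by simp, by simp⟩

theorem At.left {w : List ℤ} {i : ℕ} {l l' : List ℤ} (h : At w i (l ++ l')) : At w i l := by
  obtain ⟨pre, post, rfl, rfl⟩ := h
  exact ⟨pre, l' ++ post, by simp, rfl⟩

/-- The configuration with all registers in use made explicit. -/
def conf (w : List ℤ) (i t s : ℤ) (l : List ℤ) (f : ℕ → ℤ) (o : List ℤ) : State :=
  -- Registers 0 and 3 hold the constants 0 and 1; 1 is the read pointer, 2 the current entry, 4 a
  -- loop guard. In `l`, register 5 is the start of the list C, 6 the weight still to be placed, 7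
  -- the address of the next unused name, 8 the weight of the current root, 9 that root, 10 the
  -- number of legs, 11 the bound k; 12 and 13 are for scratch, the previous leg vertex and the
  -- guard for legs.
  ⟨regs (0 :: i :: t :: 1 :: s :: l), memOf w f, o⟩

/-- Move on to the next entry of a list in memory. -/
def advance : Cmd := block [.add 1 1 3, .load 2 1, .add 4 2 3]

/-- Run `a` for all entries of a list in memory, up to the first negative entry. -/
def foreach (a : Cmd) : Cmd :=
  .seq (block [.load 2 1, .add 4 2 3]) (.whilePos 4 (.seq a advance))

variable {w : List ℤ}

/-- Unfolding of the registers after a run of basic commands. -/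
theorem Halts.advance {i : ℕ} {t s : ℤ} {l : List ℤ} {f : ℕ → ℤ} {o : List ℤ} {Q : State → Prop}
    (h : Q (conf w (i + 1 : ℕ) (w.getD (i + 1) 0) (w.getD (i + 1) 0 + 1) l f o)) :
    Halts advance (conf w i t s l f o) 4 Q := by
  refine Halts.block (by simp [IsBasic]) ?_
  have e : memOf w f ((i : ℤ) + 1) = w.getD (i + 1) 0 := by exact_mod_cast memOf_nat w f (i + 1)
  push_cast at h
  simpa [step, conf, update_regs, regs, e] using h

/-- The guard is the current entry plus one, so it is positive for names and zero at the closing -1.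
The invariant refers to the entries still ahead. The body itself moves over the tail of a longer
entry, such as the second end of an edge; `advance` takes four steps and the test one. -/
theorem Halts.foreach_loop {α : Type*} {enc : α → List ℤ} {hd : α → ℕ} {tl : α → List ℤ}
    (henc : ∀ a, enc a = (hd a : ℤ) :: tl a)
    (Inv : List α → List ℤ → (ℕ → ℤ) → List ℤ → Prop) {body : Cmd} {K : ℕ}
    (hbody : ∀ (a : α) (L : List α) (i : ℕ) (l : List ℤ) (f : ℕ → ℤ) (o : List ℤ),
      Inv (a :: L) l f o → At w i (enc a) →
      Halts body (conf w i (hd a) (hd a + 1) l f o) K fun τ => ∃ t s l' f' o',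
        τ = conf w (i + (tl a).length : ℕ) t s l' f' o' ∧ Inv L l' f' o')
    (L : List α) {i : ℕ} {l : List ℤ} {f : ℕ → ℤ} {o : List ℤ} (hInv : Inv L l f o)
    (hat : At w i (L.flatMap enc ++ [-1])) :
    Halts (.whilePos 4 (.seq body RAM.advance)) (conf w i (w.getD i 0) (w.getD i 0 + 1) l f o)
      ((K + 5) * L.length + 1) fun τ => ∃ t s l' f' o',
        τ = conf w (i + (L.flatMap enc).length : ℕ) t s l' f' o' ∧ Inv [] l' f' o' := by
  induction L generalizing i l f o with
  | nil =>
    have h1 : w.getD i 0 = -1 := At.getD (l := []) (by simpa using hat)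
    rw [h1]
    refine ⟨1, by simp, _, .while_false ?_, -1, 0, l, f, o, by simp [conf], hInv⟩
    simp [conf, regs]
  | cons a L ih =>
    rw [List.flatMap_cons, List.append_assoc] at hat
    have h1 : w.getD i 0 = hd a := At.getD (by simpa [henc] using hat)
    have h2 := (hat.right)
    rw [henc, List.length_cons] at h2
    obtain ⟨t₁, ht₁, τ₁, he₁, t, s, l', f', o', rfl, hInv'⟩ := hbody a L i l f o hInv hat.left
    obtain ⟨t₂, ht₂, τ₂, he₂, hτ₂⟩ := Halts.advance (w := w) (i := i + (tl a).length) (t := t) (s := s)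
      (l := l') (f := f') (o := o') (Q := fun τ => τ = _) rfl
    subst hτ₂
    obtain ⟨t₃, ht₃, τ₃, he₃, t', s', l'', f'', o'', rfl, hQ⟩ := ih hInv'
      (i := i + (tl a).length + 1) (by rwa [Nat.add_assoc])
    rw [h1]
    refine ⟨1 + (t₁ + t₂) + t₃, ?_, _, .while_true ?_ (.seq he₁ he₂) he₃, t', s', l'', f'', o'', ?_,
      hQ⟩
    · rw [List.length_cons, Nat.mul_add]; omega
    · simp only [conf, regs, List.getD_cons_succ, List.getD_cons_zero]; omega
    · congr 2
      rw [List.flatMap_cons, List.length_append, henc a, List.length_cons]; omega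

theorem Halts.foreach {α : Type*} {enc : α → List ℤ} {hd : α → ℕ} {tl : α → List ℤ}
    (henc : ∀ a, enc a = (hd a : ℤ) :: tl a)
    (Inv : List α → List ℤ → (ℕ → ℤ) → List ℤ → Prop) {body : Cmd} {K : ℕ}
    (hbody : ∀ (a : α) (L : List α) (i : ℕ) (l : List ℤ) (f : ℕ → ℤ) (o : List ℤ),
      Inv (a :: L) l f o → At w i (enc a) →
      Halts body (conf w i (hd a) (hd a + 1) l f o) K fun τ => ∃ t s l' f' o',
        τ = conf w (i + (tl a).length : ℕ) t s l' f' o' ∧ Inv L l' f' o')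
    (L : List α) {i : ℕ} {t s : ℤ} {l : List ℤ} {f : ℕ → ℤ} {o : List ℤ} (hInv : Inv L l f o)
    (hat : At w i (L.flatMap enc ++ [-1])) :
    Halts (foreach body) (conf w i t s l f o)
      ((K + 5) * L.length + 4) fun τ => ∃ t s l' f' o',
        τ = conf w (i + (L.flatMap enc).length : ℕ) t s l' f' o' ∧ Inv [] l' f' o' := by
  refine (Halts.seq (m := 3) (n := (K + 5) * L.length + 1) (Q := fun τ => τ = conf w i (w.getD i 0) (w.getD i 0 + 1) l f o)
    (Halts.block (by simp [IsBasic]) ?_) ?_).mono ?_ fun τ h => h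
  · simp [step, conf, update_regs, regs, memOf_nat]
  · rintro τ rfl
    exact Halts.foreach_loop henc Inv hbody L hInv hat
  · omega


end RAM

/-! ### Layouts: how names and flags record a gadget. -/

section

open Set

/-- The vertices of the leg `(c, x, y, z)`, from its root `c` outwards. -/
def legNode : ℕ × ℕ × ℕ × ℕ → ℕ → ℕ
  | (c, _, _, _), 0 => c
  | (_, x, _, _), 1 => x
  | (_, _, y, _), 2 => y
  | (_, _, _, z), _ => z

/-- The number of legs at `c`. -/
def legNumber (J : Finset (ℕ × ℕ × ℕ × ℕ)) (c : ℕ) : ℕ := (J.filter fun j => legNode j 0 = c).card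

/-- The weight of a gadget: the number of ways to spend one more vertex on a root. -/
def gadgetWeight (R : Finset ℕ) (J : Finset (ℕ × ℕ × ℕ × ℕ)) : ℕ := ∑ c ∈ R, 2 ^ legNumber J c

/-- `Layout f₀ U R J f`: the names `U` have been used up, in this order, for the roots `R` and the
legs `J`, and the flags `f₀` have become `f`: zero for roots, the successor of the preceding vertex
for vertices of legs. -/
inductive Layout (f₀ : ℕ → ℤ) :
    List ℕ → Finset ℕ → Finset (ℕ × ℕ × ℕ × ℕ) → (ℕ → ℤ) → Prop
  | nil : Layout f₀ [] ∅ ∅ f₀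
  | root {U : List ℕ} {R : Finset ℕ} {J : Finset (ℕ × ℕ × ℕ × ℕ)} {f : ℕ → ℤ} {c : ℕ} :
      Layout f₀ U R J f → c ∉ U → Layout f₀ (U ++ [c]) (insert c R) J (Function.update f c 0)
  | leg {U : List ℕ} {R : Finset ℕ} {J : Finset (ℕ × ℕ × ℕ × ℕ)} {f : ℕ → ℤ} {c x y z : ℕ} :
      Layout f₀ U R J f → c ∈ R → (U ++ [x, y, z]).Nodup →
      Layout f₀ (U ++ [x, y, z]) R (insert (c, x, y, z) J)
        (Function.update (Function.update (Function.update f x (c + 1)) y (x + 1)) z (y + 1))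

namespace Layout

variable {f₀ f : ℕ → ℤ} {U : List ℕ} {R : Finset ℕ} {J : Finset (ℕ × ℕ × ℕ × ℕ)}

theorem legNode_mem (c x y z : ℕ) {k : ℕ} (hk : k < 3) : legNode (c, x, y, z) (k + 1) ∈ [x, y, z] := by
  interval_cases k <;> simp [legNode]

/-- Every new root or leg uses fresh names, so legs are disjoint from each other and from the roots.
-/
theorem isNaming (h : Layout f₀ U R J f) : IsNaming U.toFinset R J legNode := by
  induction h with
  | nil => constructor <;> simp
  | @root U R J f c h hc ih =>
    refine ⟨fun j hj => Finset.mem_insert_of_mem (ih.root_mem j hj), ?_, ?_, ?_, ih.inj⟩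
    · intro a ha
      rcases Finset.mem_insert.mp ha with rfl | ha
      · simp
      · have := ih.subset ha
        simp at this ⊢; exact Or.inr this
    · intro j hj k hk
      have := ih.leg_mem j hj k hk
      simp at this ⊢; exact Or.inr this
    · intro j hj k hk hmem
      rcases Finset.mem_insert.mp hmem with e | hmem
      · have := ih.leg_mem j hj k hk
        rw [e] at this; exact hc (by simpa using this)
      · exact ih.notMem_root j hj k hk hmem
  | @leg U R J f c x y z h hc hnd ih =>
    have hdisj : ∀ a ∈ U, a ∉ [x, y, z] := fun a ha hb => List.disjoint_of_nodup_append hnd ha hb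
    have hxyz : [x, y, z].Nodup := (List.nodup_append.mp hnd).2.1
    have hold : ∀ j ∈ J, ∀ k < 3, legNode j (k + 1) ∈ U := fun j hj k hk => by
      simpa using ih.leg_mem j hj k hk
    refine ⟨?_, ?_, ?_, ?_, ?_⟩
    · intro j hj
      rcases Finset.mem_insert.mp hj with rfl | hj
      · exact hc
      · exact ih.root_mem j hj
    · intro a ha
      have := ih.subset ha
      rw [List.mem_toFinset] at this ⊢
      exact List.mem_append_left _ this
    · intro j hj k hk
      rw [List.mem_toFinset]
      rcases Finset.mem_insert.mp hj with rfl | hj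
      · exact List.mem_append_right _ (legNode_mem c x y z hk)
      · exact List.mem_append_left _ (hold j hj k hk)
    · intro j hj k hk hmem
      rcases Finset.mem_insert.mp hj with rfl | hj
      · exact hdisj _ (by simpa using ih.subset hmem) (legNode_mem c x y z hk)
      · exact ih.notMem_root j hj k hk hmem
    · intro j hj j' hj' k hk k' hk' e
      rcases Finset.mem_insert.mp hj with rfl | hj <;> rcases Finset.mem_insert.mp hj' with rfl | hj'
      · refine ⟨rfl, ?_⟩
        simp only [List.nodup_cons, List.mem_cons, not_or] at hxyz
        interval_cases k <;> interval_cases k' <;> simp only [legNode] at e <;>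
          first | rfl | (exfalso; subst e; simp_all)
      · exact absurd (legNode_mem c x y z hk) (e ▸ hdisj _ (hold j' hj' k' hk'))
      · exact absurd (legNode_mem c x y z hk') (e ▸ hdisj _ (hold j hj k hk))
      · exact ih.inj j hj j' hj' k hk k' hk' e

theorem mem_iff (h : Layout f₀ U R J f) (a : ℕ) : a ∈ U ↔ a ∈ gadgetVerts R J legNode := by
  rw [mem_gadgetVerts]
  induction h with
  | nil => simp
  | @root U R J f c h hc ih =>
    rw [List.mem_append, ih, Finset.mem_insert, List.mem_singleton]
    exact (or_comm.trans or_assoc.symm)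
  | @leg U R J f c x y z h hc hnd ih =>
    rw [List.mem_append, ih, Finset.exists_mem_insert]
    have : a ∈ [x, y, z] ↔ ∃ k < 3, a = legNode (c, x, y, z) (k + 1) := by
      constructor
      · intro ha
        simp only [List.mem_cons, List.not_mem_nil, or_false] at ha
        rcases ha with rfl | rfl | rfl
        · exact ⟨0, by norm_num, rfl⟩
        · exact ⟨1, by norm_num, rfl⟩
        · exact ⟨2, by norm_num, rfl⟩
      · rintro ⟨k, hk, rfl⟩; exact legNode_mem c x y z hk
    rw [this, or_assoc]
    exact or_congr_right or_comm

theorem flag_of_notMem (h : Layout f₀ U R J f) {a : ℕ} (ha : a ∉ U) : f a = f₀ a := by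
  induction h with
  | nil => rfl
  | @root U R J f c h hc ih =>
    simp only [List.mem_append, List.mem_singleton, not_or] at ha
    rw [Function.update_of_ne ha.2, ih ha.1]
  | @leg U R J f c x y z h hc hnd ih =>
    simp only [List.mem_append, List.mem_cons, List.not_mem_nil, or_false, not_or] at ha
    rw [Function.update_of_ne ha.2.2.2, Function.update_of_ne ha.2.2.1, Function.update_of_ne ha.2.1,
      ih ha.1]

theorem flag_root (h : Layout f₀ U R J f) {a : ℕ} (ha : a ∈ R) : f a = 0 := by
  induction h with
  | nil => simp at ha
  | @root U R J f c h hc ih =>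
    by_cases hac : a = c
    · rw [hac, Function.update_self]
    · rw [Function.update_of_ne hac, ih ((Finset.mem_insert.mp ha).resolve_left hac)]
  | @leg U R J f c x y z h hc hnd ih =>
    have haU : a ∈ U := by simpa using h.isNaming.subset ha
    have hd : a ∉ [x, y, z] := fun hb => List.disjoint_of_nodup_append hnd haU hb
    simp only [List.mem_cons, List.not_mem_nil, or_false, not_or] at hd
    rw [Function.update_of_ne hd.2.2, Function.update_of_ne hd.2.1, Function.update_of_ne hd.1,
      ih ha]

/-- Later steps write to fresh names only, so flags persist. Storing the successor of the preceding
name keeps the flag positive even if that name is 0. -/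
theorem flag_leg (h : Layout f₀ U R J f) {j : ℕ × ℕ × ℕ × ℕ} (hj : j ∈ J) {k : ℕ} (hk : k < 3) :
    f (legNode j (k + 1)) = legNode j k + 1 := by
  induction h with
  | nil => simp at hj
  | @root U R J f c h hc ih =>
    have : legNode j (k + 1) ∈ U := by simpa using h.isNaming.leg_mem j hj k hk
    rw [Function.update_of_ne (by rintro rfl; exact hc this), ih hj]
  | @leg U R J f c x y z h hc hnd ih =>
    rcases Finset.mem_insert.mp hj with rfl | hj
    · have hxyz : [x, y, z].Nodup := (List.nodup_append.mp hnd).2.1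
      simp only [List.nodup_cons, List.mem_cons, List.not_mem_nil, or_false, not_or] at hxyz
      obtain ⟨⟨h1, h2⟩, h3, -⟩ := hxyz
      interval_cases k <;> simp only [legNode]
      · rw [Function.update_of_ne h2, Function.update_of_ne h1, Function.update_self]
      · rw [Function.update_of_ne h3, Function.update_self]
      · rw [Function.update_self]
    · have haU : legNode j (k + 1) ∈ U := by simpa using h.isNaming.leg_mem j hj k hk
      have hd : legNode j (k + 1) ∉ [x, y, z] := fun hb => List.disjoint_of_nodup_append hnd haU hb
      simp only [List.mem_cons, List.not_mem_nil, or_false, not_or] at hd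
      rw [Function.update_of_ne hd.2.2, Function.update_of_ne hd.2.1, Function.update_of_ne hd.1,
        ih hj]

theorem nodup (h : Layout f₀ U R J f) : U.Nodup := by
  induction h with
  | nil => exact List.nodup_nil
  | @root U R J f c h hc ih => exact List.nodup_append.mpr ⟨ih, by simp, by
      intro a ha b hb; rintro rfl; simp at hb; exact hc (hb ▸ ha)⟩
  | @leg U R J f c x y z h hc hnd ih => exact hnd

theorem leg_notMem (h : Layout f₀ U R J f) {c x y z : ℕ} (hnd : (U ++ [x, y, z]).Nodup) :
    (c, x, y, z) ∉ J := fun hj =>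
  List.disjoint_of_nodup_append hnd (by simpa using h.isNaming.leg_mem _ hj 0 (by norm_num))
    (legNode_mem c x y z (k := 0) (by norm_num))

/-- A root uses one name and a leg three. A bound on the names used thus bounds the number of legs
as well, which is the increase of k. -/
theorem length_eq (h : Layout f₀ U R J f) : U.length = R.card + 3 * J.card := by
  induction h with
  | nil => simp
  | @root U R J f c h hc ih =>
    have : c ∉ R := fun hcR => hc (by simpa using h.isNaming.subset hcR)
    rw [List.length_append, ih, Finset.card_insert_of_notMem this, List.length_singleton]; omega
  | @leg U R J f c x y z h hc hnd ih =>
    rw [List.length_append, ih, Finset.card_insert_of_notMem (h.leg_notMem hnd)]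
    simp only [List.length_cons, List.length_nil]; omega

theorem legNumber_insert (h : Layout f₀ U R J f) {c x y z : ℕ} (hnd : (U ++ [x, y, z]).Nodup)
    (d : ℕ) : legNumber (insert (c, x, y, z) J) d = legNumber J d + if d = c then 1 else 0 := by
  rw [legNumber, Finset.filter_insert]
  have e : legNode (c, x, y, z) 0 = c := rfl
  split_ifs with h1 h2 h2
  · rw [Finset.card_insert_of_notMem]
    · rfl
    · exact fun hh => h.leg_notMem hnd (Finset.mem_filter.mp hh).1
  · exact absurd (h1.symm.trans e) h2
  · exact absurd (e.trans h2.symm) h1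
  · rfl

theorem legNumber_of_notMem (h : Layout f₀ U R J f) {c : ℕ} (hc : c ∉ U) : legNumber J c = 0 := by
  rw [legNumber, Finset.card_eq_zero, Finset.filter_eq_empty_iff]
  rintro j hj rfl
  exact hc (by simpa using h.isNaming.subset (h.isNaming.root_mem j hj))

theorem gadgetWeight_root (h : Layout f₀ U R J f) {c : ℕ} (hc : c ∉ U) :
    gadgetWeight (insert c R) J = gadgetWeight R J + 1 := by
  have : c ∉ R := fun hcR => hc (by simpa using h.isNaming.subset hcR)
  rw [gadgetWeight, Finset.sum_insert this, h.legNumber_of_notMem hc, pow_zero, add_comm]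
  rfl

/-- A further leg doubles the weight 2 ^ b of its root, which adds 2 ^ b to the total. -/
theorem gadgetWeight_leg (h : Layout f₀ U R J f) {c x y z : ℕ} (hc : c ∈ R)
    (hnd : (U ++ [x, y, z]).Nodup) :
    gadgetWeight R (insert (c, x, y, z) J) = gadgetWeight R J + 2 ^ legNumber J c := by
  rw [gadgetWeight, gadgetWeight, ← Finset.add_sum_erase _ _ hc, ← Finset.add_sum_erase R (fun d => 2 ^ legNumber J d) hc,
    h.legNumber_insert hnd, if_pos rfl]
  have : ∑ d ∈ R.erase c, 2 ^ legNumber (insert (c, x, y, z) J) d =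
      ∑ d ∈ R.erase c, 2 ^ legNumber J d :=
    Finset.sum_congr rfl fun d hd => by
      rw [h.legNumber_insert hnd, if_neg (Finset.ne_of_mem_erase hd), add_zero]
  rw [this]; ring

end Layout

end

/-! ### Marking names and placing the legs of one root. -/

section

open Set

namespace RAM

variable {w : List ℤ}

theorem Halts.seq_eq {a b : Cmd} {σ τ : State} {m n : ℕ} {Q : State → Prop}
    (h : Halts a σ m (· = τ)) (h' : Halts b τ n Q) : Halts (.seq a b) σ (m + n) Q :=
  h.seq fun _ e => e ▸ h'

theorem getD_of_at {c₀ : ℕ} {U rest : List ℕ} {a : ℕ} {l : List ℤ}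
    (hat : At w c₀ ((U ++ a :: rest).map (fun a : ℕ => (a : ℤ)) ++ l)) :
    w.getD (c₀ + U.length) 0 = a := by
  have h : At w c₀ (U.map (fun a : ℕ => (a : ℤ)) ++
      ((a : ℤ) :: (rest.map (fun a : ℕ => (a : ℤ)) ++ l))) := by simpa using hat
  simpa using h.right.getD

/-- Delete all names in a list. -/
def markAll : Cmd := foreach (block [.sub 4 0 2, .sub 4 4 3, .sub 12 0 3, .store 4 12])

theorem halts_markAll {i : ℕ} {t s r5 r6 r7 r8 r9 r10 r11 r12 r13 : ℤ} {o : List ℤ} {L : List ℕ}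
    (hat : At w i (L.map (fun a : ℕ => (a : ℤ)) ++ [-1])) :
    Halts markAll (conf w i t s [r5, r6, r7, r8, r9, r10, r11, r12, r13] (fun _ => 0) o)
      (10 * L.length + 4) fun τ => ∃ i' t' s' x,
        τ = conf w i' t' s' [r5, r6, r7, r8, r9, r10, r11, x, r13]
          (fun a => if a ∈ L then -1 else 0) o := by
  refine (Halts.foreach (w := w) (enc := fun a : ℕ => [(a : ℤ)]) (hd := id) (tl := fun _ => [])
    (K := 5) (fun a => rfl)
    (fun L' l f o' => o' = o ∧ (∃ x, l = [r5, r6, r7, r8, r9, r10, r11, x, r13]) ∧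
      ∃ P, L = P ++ L' ∧ f = fun a => if a ∈ P then -1 else 0) ?_ L
      ⟨rfl, ⟨r12, rfl⟩, [], rfl, by simp⟩ ?_).mono le_rfl ?_
  · rintro a L' i l f o' ⟨rfl, ⟨x, rfl⟩, P, hP, rfl⟩ -
    refine Halts.block (by simp [IsBasic]) ⟨a, 0 - a - 1, [r5, r6, r7, r8, r9, r10, r11, -1, r13],
      fun b => if b ∈ P ++ [a] then -1 else 0, o', ?_, rfl, ⟨-1, rfl⟩, P ++ [a], by simp [hP], rfl⟩
    have hf : (fun b => if b ∈ P ++ [a] then (-1 : ℤ) else 0) =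
        Function.update (fun b => if b ∈ P then (-1 : ℤ) else 0) a (-1) := by
      funext b
      by_cases hb : b = a <;> simp [hb]
    rw [hf, conf, conf, ← update_memOf]
    simp [step, update_regs, regs]
  · rwa [← List.map_eq_flatMap]
  · rintro τ ⟨t', s', l, f, o', rfl, rfl, ⟨x, rfl⟩, P, hP, rfl⟩
    rw [List.append_nil] at hP
    subst hP
    exact ⟨_, t', s', x, rfl⟩

/-- Take the next name as a root. -/
def placeRoot : Cmd := block [.load 9 7, .add 7 7 3, .sub 4 0 9, .sub 4 4 3, .store 4 0]

theorem halts_placeRoot {i t s r5 r6 r8 r9 r10 r11 r12 r13 : ℤ} {f : ℕ → ℤ} {o : List ℤ} {j a : ℕ}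
    (h : w.getD j 0 = a) :
    Halts placeRoot (conf w i t s [r5, r6, j, r8, r9, r10, r11, r12, r13] f o) 6
      (· = conf w i t (0 - a - 1) [r5, r6, (j + 1 : ℕ), r8, a, r10, r11, r12, r13]
        (Function.update f a 0) o) := by
  refine Halts.block (by simp [IsBasic]) ?_
  have e := memOf_nat w f j
  rw [h] at e
  rw [conf, conf, ← update_memOf]
  simp [step, update_regs, regs, e]

/-- Take the next name as the next vertex of a leg. -/
def placeNext : Cmd :=
  block [.load 2 7, .add 7 7 3, .sub 4 0 2, .sub 4 4 3, .add 12 12 3, .store 4 12, .add 12 2 0]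

theorem halts_placeNext {i t s r5 r6 r8 r9 r10 r11 r13 : ℤ} {f : ℕ → ℤ} {o : List ℤ} {j a q : ℕ}
    (h : w.getD j 0 = a) :
    Halts placeNext (conf w i t s [r5, r6, j, r8, r9, r10, r11, q, r13] f o) 8
      (· = conf w i a (0 - a - 1) [r5, r6, (j + 1 : ℕ), r8, r9, r10, r11, a, r13]
        (Function.update f a (q + 1)) o) := by
  refine Halts.block (by simp [IsBasic]) ?_
  have e := memOf_nat w f j
  rw [h] at e
  rw [conf, conf, ← update_memOf]
  simp [step, update_regs, regs, e]

/-- Add one more leg to the current root. -/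
def placeLeg : Cmd :=
  .seq (block [.add 8 8 8, .add 12 9 0]) (.seq placeNext (.seq placeNext (.seq placeNext
    -- The guard r - 2 * 2 ^ b + 1 is positive exactly if the weight can be doubled once more
    -- without exceeding r.
    (block [.add 10 10 3, .add 13 8 8, .sub 13 6 13, .add 13 13 3]))))

theorem halts_placeLeg {i t s r5 r6 r8 r10 r11 r12 r13 : ℤ} {f : ℕ → ℤ} {o : List ℤ}
    {j c x y z : ℕ} (hx : w.getD j 0 = x) (hy : w.getD (j + 1) 0 = y)
    (hz : w.getD (j + 1 + 1) 0 = z) :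
    Halts placeLeg (conf w i t s [r5, r6, j, r8, c, r10, r11, r12, r13] f o) 32
      (· = conf w i z (0 - z - 1) [r5, r6, (j + 1 + 1 + 1 : ℕ), r8 + r8, c, r10 + 1, r11, z,
        r6 - (r8 + r8 + (r8 + r8)) + 1]
        (Function.update (Function.update (Function.update f x (c + 1)) y (x + 1)) z (y + 1)) o) := by
  refine (Halts.seq_eq (τ := conf w i t s [r5, r6, j, r8 + r8, c, r10, r11, c, r13] f o) (m := 3)
    (n := 29) (Halts.block (by simp [IsBasic]) ?_) (Halts.seq_eq (m := 8) (n := 21)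
      (halts_placeNext hx) (Halts.seq_eq (m := 8) (n := 13) (halts_placeNext hy)
        (Halts.seq_eq (m := 8) (n := 5) (halts_placeNext hz)
          (Halts.block (by simp [IsBasic]) ?_))))).mono le_rfl fun _ h => h
  · simp [step, conf, update_regs, regs]
  · simp [step, conf, update_regs, regs]

/-- Add legs to the current root as long as twice its weight does not exceed register `6`. -/
def placeLegs : Cmd := .whilePos 13 placeLeg

/-- There is room for another leg. If 2 ^ (b + 1) ≤ r then `r.size` is at least b + 2, and the
allotted 2 * (b + 2) ^ 2 names exceed the 1 + 3 * b used for the current root by more than three. -/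
theorem size_step {b r B l n u : ℕ} (hb : 2 ^ (b + 1) ≤ r) (hu : u + 2 * r.size ^ 2 ≤ B)
    (hBn : B ≤ n) (hl : l = u + 1 + 3 * b) : l + 3 ≤ n := by
  have h1 : b + 1 < r.size := Nat.lt_size.mpr hb
  nlinarith

/-- Here u counts the names used before the current root and r is the weight left before it. The
weight 2 ^ b of that root is not yet subtracted from r, whence the equation with n + 2 ^ b. The
measure r - 2 ^ b drops with every leg, and at the end 2 ^ b is the largest power of two not
exceeding r. -/
theorem halts_placeLegs {c₀ n B u r b c : ℕ} {Cl : List ℕ} {f₀ : ℕ → ℤ}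
    (hat : At w c₀ (Cl.map (fun a : ℕ => (a : ℤ)) ++ [-1])) (hnd : Cl.Nodup)
    (hu : u + 2 * r.size ^ 2 ≤ B) (hB : B ≤ Cl.length)
    {U rest : List ℕ} {R : Finset ℕ} {J : Finset (ℕ × ℕ × ℕ × ℕ)} {f : ℕ → ℤ}
    (hL : Layout f₀ U R J f) (hU : Cl = U ++ rest) (hc : c ∈ R) (hb : legNumber J c = b)
    (hw : gadgetWeight R J + r = n + 2 ^ b) (hbr : 2 ^ b ≤ r) (hlen : U.length = u + 1 + 3 * b)
    {i t s k x : ℤ} {o : List ℤ} :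
    Halts placeLegs (conf w i t s [c₀, r, (c₀ + U.length : ℕ), (2 ^ b : ℕ), c, J.card, k, x,
        r - ((2 ^ b : ℕ) + (2 ^ b : ℕ)) + 1] f o)
      (33 * r + 1) fun τ => ∃ (t s x y : ℤ) (U rest : List ℕ) (J : Finset (ℕ × ℕ × ℕ × ℕ))
        (f : ℕ → ℤ) (b : ℕ),
        τ = conf w i t s [c₀, r, (c₀ + U.length : ℕ), (2 ^ b : ℕ), c, J.card, k, x, y] f o ∧
        Layout f₀ U R J f ∧ Cl = U ++ rest ∧ gadgetWeight R J + r = n + 2 ^ b ∧ 2 ^ b ≤ r ∧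
        r < 2 ^ (b + 1) ∧ U.length = u + 1 + 3 * b := by
  refine (Halts.whilePos (K := 32) (fun m τ => ∃ (t s x : ℤ) (U rest : List ℕ)
    (J : Finset (ℕ × ℕ × ℕ × ℕ)) (f : ℕ → ℤ) (b : ℕ),
      τ = conf w i t s [c₀, r, (c₀ + U.length : ℕ), (2 ^ b : ℕ), c, J.card, k, x,
        r - ((2 ^ b : ℕ) + (2 ^ b : ℕ)) + 1] f o ∧
      Layout f₀ U R J f ∧ Cl = U ++ rest ∧ legNumber J c = b ∧ gadgetWeight R J + r = n + 2 ^ b ∧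
      2 ^ b ≤ r ∧ U.length = u + 1 + 3 * b ∧ m = r - 2 ^ b) ?_
      ⟨t, s, x, U, rest, J, f, b, rfl, hL, hU, hb, hw, hbr, hlen, rfl⟩).mono ?_ ?_
  · rintro m σ ⟨t, s, x, U, rest, J, f, b, rfl, hL, hU, hb, hw, hbr, hlen, rfl⟩ hpos
    have hpos : (0 : ℤ) < r - ((2 ^ b : ℕ) + (2 ^ b : ℕ)) + 1 := hpos
    have h2 : 2 ^ b + 2 ^ b ≤ r := by zify; push_cast at hpos; omega
    have h3 : 2 ^ (b + 1) ≤ r := by rw [pow_succ]; omega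
    have h4 := size_step h3 hu hB hlen
    obtain ⟨x', y', z', rest', rfl⟩ : ∃ x y z rest', rest = x :: y :: z :: rest' := by
      rw [hU, List.length_append] at h4
      match rest, h4 with
      | x :: y :: z :: rest', _ => exact ⟨x, y, z, rest', rfl⟩
      | [], h => simp at h
      | [_], h => simp at h
      | [_, _], h => simp at h
    have hx := getD_of_at (hU ▸ hat)
    have hy := getD_of_at (U := U ++ [x']) (a := y') (rest := z' :: rest') (w := w) (c₀ := c₀)
      (l := [-1]) (by simpa [hU] using hat)
    have hz := getD_of_at (U := U ++ [x', y']) (a := z') (rest := rest') (w := w) (c₀ := c₀)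
      (l := [-1]) (by simpa [hU] using hat)
    have hnd' : (U ++ [x', y', z']).Nodup := by
      rw [hU, show U ++ x' :: y' :: z' :: rest' = (U ++ [x', y', z']) ++ rest' by simp] at hnd
      exact (List.nodup_append.mp hnd).1
    have hpow : 0 < 2 ^ b := by positivity
    have hlegn := hL.legNumber_insert (c := c) hnd' c
    rw [if_pos rfl, hb] at hlegn
    have hwt := hL.gadgetWeight_leg hc hnd'
    rw [hb] at hwt
    refine (halts_placeLeg (x := x') (y := y') (z := z') hx
      (by simpa [Nat.add_assoc] using hy) (by simpa [Nat.add_assoc] using hz)).mono le_rfl ?_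
    rintro τ rfl
    refine ⟨r - 2 ^ (b + 1), by rw [pow_succ]; omega, z', 0 - z' - 1, z', U ++ [x', y', z'], rest',
      insert (c, x', y', z') J, _, b + 1, ?_, hL.leg hc hnd', by simp [hU], hlegn, ?_, h3, ?_, rfl⟩
    · rw [Finset.card_insert_of_notMem (hL.leg_notMem hnd')]
      congr 2
      · push_cast; simp; ring_nf; simp
    · rw [hwt, pow_succ]; omega
    · simp only [List.length_append, hlen, List.length_cons, List.length_nil]; omega
  · have : 0 < 2 ^ b := by positivity
    omega
  · rintro τ ⟨⟨m, t, s, x, U, rest, J, f, b, rfl, hL, hU, hb, hw, hbr, hlen, rfl⟩, hneg⟩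
    refine ⟨t, s, x, _, U, rest, J, f, b, rfl, hL, hU, hw, hbr, ?_, hlen⟩
    have hneg : ¬ (0 : ℤ) < r - ((2 ^ b : ℕ) + (2 ^ b : ℕ)) + 1 := hneg
    rw [pow_succ]; zify; push_cast at hneg; omega

end RAM

end

/-! ### The greedy binary expansion. -/

section

open Set

namespace RAM

variable {w : List ℤ}

/-- Place roots greedily, each with as many legs as possible, until the weight in register `6` is
used up. -/
def placeRoots : Cmd :=
  .whilePos 6 (.seq placeRoot (.seq (block [.add 8 3 0, .add 13 8 8, .sub 13 6 13, .add 13 13 3])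
    (.seq placeLegs (block [.sub 6 6 8]))))

/-- The invariant reserves 2 * r.size ^ 2 names for the weight r still to be placed, so the list of
names never runs out. The weight r also serves as the measure. -/
theorem halts_placeRoots {c₀ n B r : ℕ} {Cl : List ℕ} {f₀ : ℕ → ℤ}
    (hat : At w c₀ (Cl.map (fun a : ℕ => (a : ℤ)) ++ [-1])) (hnd : Cl.Nodup) (hB : B ≤ Cl.length)
    {U rest : List ℕ} {R : Finset ℕ} {J : Finset (ℕ × ℕ × ℕ × ℕ)} {f : ℕ → ℤ}
    (hL : Layout f₀ U R J f) (hU : Cl = U ++ rest) (hw : gadgetWeight R J + r = n)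
    (hlen : U.length + 2 * r.size ^ 2 ≤ B) (hR : 0 < r ∧ 2 ≤ R.card)
    {i t s k r8 r9 r12 r13 : ℤ} {o : List ℤ} :
    Halts placeRoots (conf w i t s [c₀, r, (c₀ + U.length : ℕ), r8, r9, J.card, k, r12, r13] f o)
      ((33 * n + 15) * r + 1) fun τ => ∃ (t s r6 r7 r8 r9 r12 r13 : ℤ) (U rest : List ℕ)
        (R : Finset ℕ) (J : Finset (ℕ × ℕ × ℕ × ℕ)) (f : ℕ → ℤ),
        τ = conf w i t s [c₀, r6, r7, r8, r9, J.card, k, r12, r13] f o ∧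
        Layout f₀ U R J f ∧ Cl = U ++ rest ∧ gadgetWeight R J = n ∧ U.length ≤ B ∧ 3 ≤ R.card := by
  -- Since r is positive at the start, at least one round is run, and it adds a third root.
  refine (Halts.whilePos (K := 33 * n + 14) (fun m τ => ∃ (t s r8 r9 r12 r13 : ℤ) (r : ℕ)
    (U rest : List ℕ) (R : Finset ℕ) (J : Finset (ℕ × ℕ × ℕ × ℕ)) (f : ℕ → ℤ),
      τ = conf w i t s [c₀, r, (c₀ + U.length : ℕ), r8, r9, J.card, k, r12, r13] f o ∧
      Layout f₀ U R J f ∧ Cl = U ++ rest ∧ gadgetWeight R J + r = n ∧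
      U.length + 2 * r.size ^ 2 ≤ B ∧ 2 ≤ R.card ∧ (0 < r ∨ 3 ≤ R.card) ∧ m = r) ?_
      ⟨t, s, r8, r9, r12, r13, r, U, rest, R, J, f, rfl, hL, hU, hw, hlen, hR.2, Or.inl hR.1, rfl⟩).mono
      le_rfl ?_
  · rintro m σ ⟨t, s, r8, r9, r12, r13, r, U, rest, R, J, f, rfl, hL, hU, hw, hlen, hR, -, rfl⟩ hpos
    have hpos : (0 : ℤ) < (m : ℤ) := hpos
    have hpos : 0 < m := by exact_mod_cast hpos
    have hsz : 0 < m.size := Nat.size_pos.mpr hpos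
    obtain ⟨a, rest', rfl⟩ : ∃ a rest', rest = a :: rest' := by
      apply List.exists_cons_of_ne_nil
      rintro rfl
      rw [List.append_nil] at hU
      rw [hU] at hB
      have : 0 < m.size ^ 2 := by positivity
      omega
    have ha := getD_of_at (hU ▸ hat)
    have haU : a ∉ U := by
      rw [hU] at hnd
      exact fun h => List.disjoint_of_nodup_append hnd h (by simp)
    have haR : a ∉ R := fun h => haU (by simpa using hL.isNaming.subset h)
    have hlegs := halts_placeLegs (w := w) (n := n) (r := m) (B := B) (b := 0) hat hnd hlen hB
      (hL.root haU) (U := U ++ [a]) (rest := rest') (by simp [hU]) (Finset.mem_insert_self _ _)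
      (hL.legNumber_of_notMem haU) (by rw [hL.gadgetWeight_root haU, pow_zero]; omega)
      (by rw [pow_zero]; omega) (by simp) (i := i) (t := t) (s := 0 - a - 1) (k := k) (x := r12) (o := o)
    have hblock : Halts (block [.add 8 3 0, .add 13 8 8, .sub 13 6 13, .add 13 13 3])
        (conf w i t (0 - a - 1) [c₀, m, (c₀ + U.length + 1 : ℕ), r8, a, J.card, k, r12, r13]
          (Function.update f a 0) o) 5
        (· = conf w i t (0 - a - 1) [c₀, m, (c₀ + (U ++ [a]).length : ℕ), (2 ^ 0 : ℕ), a, J.card, k,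
          r12, m - ((2 ^ 0 : ℕ) + (2 ^ 0 : ℕ)) + 1] (Function.update f a 0) o) :=
      Halts.block (by simp [IsBasic]) (by simp [step, conf, update_regs, regs, add_assoc])
    refine (Halts.seq_eq (m := 6) (halts_placeRoot ha) (Halts.seq_eq (m := 5) hblock
      (Halts.seq (m := 33 * m + 1) (n := 2) hlegs ?_))).mono ?_ fun τ h => h
    · rintro τ ⟨t, s, x, y, U', rest'', J', f', b, rfl, hL', hU', hw', hb1, hb2, hlen'⟩
      refine Halts.block (by simp [IsBasic]) ⟨m - 2 ^ b, ?_, t, s, (2 ^ b : ℕ), a, x, y, m - 2 ^ b, U',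
        rest'', insert a R, J', f', ?_, hL', hU', by omega, ?_, ?_, Or.inr ?_, rfl⟩
      · have : 0 < 2 ^ b := by positivity
        omega
      · rw [Nat.cast_sub hb1]
        simp [step, conf, update_regs, regs]
      -- Removing the leading power of two lowers the size from at least b + 1 to at most b, and 1 +
      -- 3 * b + 2 * b ^ 2 ≤ 2 * (b + 1) ^ 2.
      · have h1 : (m - 2 ^ b).size ≤ b := Nat.size_le.mpr (by rw [pow_succ] at hb2; omega)
        have h2 : b < m.size := Nat.lt_size.mpr hb1
        nlinarith
      · rw [Finset.card_insert_of_notMem haR]; omega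
      · rw [Finset.card_insert_of_notMem haR]; omega
    · omega
  · rintro τ ⟨⟨m, t, s, r8, r9, r12, r13, r, U, rest, R, J, f, rfl, hL, hU, hw, hlen, hR, hR', rfl⟩, hneg⟩
    have hneg : ¬ (0 : ℤ) < (m : ℤ) := hneg
    have hm : m = 0 := by omega
    subst hm
    exact ⟨t, s, _, _, r8, r9, r12, r13, U, rest, R, J, f, rfl, hL, hU, hw, by omega,
      hR'.resolve_left (by simp)⟩

/-- The names for the gadget can be taken from C itself. For size at most 7 the left side is at most
100; for size L ≥ 8 the estimate 2 * L ^ 2 ≤ 2 ^ (L - 1) applies, with equality at L = 8. -/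
theorem two_add_size_le {n : ℕ} (hn : 128 ≤ n) : 2 + 2 * (n - 2).size ^ 2 ≤ n := by
  have key : ∀ L, 8 ≤ L → 2 * L ^ 2 ≤ 2 ^ (L - 1) := by
    intro L hL
    induction L, hL using Nat.le_induction with
    | base => norm_num
    | succ L hL ih =>
      obtain ⟨L, rfl⟩ : ∃ l, L = l + 1 := ⟨L - 1, by omega⟩
      simp only [Nat.add_sub_cancel] at ih ⊢
      rw [show 2 ^ (L + 1) = 2 ^ L * 2 from pow_succ 2 L]
      nlinarith
  by_cases h : (n - 2).size ≤ 7
  · have := Nat.pow_le_pow_left h 2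
    omega
  · have h1 := key _ (not_le.mp h)
    have h2 : 2 ^ ((n - 2).size - 1) ≤ n - 2 := Nat.lt_size.mp (by omega)
    omega

/-- Lay out the gadget. -/
def build : Cmd :=
  .seq (block [.add 7 5 0]) (.seq placeRoot (.seq placeRoot (.seq (block [.sub 6 6 3, .sub 6 6 3])
    placeRoots)))

/-- Two roots without legs come first, and the rest n - 2 is positive and yields another one. This
guarantees the three roots that make sets avoiding v and u too expensive, whatever the binary
expansion is. -/
theorem halts_build {c₀ : ℕ} {Cl : List ℕ} {f₀ : ℕ → ℤ}
    (hat : At w c₀ (Cl.map (fun a : ℕ => (a : ℤ)) ++ [-1])) (hnd : Cl.Nodup) (hn : 128 ≤ Cl.length)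
    {i t s k r7 r8 r9 r12 r13 : ℤ} {o : List ℤ} :
    Halts build (conf w i t s [c₀, Cl.length, r7, r8, r9, 0, k, r12, r13] f₀ o)
      ((33 * Cl.length + 15) * Cl.length + 18) fun τ => ∃ (t s r6 r7 r8 r9 r12 r13 : ℤ)
        (U rest : List ℕ) (R : Finset ℕ) (J : Finset (ℕ × ℕ × ℕ × ℕ)) (f : ℕ → ℤ),
        τ = conf w i t s [c₀, r6, r7, r8, r9, J.card, k, r12, r13] f o ∧
        Layout f₀ U R J f ∧ Cl = U ++ rest ∧ gadgetWeight R J = Cl.length ∧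
        U.length ≤ 2 + 2 * (Cl.length - 2).size ^ 2 ∧ 3 ≤ R.card := by
  obtain ⟨a, b, rest, rfl⟩ : ∃ a b rest, Cl = a :: b :: rest := by
    match Cl, hn with
    | a :: b :: rest, _ => exact ⟨a, b, rest, rfl⟩
    | [], h => simp at h
    | [_], h => simp at h
  have ha := getD_of_at (U := []) hat
  have hb := getD_of_at (U := [a]) (a := b) (rest := rest) (w := w) (c₀ := c₀)
      (l := [-1]) (by simpa using hat)
  have hab : b ∉ [a] := by
    simp only [List.nodup_cons, List.mem_cons, not_or] at hnd
    simpa using fun h => hnd.1.1 h.symm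
  have hL1 : Layout f₀ [a] {a} ∅ (Function.update f₀ a 0) := by
    simpa using (Layout.nil (f₀ := f₀)).root (c := a) (by simp)
  have hL := hL1.root hab
  have hsz := two_add_size_le hn
  have hR2 : (insert b ({a} : Finset ℕ)).card = 2 := Finset.card_pair (by simpa using hab)
  set n := (a :: b :: rest).length with hnlen
  have hr := halts_placeRoots (w := w) (n := n) (r := n - 2) (B := 2 + 2 * (n - 2).size ^ 2) hat hnd
    (hsz.trans_eq hnlen) hL (rest := rest) (by simp) (by
      rw [hL1.gadgetWeight_root hab]
      simp only [gadgetWeight, Finset.sum_singleton, legNumber, Finset.filter_empty,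
        Finset.card_empty, pow_zero]
      omega) (by simp) ⟨by omega, hR2.ge⟩
    (i := i) (t := t) (s := 0 - b - 1) (k := k) (r8 := r8) (r9 := b) (r12 := r12) (r13 := r13) (o := o)
  refine (Halts.seq_eq (m := 2)
    (τ := conf w i t s [c₀, n, (c₀ : ℕ), r8, r9, 0, k, r12, r13] f₀ o)
    (Halts.block (by simp [IsBasic]) ?_) (Halts.seq_eq (m := 6) (halts_placeRoot (by simpa using ha))
      (Halts.seq_eq (m := 6) (halts_placeRoot (by simpa using hb)) (Halts.seq_eq (m := 3)
        (Halts.block (by simp [IsBasic]) ?_) hr)))).mono ?_ fun τ h => h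
  · simp [step, conf, update_regs, regs]
  · rw [Nat.cast_sub (by omega)]
    simp [step, conf, update_regs, regs, Nat.add_assoc]
    rw [show (n : ℤ) - 1 - 1 = n - 2 by ring]
  · have : (33 * n + 15) * (n - 2) ≤ (33 * n + 15) * n := Nat.mul_le_mul_left _ (by omega)
    omega

end RAM

end

/-! ### Reading the input and printing the output. -/

section

open Set

namespace RAM

variable {w : List ℤ}

theorem memOf_neg' (w : List ℤ) (f : ℕ → ℤ) (a : ℕ) : memOf w f (-(a : ℤ) - 1) = f a := by
  rw [← memOf_neg w f a, zero_sub]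

/-- Skip a list in memory. -/
def scan : Cmd := foreach .skip

theorem halts_scan {i : ℕ} {t s : ℤ} {l : List ℤ} {f : ℕ → ℤ} {o : List ℤ} {L : List ℕ}
    (hat : At w i (L.map (fun a : ℕ => (a : ℤ)) ++ [-1])) :
    Halts scan (conf w i t s l f o) (6 * L.length + 4) fun τ => ∃ t' s',
      τ = conf w (i + L.length : ℕ) t' s' l f o := by
  refine (Halts.foreach (w := w) (enc := fun a : ℕ => [(a : ℤ)]) (hd := id) (tl := fun _ => [])
    (K := 1) (fun a => rfl) (fun _ l' f' o' => l' = l ∧ f' = f ∧ o' = o) ?_ L ⟨rfl, rfl, rfl⟩ ?_).mono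
    le_rfl ?_
  · rintro a L' i l' f' o' ⟨rfl, rfl, rfl⟩ -
    exact Halts.skip ⟨_, _, _, _, _, rfl, rfl, rfl, rfl⟩
  · rwa [← List.map_eq_flatMap]
  · rintro τ ⟨t', s', _, _, _, rfl, rfl, rfl, rfl⟩
    exact ⟨t', s', by rw [← List.map_eq_flatMap, List.length_map]⟩

/-- Find the deletable set and read the last entry of the input. -/
def locate : Cmd :=
  .seq (block [.const 0 0, .const 3 1, .const 1 0]) (.seq scan (.seq (block [.add 1 1 3])
    (.seq scan (.seq (block [.add 1 1 3, .add 5 1 0]) (.seq scan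
      -- The pointer stands at the closing -1 of C, so its distance from the start of the list is
      -- the number of elements; k is the next entry.
      (block [.sub 6 1 5, .add 1 1 3, .load 11 1]))))))

/-- The edge list is skipped as a flat list of names, since only the closing entry is negative. -/
theorem halts_locate {V E C : List ℕ} {k : ℤ}
    (hw : w = V.map (fun a : ℕ => (a : ℤ)) ++ [-1] ++ (E.map (fun a : ℕ => (a : ℤ)) ++ [-1]) ++
      (C.map (fun a : ℕ => (a : ℤ)) ++ [-1]) ++ [k]) :
    Halts locate (init w) (6 * w.length + 26) fun τ => ∃ i t s : ℤ,
      τ = conf w i t s [(V.length + 1 + E.length + 1 : ℕ), C.length, 0, 0, 0, 0, k, 0, 0]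
        (fun _ => 0) [] := by
  have hV : At w 0 (V.map (fun a : ℕ => (a : ℤ)) ++ [-1]) :=
    ⟨[], E.map (fun a : ℕ => (a : ℤ)) ++ [-1] ++ (C.map (fun a : ℕ => (a : ℤ)) ++ [-1]) ++ [k],
      by rw [hw]; simp, rfl⟩
  have hE : At w (V.length + 1) (E.map (fun a : ℕ => (a : ℤ)) ++ [-1]) :=
    ⟨V.map (fun a : ℕ => (a : ℤ)) ++ [-1], C.map (fun a : ℕ => (a : ℤ)) ++ [-1] ++ [k],
      by rw [hw]; simp, by simp⟩
  have hC : At w (V.length + 1 + E.length + 1) (C.map (fun a : ℕ => (a : ℤ)) ++ [-1]) :=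
    ⟨V.map (fun a : ℕ => (a : ℤ)) ++ [-1] ++ (E.map (fun a : ℕ => (a : ℤ)) ++ [-1]), [k],
      hw, by simp; omega⟩
  have hk : At w (V.length + 1 + E.length + 1 + C.length + 1) [k] :=
    ⟨V.map (fun a : ℕ => (a : ℤ)) ++ [-1] ++ (E.map (fun a : ℕ => (a : ℤ)) ++ [-1]) ++
      (C.map (fun a : ℕ => (a : ℤ)) ++ [-1]), [], by rw [hw, List.append_nil], by simp; omega⟩
  have hlen : w.length = V.length + 1 + E.length + 1 + C.length + 1 + 1 := by
    rw [hw]; simp; omega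
  rw [init_eq]
  refine (Halts.seq_eq (m := 4) (τ := conf w (0 : ℕ) 0 0 [0, 0, 0, 0, 0, 0, 0, 0, 0] (fun _ => 0) [])
    (n := 6 * w.length + 22) (Halts.block (by simp [IsBasic]) ?_) ((Halts.seq (halts_scan hV)
      (n := 6 * E.length + 6 * C.length + 17) ?_).mono ?_ fun τ h => h)).mono ?_ fun τ h => h
  · simp [step, conf, update_regs]
  · rintro τ ⟨t, s, rfl⟩
    refine (Halts.seq_eq (m := 2) (τ := conf w (V.length + 1 : ℕ) t s [0, 0, 0, 0, 0, 0, 0, 0, 0]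
      (fun _ => 0) []) (n := 6 * E.length + 6 * C.length + 15) (Halts.block (by simp [IsBasic]) ?_)
      ((Halts.seq (halts_scan hE) (n := 6 * C.length + 11) ?_).mono ?_ fun τ h => h)).mono ?_
      fun τ h => h
    · simp [step, conf, update_regs, regs]
    · rintro τ ⟨t, s, rfl⟩
      refine (Halts.seq_eq (m := 3) (τ := conf w (V.length + 1 + E.length + 1 : ℕ) t s
        [(V.length + 1 + E.length + 1 : ℕ), 0, 0, 0, 0, 0, 0, 0, 0] (fun _ => 0) [])
        (n := 6 * C.length + 8) (Halts.block (by simp [IsBasic]) ?_)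
        (Halts.seq (halts_scan hC) (n := 4) ?_)).mono ?_ fun τ h => h
      · simp [step, conf, update_regs, regs]
      · rintro τ ⟨t, s, rfl⟩
        refine Halts.block (by simp [IsBasic]) ⟨(V.length + 1 + E.length + 1 + C.length + 1 : ℕ), t, s, ?_⟩
        have e := memOf_nat w (fun _ => 0) (V.length + 1 + E.length + 1 + C.length + 1)
        rw [hk.getD] at e
        push_cast at e
        simp [step, conf, update_regs, regs, e]
      · omega
    · omega
    · omega
  · omega
  · omega

/-- Print the vertices that are not deleted. -/
def printVerts : Cmd :=
  .seq (block [.const 1 0]) (.seq (foreach (.seq (block [.sub 4 0 2, .sub 4 4 3, .load 4 4, .add 4 4 3])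
    (.ifPos 4 (block [.write 2]) .skip))) (block [.sub 4 0 3, .write 4, .add 1 1 3]))

theorem halts_printVerts {i t s : ℤ} {l : List ℤ} {f : ℕ → ℤ} {o : List ℤ} {L : List ℕ}
    (hat : At w 0 (L.map (fun a : ℕ => (a : ℤ)) ++ [-1])) :
    Halts printVerts (conf w i t s l f o) (13 * L.length + 10) fun τ => ∃ t' s',
      τ = conf w (L.length + 1 : ℕ) t' s' l f
        (o ++ (L.filter fun a => 0 ≤ f a).map (fun a : ℕ => (a : ℤ)) ++ [-1]) := by
  refine (Halts.seq_eq (m := 2) (τ := conf w (0 : ℕ) t s l f o) (n := 13 * L.length + 8)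
    (Halts.block (by simp [IsBasic]) ?_) (Halts.seq (m := 13 * L.length + 4) (n := 4)
      (Halts.foreach (w := w) (enc := fun a : ℕ => [(a : ℤ)]) (hd := id) (tl := fun _ => [])
        (K := 8) (fun a => rfl) (fun L' l' f' o' => l' = l ∧ f' = f ∧ ∃ P, L = P ++ L' ∧
          o' = o ++ (P.filter fun a => 0 ≤ f a).map (fun a : ℕ => (a : ℤ))) ?_ L
          ⟨rfl, rfl, [], rfl, by simp⟩ ?_) ?_)).mono (by omega) fun τ h => h
  · simp [step, conf, update_regs]
  · rintro a L' i l' f' o' ⟨rfl, rfl, P, hP, rfl⟩ -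
    refine (Halts.seq_eq (m := 5) (n := 3) (τ := conf w i a (f' a + 1) l' f'
      (o ++ (P.filter fun a => 0 ≤ f' a).map (fun a : ℕ => (a : ℤ))))
      (Halts.block (by simp [IsBasic]) ?_) ?_)
    · simp [step, conf, update_regs, regs, memOf_neg']
    · refine Halts.ifPos (n := 2) (fun hpos => ?_) (fun hpos => ?_)
      · have hpos : 0 < f' a + 1 := hpos
        have hpos : 0 ≤ f' a := by omega
        refine Halts.block (by simp [IsBasic]) ⟨a, f' a + 1, l', f', _, rfl, rfl, rfl, P ++ [a],
          by simp [hP], ?_⟩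
        simp [conf, regs, List.filter_append, hpos]
      · have hpos : ¬ 0 < f' a + 1 := hpos
        have hpos : ¬ 0 ≤ f' a := by omega
        refine (Halts.skip ⟨a, f' a + 1, l', f', _, rfl, rfl, rfl, P ++ [a],
          by simp [hP], ?_⟩).mono one_le_two fun τ h => h
        simp [List.filter_append, hpos]
  · rwa [← List.map_eq_flatMap]
  · rintro τ ⟨t', s', _, _, _, rfl, rfl, rfl, P, hP, rfl⟩
    rw [List.append_nil] at hP
    subst hP
    refine Halts.block (by simp [IsBasic]) ⟨t', -1, ?_⟩
    simp [step, conf, update_regs, regs, ← List.map_eq_flatMap]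

/-- Print the edges whose two ends have flag zero. -/
def printEdges : Cmd :=
  foreach (.seq (block [.sub 4 0 2, .sub 4 4 3, .load 4 4, .add 1 1 3, .load 12 1, .sub 13 0 12,
      .sub 13 13 3, .load 13 13])
    -- After these tests both flags are at most zero, so the negated sum is positive unless both
    -- vanish.
    (.ifPos 4 .skip (.ifPos 13 .skip (.seq (block [.add 4 4 13, .sub 4 0 4])
      (.ifPos 4 .skip (block [.write 2, .write 12]))))))

/-- The two ends of an edge, written down. -/
def pairWord (p : ℕ × ℕ) : List ℤ := [(p.1 : ℤ), (p.2 : ℤ)]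

/-- No closing entry is written, because the edges of the legs continue the same list. -/
theorem halts_printEdges {i : ℕ} {t s r5 r6 r7 r8 r9 r10 r11 r12 r13 : ℤ} {f : ℕ → ℤ} {o : List ℤ}
    {L : List (ℕ × ℕ)} (hat : At w i (L.flatMap pairWord ++ [-1])) :
    Halts printEdges (conf w i t s [r5, r6, r7, r8, r9, r10, r11, r12, r13] f o) (23 * L.length + 4)
      fun τ => ∃ i t' s' r12 r13 : ℤ, τ = conf w i t' s' [r5, r6, r7, r8, r9, r10, r11, r12, r13] f
        (o ++ (L.filter fun p => f p.1 = 0 ∧ f p.2 = 0).flatMap pairWord) := by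
  refine (Halts.foreach (w := w) (enc := pairWord) (hd := Prod.fst) (tl := fun p => [(p.2 : ℤ)])
    (K := 18) (fun a => rfl) (fun L' l' f' o' => (∃ r12 r13,
      l' = [r5, r6, r7, r8, r9, r10, r11, r12, r13]) ∧ f' = f ∧ ∃ P, L = P ++ L' ∧
      o' = o ++ (P.filter fun p => f p.1 = 0 ∧ f p.2 = 0).flatMap pairWord) ?_ L
      ⟨⟨r12, r13, rfl⟩, rfl, [], rfl, by simp⟩ hat).mono le_rfl ?_
  · rintro ⟨a, b⟩ L' i l' f' o' ⟨⟨r12, r13, rfl⟩, rfl, P, hP, rfl⟩ hat'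
    have e : memOf w f' ((i : ℤ) + 1) = b := by
      have h1 : At w i ([(a : ℤ)] ++ [(b : ℤ)]) := hat'
      exact_mod_cast (memOf_nat w f' (i + 1)).trans h1.right.getD
    set o' := o ++ (P.filter fun p => f' p.1 = 0 ∧ f' p.2 = 0).flatMap pairWord with ho'
    have hout : o ++ ((P ++ [(a, b)]).filter fun p => f' p.1 = 0 ∧ f' p.2 = 0).flatMap pairWord =
        o' ++ if f' a = 0 ∧ f' b = 0 then pairWord (a, b) else [] := by
      rw [ho', List.filter_append, List.flatMap_append, List.append_assoc]
      congr 2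
      split_ifs with h
      · rw [List.filter_cons_of_pos (by simpa using h)]; simp
      · rw [List.filter_cons_of_neg (by simpa using h)]; simp
    -- All branches end in the same configuration up to the guard and the output.
    have hend : ∀ s'' : ℤ, ∀ o'' : List ℤ,
        o'' = (o' ++ if f' a = 0 ∧ f' b = 0 then pairWord (a, b) else []) →
        ∃ t s l'' f'' o''', conf w (i + 1 : ℕ) a s'' [r5, r6, r7, r8, r9, r10, r11, b, f' b] f' o'' =
          conf w (i + [(b : ℤ)].length : ℕ) t s l'' f'' o''' ∧
          (∃ r12 r13, l'' = [r5, r6, r7, r8, r9, r10, r11, r12, r13]) ∧ f'' = f' ∧ ∃ P, L = P ++ L' ∧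
          o''' = o ++ (P.filter fun p => f' p.1 = 0 ∧ f' p.2 = 0).flatMap pairWord := by
      rintro s'' o'' rfl
      exact ⟨_, _, _, _, _, rfl, ⟨_, _, rfl⟩, rfl, P ++ [(a, b)], by simp [hP], hout.symm⟩
    refine (Halts.seq_eq (m := 9) (n := 9)
      (τ := conf w (i + 1 : ℕ) a (f' a) [r5, r6, r7, r8, r9, r10, r11, b, f' b] f' o')
      (Halts.block (by simp [IsBasic]) ?_) ?_)
    · simp [step, conf, update_regs, regs, memOf_neg', e]
    refine Halts.ifPos (n := 8) (fun h1 => ?_) (fun h1 => ?_)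
    · have h1 : 0 < f' a := h1
      refine (Halts.skip (hend _ _ ?_)).mono (by norm_num) fun τ h => h
      rw [if_neg (by omega), List.append_nil]
    have h1 : ¬ 0 < f' a := h1
    refine Halts.ifPos (n := 7) (fun h2 => ?_) (fun h2 => ?_)
    · have h2 : 0 < f' b := h2
      refine (Halts.skip (hend _ _ ?_)).mono (by norm_num) fun τ h => h
      rw [if_neg (by omega), List.append_nil]
    have h2 : ¬ 0 < f' b := h2
    refine (Halts.seq_eq (m := 3) (n := 4)
      (τ := conf w (i + 1 : ℕ) a (-(f' a + f' b)) [r5, r6, r7, r8, r9, r10, r11, b, f' b] f' o')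
      (Halts.block (by simp [IsBasic]) ?_) (Halts.ifPos (n := 3) (fun h3 => ?_) (fun h3 => ?_)))
    · simp [step, conf, update_regs, regs]
    · have h3 : 0 < -(f' a + f' b) := h3
      refine (Halts.skip (hend _ _ ?_)).mono (by norm_num) fun τ h => h
      rw [if_neg (by omega), List.append_nil]
    · have h3 : ¬ 0 < -(f' a + f' b) := h3
      refine Halts.block (by simp [IsBasic]) ?_
      have h4 := hend (-(f' a + f' b)) _ rfl
      rw [if_pos (by omega)] at h4
      simpa [step, conf, regs, pairWord] using h4
  · rintro τ ⟨t', s', _, _, _, rfl, ⟨r12, r13, rfl⟩, rfl, P, hP, rfl⟩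
    rw [List.append_nil] at hP
    subst hP
    exact ⟨_, t', s', r12, r13, rfl⟩

/-- Print the edges of the legs and the new bound. -/
def printLegs : Cmd :=
  .seq (block [.add 1 5 0]) (.seq (foreach (.seq (block [.sub 4 0 2, .sub 4 4 3, .load 4 4])
    (.ifPos 4 (block [.sub 4 4 3, .write 2, .write 4]) .skip)))
    (block [.sub 4 0 3, .write 4, .add 11 11 10, .write 11]))

theorem halts_printLegs {c₀ : ℕ} {i t s r6 r7 r8 r9 r10 r11 r12 r13 : ℤ} {f : ℕ → ℤ} {o : List ℤ}
    {L : List ℕ} (hat : At w c₀ (L.map (fun a : ℕ => (a : ℤ)) ++ [-1])) :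
    Halts printLegs (conf w i t s [c₀, r6, r7, r8, r9, r10, r11, r12, r13] f o) (14 * L.length + 11)
      fun τ => τ.out = o ++ ((L.filter fun a => 0 < f a).flatMap fun a : ℕ => [(a : ℤ), f a - 1]) ++
        [-1, r11 + r10] := by
  refine (Halts.seq_eq (m := 2) (τ := conf w c₀ t s [c₀, r6, r7, r8, r9, r10, r11, r12, r13] f o)
    (n := 14 * L.length + 9)
    (Halts.block (by simp [IsBasic]) ?_) (Halts.seq (m := 14 * L.length + 4) (n := 5)
      (Halts.foreach (w := w) (enc := fun a : ℕ => [(a : ℤ)]) (hd := id) (tl := fun _ => [])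
        (K := 9) (fun a => rfl) (fun L' l' f' o' => l' = [(c₀ : ℤ), r6, r7, r8, r9, r10, r11, r12, r13] ∧
          f' = f ∧ ∃ P, L = P ++ L' ∧
          o' = o ++ (P.filter fun a => 0 < f a).flatMap fun a : ℕ => [(a : ℤ), f a - 1]) ?_ L
          ⟨rfl, rfl, [], rfl, by simp⟩ ?_) ?_)).mono (by omega) fun τ h => h
  · simp [step, conf, update_regs, regs]
  · rintro a L' i l' f' o' ⟨rfl, rfl, P, hP, rfl⟩ -
    refine (Halts.seq_eq (m := 4) (n := 5)
      (τ := conf w i a (f' a) [c₀, r6, r7, r8, r9, r10, r11, r12, r13] f'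
        (o ++ (P.filter fun a => 0 < f' a).flatMap fun a : ℕ => [(a : ℤ), f' a - 1]))
      (Halts.block (by simp [IsBasic]) ?_) ?_)
    · simp [step, conf, update_regs, regs, memOf_neg']
    · refine Halts.ifPos (n := 4) (fun hpos => ?_) (fun hpos => ?_)
      · have hpos : 0 < f' a := hpos
        refine Halts.block (by simp [IsBasic]) ⟨a, f' a - 1, _, f', _, ?_, rfl, rfl, P ++ [a],
          by simp [hP], rfl⟩
        simp [step, conf, update_regs, regs, List.filter_append, hpos]
      · have hpos : ¬ 0 < f' a := hpos
        refine (Halts.skip ⟨a, f' a, _, f', _, rfl, rfl, rfl, P ++ [a],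
          by simp [hP], ?_⟩).mono (by norm_num) fun τ h => h
        simp [List.filter_append, hpos]
  · rwa [← List.map_eq_flatMap]
  · rintro τ ⟨t', s', _, _, _, rfl, rfl, rfl, P, hP, rfl⟩
    rw [List.append_nil] at hP
    subst hP
    refine Halts.block (by simp [IsBasic]) ?_
    simp [step, conf, update_regs, regs]

end RAM

end

/-! ### The complete program. -/

section

open Set

namespace RAM

variable {w : List ℤ}

/-- The kernelization program. -/
def program : Cmd :=
  .seq locate (.seq (block [.const 2 127, .sub 2 6 2]) (.seq
    (.ifPos 2 (.seq (block [.add 1 5 0]) (.seq markAll build)) .skip)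
    (.seq printVerts (.seq printEdges printLegs))))

/-- The output of the program, in terms of the flags of the names. -/
def outputWord (V : List ℕ) (E : List (ℕ × ℕ)) (C : List ℕ) (f : ℕ → ℤ) (k : ℤ) : List ℤ :=
  (V.filter fun a => 0 ≤ f a).map (fun a : ℕ => (a : ℤ)) ++ [-1] ++
    ((E.filter fun p => f p.1 = 0 ∧ f p.2 = 0).flatMap pairWord ++
      ((C.filter fun a => 0 < f a).flatMap fun a : ℕ => [(a : ℤ), f a - 1]) ++ [-1]) ++ [k]

/-- What the program computes: nothing for short lists, and otherwise a layout of a gadget. -/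
def IsPlan (C : List ℕ) (R : Finset ℕ) (J : Finset (ℕ × ℕ × ℕ × ℕ)) (f : ℕ → ℤ) : Prop :=
  (C.length < 128 ∧ J = ∅ ∧ f = fun _ => 0) ∨
    (128 ≤ C.length ∧ ∃ U rest, Layout (fun a => if a ∈ C then -1 else 0) U R J f ∧ C = U ++ rest ∧
      gadgetWeight R J = C.length ∧ U.length ≤ 2 + 2 * (C.length - 2).size ^ 2 ∧ 3 ≤ R.card)

theorem halts_program {V C : List ℕ} {E : List (ℕ × ℕ)} {k : ℤ} (hnd : C.Nodup)
    (hw : w = V.map (fun a : ℕ => (a : ℤ)) ++ [-1] ++ (E.flatMap pairWord ++ [-1]) ++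
      (C.map (fun a : ℕ => (a : ℤ)) ++ [-1]) ++ [k]) :
    Halts program (init w) (1000 * (w.length + 1) ^ 2) fun τ => ∃ R J f, IsPlan C R J f ∧
      τ.out = outputWord V E C f (k + J.card) := by
  have hflat : E.flatMap pairWord =
      (E.flatMap fun p => [p.1, p.2]).map (fun a : ℕ => (a : ℤ)) := by
    rw [List.map_flatMap]; rfl
  have hElen : (E.flatMap pairWord).length = 2 * E.length := by
    simp [List.length_flatMap, pairWord, mul_comm]
  have hElen' : (E.flatMap fun p => [p.1, p.2]).length = 2 * E.length := by
    rw [← hElen, hflat, List.length_map]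
  have hV : At w 0 (V.map (fun a : ℕ => (a : ℤ)) ++ [-1]) :=
    ⟨[], E.flatMap pairWord ++ [-1] ++ (C.map (fun a : ℕ => (a : ℤ)) ++ [-1]) ++ [k],
      by rw [hw]; simp, rfl⟩
  have hE : At w (V.length + 1) (E.flatMap pairWord ++ [-1]) :=
    ⟨V.map (fun a : ℕ => (a : ℤ)) ++ [-1], C.map (fun a : ℕ => (a : ℤ)) ++ [-1] ++ [k],
      by rw [hw]; simp, by simp⟩
  have hlen : w.length = V.length + 1 + 2 * E.length + 1 + C.length + 1 + 1 := by
    rw [hw]; simp [hElen]; omega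
  set c₀ := V.length + 1 + 2 * E.length + 1 with hc₀
  have hC : At w c₀ (C.map (fun a : ℕ => (a : ℤ)) ++ [-1]) :=
    ⟨V.map (fun a : ℕ => (a : ℤ)) ++ [-1] ++ (E.flatMap pairWord ++ [-1]), [k],
      hw, by simp [hElen, hc₀]; omega⟩
  have hloc := halts_locate (w := w) (V := V) (E := E.flatMap fun p => [p.1, p.2]) (C := C) (k := k)
    (by rw [← hflat, hw])
  rw [hElen', ← hc₀] at hloc
  have hprint : ∀ (i t s r6 r7 r8 r9 r12 r13 : ℤ) (R : Finset ℕ) (J : Finset (ℕ × ℕ × ℕ × ℕ))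
      (f : ℕ → ℤ), IsPlan C R J f →
      Halts (.seq printVerts (.seq printEdges printLegs))
        (conf w i t s [c₀, r6, r7, r8, r9, J.card, k, r12, r13] f [])
        (13 * V.length + 10 + (23 * E.length + 4 + (14 * C.length + 11))) fun τ => ∃ R J f, IsPlan C R J f ∧
          τ.out = outputWord V E C f (k + J.card) := by
    intro i t s r6 r7 r8 r9 r12 r13 R J f hplan
    refine Halts.seq (halts_printVerts hV) ?_
    rintro τ ⟨t, s, rfl⟩
    refine Halts.seq (halts_printEdges hE) ?_
    rintro τ ⟨i, t, s, r12, r13, rfl⟩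
    refine (halts_printLegs hC).mono le_rfl fun τ hτ => ⟨R, J, f, hplan, ?_⟩
    rw [hτ, outputWord]
    simp only [List.nil_append, List.append_assoc, List.cons_append]
  refine (Halts.seq hloc (n := 3 + (1 + (2 + (10 * C.length + 4 +
    ((33 * C.length + 15) * C.length + 18))) +
    (13 * V.length + 10 + (23 * E.length + 4 + (14 * C.length + 11))))) ?_).mono ?_ fun τ h => h
  · rintro τ ⟨i, t, s, rfl⟩
    refine Halts.seq_eq (m := 3)
      (τ := conf w i (C.length - 127) s [c₀, C.length, 0, 0, 0, 0, k, 0, 0] (fun _ => 0) [])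
      (Halts.block (by simp [IsBasic]) ?_) (Halts.seq (Q := fun τ =>
        ∃ (i t s r6 r7 r8 r9 r12 r13 : ℤ) (R : Finset ℕ) (J : Finset (ℕ × ℕ × ℕ × ℕ)) (f : ℕ → ℤ),
          IsPlan C R J f ∧ τ = conf w i t s [c₀, r6, r7, r8, r9, J.card, k, r12, r13] f [])
        (Halts.ifPos (fun hpos => ?_) (fun hpos => ?_)) ?_)
    · simp [step, conf, update_regs, regs]
    · have hpos : (0 : ℤ) < C.length - 127 := hpos
      refine Halts.seq_eq (m := 2) (τ := conf w c₀ (C.length - 127) s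
        [c₀, C.length, 0, 0, 0, 0, k, 0, 0] (fun _ => 0) []) (Halts.block (by simp [IsBasic]) ?_)
        (Halts.seq (halts_markAll hC) ?_)
      · simp [step, conf, update_regs, regs]
      · rintro τ ⟨i, t, s, x, rfl⟩
        refine (halts_build hC hnd (by omega)).mono le_rfl ?_
        rintro τ ⟨t, s, r6, r7, r8, r9, r12, r13, U, rest, R, J, f, rfl, h⟩
        exact ⟨i, t, s, r6, r7, r8, r9, r12, r13, R, J, f,
          Or.inr ⟨by omega, U, rest, h⟩, rfl⟩
    · have hpos : ¬ (0 : ℤ) < C.length - 127 := hpos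
      exact (Halts.skip ⟨i, _, s, _, _, _, _, _, _, ∅, ∅, _, Or.inl ⟨by omega, rfl, rfl⟩, rfl⟩).mono
        (by omega) fun τ h => h
    · rintro τ ⟨i, t, s, r6, r7, r8, r9, r12, r13, R, J, f, hplan, rfl⟩
      exact hprint i t s r6 r7 r8 r9 r12 r13 R J f hplan
  -- The quadratic term comes from `build`, where up to |C| rounds are each charged for up to |C|
  -- legs; everything else is linear in the length of the input.
  · have h1 : C.length ≤ w.length := by omega
    have h2 : (33 * C.length + 15) * C.length ≤ (33 * w.length + 15) * w.length := by gcongr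
    nlinarith

end RAM

end

/-! ### Decoding the output, logarithmic bounds, and the conclusion. -/

section

open Set

namespace Layout

variable {f : ℕ → ℤ} {C U : List ℕ} {R : Finset ℕ} {J : Finset (ℕ × ℕ × ℕ × ℕ)}

/-- Outside the layout flags are -1 or 0, at roots 0, and at leg vertices a successor. The sign of
the flag thus tells leg vertices apart from kept and from deleted vertices. -/
theorem flag_pos_iff (h : Layout (fun a => if a ∈ C then -1 else 0) U R J f) (a : ℕ) :
    0 < f a ↔ ∃ j ∈ J, ∃ k < 3, a = legNode j (k + 1) := by
  constructor
  · intro ha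
    by_cases haU : a ∈ U
    · rcases mem_gadgetVerts.mp ((h.mem_iff a).mp haU) with haR | hleg
      · rw [h.flag_root haR] at ha
        exact absurd ha (lt_irrefl 0)
      · exact hleg
    · rw [h.flag_of_notMem haU] at ha
      split_ifs at ha <;> omega
  · rintro ⟨j, hj, k, hk, rfl⟩
    rw [h.flag_leg hj hk]
    omega

theorem flag_nonneg_iff (h : Layout (fun a => if a ∈ C then -1 else 0) U R J f) (a : ℕ) :
    0 ≤ f a ↔ (a ∈ C → a ∈ gadgetVerts R J legNode) := by
  rw [← h.mem_iff]
  by_cases haU : a ∈ U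
  · refine iff_of_true ?_ fun _ => haU
    rcases mem_gadgetVerts.mp ((h.mem_iff a).mp haU) with haR | hleg
    · exact (h.flag_root haR).ge
    · exact ((h.flag_pos_iff a).mpr hleg).le
  · rw [h.flag_of_notMem haU]
    split_ifs with haC <;> simp [haC, haU]

/-- This is the condition under which an end of an old edge is kept in `IsNaming.replace`, so
printing the edges with two zero flags prints exactly the old edges that survive. -/
theorem flag_eq_zero_iff (h : Layout (fun a => if a ∈ C then -1 else 0) U R J f) (hU : U ⊆ C)
    (a : ℕ) : f a = 0 ↔ (a ∈ C → a ∈ R) := by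
  have hpos := h.flag_pos_iff a
  have hnonneg := h.flag_nonneg_iff a
  constructor
  · intro ha haC
    have h0 := hnonneg.mp ha.ge haC
    rcases mem_gadgetVerts.mp h0 with haR | hleg
    · exact haR
    · have := hpos.mpr hleg
      omega
  · intro ha
    have h1 : 0 ≤ f a := hnonneg.mpr fun haC => mem_gadgetVerts.mpr (Or.inl (ha haC))
    refine le_antisymm (not_lt.mp fun hlt => ?_) h1
    obtain ⟨j, hj, k, hk, rfl⟩ := hpos.mp hlt
    exact h.isNaming.notMem_root j hj k hk
      (ha (hU ((h.mem_iff _).mpr (mem_gadgetVerts.mpr (Or.inr ⟨j, hj, k, hk, rfl⟩)))))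

theorem isNaming_of_subset (h : Layout (fun a => if a ∈ C then -1 else 0) U R J f) (hU : U ⊆ C) :
    IsNaming C.toFinset R J legNode := by
  have hsub : U.toFinset ⊆ C.toFinset := fun a ha => by
    rw [List.mem_toFinset] at ha ⊢
    exact hU ha
  exact ⟨h.isNaming.root_mem, h.isNaming.subset.trans hsub,
    fun j hj k hk => hsub (h.isNaming.leg_mem j hj k hk), h.isNaming.notMem_root, h.isNaming.inj⟩

theorem card_gadgetVerts (h : Layout (fun a => if a ∈ C then -1 else 0) U R J f) :
    (gadgetVerts R J legNode).card = U.length := by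
  rw [← List.toFinset_card_of_nodup h.nodup]
  congr 1
  ext a
  rw [List.mem_toFinset, h.mem_iff]

end Layout

/-- The edge from a vertex of a leg to the preceding vertex. -/
def parentEdge (f : ℕ → ℤ) (a : ℕ) : ℕ × ℕ := (a, (f a - 1).toNat)

namespace RAM

theorem length_le_inputSize (w : List ℤ) : w.length ≤ inputSize w := by
  induction w with
  | nil => simp [inputSize]
  | cons z w ih =>
    simp only [inputSize, List.map_cons, List.sum_cons, List.length_cons] at ih ⊢
    omega

variable {f : ℕ → ℤ} {V C U : List ℕ} {E : List (ℕ × ℕ)} {R : Finset ℕ}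
  {J : Finset (ℕ × ℕ × ℕ × ℕ)} {G : NatGraph}

theorem flatMap_parentEdge {L : List ℕ} (hL : ∀ a ∈ L, 0 < f a) :
    (L.map (parentEdge f)).flatMap pairWord = L.flatMap fun a : ℕ => [(a : ℤ), f a - 1] := by
  rw [List.flatMap_map]
  refine List.flatMap_congr fun a ha => ?_
  have := hL a ha
  simp only [pairWord, parentEdge]
  rw [Int.toNat_of_nonneg (by omega)]

/-- A surviving old edge has flag zero at both ends, a leg edge a positive flag at its outer end.
Leg edges differ from each other since they are determined by their outer ends. -/
theorem edges_nodup (hE : (E.map fun p => s(p.1, p.2)).Nodup) (hC : C.Nodup)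
    (h : Layout (fun a => if a ∈ C then -1 else 0) U R J f) :
    (((E.filter fun p => f p.1 = 0 ∧ f p.2 = 0) ++
      (C.filter fun a => 0 < f a).map (parentEdge f)).map fun p => s(p.1, p.2)).Nodup := by
  rw [List.map_append, List.map_map, List.nodup_append]
  refine ⟨hE.sublist (List.filter_sublist.map _), ?_, ?_⟩
  · refine (List.nodup_map_iff_inj_on (hC.filter _)).mpr ?_
    intro a ha b hb hab
    simp only [List.mem_filter, decide_eq_true_eq] at ha hb
    obtain ⟨j, hj, k, hk, rfl⟩ := (h.flag_pos_iff a).mp ha.2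
    obtain ⟨j', hj', k', hk', rfl⟩ := (h.flag_pos_iff b).mp hb.2
    simp only [Function.comp_apply, parentEdge, h.flag_leg hj hk, h.flag_leg hj' hk',
      add_sub_cancel_right, Int.toNat_natCast, Sym2.eq_iff] at hab
    rcases hab with ⟨e, -⟩ | ⟨e1, e2⟩
    · exact e
    · exfalso
      have hn := h.isNaming
      have hk0 : k' ≠ 0 := by
        rintro rfl
        exact hn.notMem_root j hj k hk (e1 ▸ hn.root_mem j' hj')
      obtain ⟨m, rfl⟩ := Nat.exists_eq_succ_of_ne_zero hk0
      obtain ⟨rfl, rfl⟩ := hn.inj j hj j' hj' k hk m (by omega) e1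
      rcases Nat.eq_zero_or_pos k with rfl | hkpos
      · exact hn.notMem_root j hj _ hk' (e2 ▸ hn.root_mem j hj)
      · obtain ⟨l, rfl⟩ := Nat.exists_eq_succ_of_ne_zero hkpos.ne'
        have := (hn.inj j hj j hj l (by omega) _ hk' e2).2
        omega
  · intro e he e' he' hee
    subst hee
    simp only [List.mem_map, List.mem_filter, decide_eq_true_eq, Function.comp_apply] at he he'
    obtain ⟨p, ⟨-, h1, h2⟩, rfl⟩ := he
    obtain ⟨a, ⟨-, ha⟩, e⟩ := he'
    simp only [parentEdge, Sym2.eq_iff] at e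
    rcases e with ⟨e, -⟩ | ⟨e, -⟩
    · rw [e, h1] at ha
      exact lt_irrefl _ ha
    · rw [e, h2] at ha
      exact lt_irrefl _ ha

theorem mem_edges (hE : ∀ e, e ∈ E.map (fun p => s(p.1, p.2)) ↔ e ∈ G.edgeSet)
    (h : Layout (fun a => if a ∈ C then -1 else 0) U R J f) (hU : U ⊆ C)
    (hC : (C.toFinset : Set ℕ) ⊆ G.verts) (e : Sym2 ℕ) :
    e ∈ ((E.filter fun p => f p.1 = 0 ∧ f p.2 = 0) ++
      (C.filter fun a => 0 < f a).map (parentEdge f)).map (fun p => s(p.1, p.2)) ↔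
      e ∈ ((h.isNaming_of_subset hU).replace G hC).edgeSet := by
  have hn := h.isNaming_of_subset hU
  have hflag : ∀ a, f a = 0 ↔ (a ∈ C.toFinset → a ∈ R) := fun a => by
    rw [List.mem_toFinset, h.flag_eq_zero_iff hU]
  have hleg : ∀ {x y}, LegEdge J legNode x y → ∃ a ∈ C.filter fun a => 0 < f a,
      s(a, (f a - 1).toNat) = s(x, y) := by
    rintro x y ⟨j, hj, k, hk, rfl, rfl⟩
    refine ⟨legNode j (k + 1), ?_, ?_⟩
    · simp only [List.mem_filter, decide_eq_true_eq]
      exact ⟨by simpa using hn.leg_mem j hj k hk, (h.flag_pos_iff _).mpr ⟨j, hj, k, hk, rfl⟩⟩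
    · rw [h.flag_leg hj hk, add_sub_cancel_right, Int.toNat_natCast, Sym2.eq_swap]
  rw [List.map_append, List.map_map, List.mem_append]
  induction e with
  | h x y =>
    change _ ↔ (G.Adj x y ∧ _ ∧ _) ∨ _ ∨ _
    rw [← hflag, ← hflag]
    refine or_congr ?_ ?_
    · have hxy := hE s(x, y)
      rw [SimpleGraph.Subgraph.mem_edgeSet] at hxy
      rw [← hxy]
      simp only [List.mem_map, List.mem_filter, decide_eq_true_eq]
      constructor
      · rintro ⟨p, ⟨hp, h1, h2⟩, e⟩
        refine ⟨⟨p, hp, e⟩, ?_⟩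
        rcases Sym2.eq_iff.mp e with ⟨rfl, rfl⟩ | ⟨rfl, rfl⟩
        exacts [⟨h1, h2⟩, ⟨h2, h1⟩]
      · rintro ⟨⟨p, hp, e⟩, h1, h2⟩
        refine ⟨p, ⟨hp, ?_⟩, e⟩
        rcases Sym2.eq_iff.mp e with ⟨rfl, rfl⟩ | ⟨rfl, rfl⟩
        exacts [⟨h1, h2⟩, ⟨h2, h1⟩]
    · rw [List.mem_map]
      constructor
      · rintro ⟨a, ha, e⟩
        simp only [List.mem_filter, decide_eq_true_eq] at ha
        obtain ⟨j, hj, k, hk, rfl⟩ := (h.flag_pos_iff a).mp ha.2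
        simp only [Function.comp_apply, parentEdge, h.flag_leg hj hk, add_sub_cancel_right,
          Int.toNat_natCast] at e
        rcases Sym2.eq_iff.mp e with ⟨rfl, rfl⟩ | ⟨rfl, rfl⟩
        exacts [Or.inr ⟨j, hj, k, hk, rfl, rfl⟩, Or.inl ⟨j, hj, k, hk, rfl, rfl⟩]
      · rintro (hl | hl)
        · exact hleg hl
        · rw [Sym2.eq_swap]
          exact hleg hl

theorem encodesOutput_replace (hVnd : V.Nodup) (hV : ∀ a, a ∈ V ↔ a ∈ G.verts)
    (hEnd : (E.map fun p => s(p.1, p.2)).Nodup)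
    (hE : ∀ e, e ∈ E.map (fun p => s(p.1, p.2)) ↔ e ∈ G.edgeSet) (hCnd : C.Nodup)
    (h : Layout (fun a => if a ∈ C then -1 else 0) U R J f) (hU : U ⊆ C)
    (hC : (C.toFinset : Set ℕ) ⊆ G.verts) (k : ℤ) :
    EncodesOutput (outputWord V E C f k) ((h.isNaming_of_subset hU).replace G hC) k := by
  refine ⟨_, ⟨_, _, ⟨V.filter fun a => 0 ≤ f a, hVnd.filter _, fun a => ?_, rfl⟩,
    ⟨_, edges_nodup hEnd hCnd h, mem_edges hE h hU hC, rfl⟩, rfl⟩, ?_⟩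
  · rw [List.mem_filter, decide_eq_true_eq, hV, h.flag_nonneg_iff, ← List.mem_toFinset]
    rfl
  · rw [outputWord, ← flatMap_parentEdge fun a ha => by simpa using (List.mem_filter.mp ha).2,
      ← List.flatMap_append]
    rfl

end RAM

/-- For n ≥ 1 the right side is at least 1000 * (log 2) ^ 2 > 128. -/
theorem le_mul_log_sq_of_lt {n : ℕ} (hn : n < 128) :
    (n : ℝ) ≤ 1000 * Real.log ((n : ℝ) + 1) ^ 2 := by
  rcases Nat.eq_zero_or_pos n with rfl | hpos
  · simp
  · have h1 : (1 : ℝ) ≤ n := by exact_mod_cast hpos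
    have h2 : Real.log 2 ≤ Real.log ((n : ℝ) + 1) :=
      Real.log_le_log (by norm_num) (by linarith)
    have h3 := Real.log_two_gt_d9
    have h4 : (n : ℝ) < 128 := by exact_mod_cast hn
    nlinarith

/-- Let s be the size and ℓ = log (n + 1). Both (s - 1) * log 2 and log 2 are at most ℓ, so s ≤ 2 *
ℓ / log 2 ≤ 3 * ℓ, which leaves ample room below the constant 1000. -/
theorem two_add_size_le_mul_log_sq {n : ℕ} (hn : 128 ≤ n) :
    ((2 + 2 * (n - 2).size ^ 2 : ℕ) : ℝ) ≤ 1000 * Real.log ((n : ℝ) + 1) ^ 2 := by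
  set s := (n - 2).size with hs
  have hspos : 0 < s := Nat.size_pos.mpr (by omega)
  have h1 : 2 ^ (s - 1) ≤ n := (Nat.lt_size.mp (by omega : s - 1 < (n - 2).size)).trans (by omega)
  have h1' : (2 : ℝ) ^ (s - 1) ≤ n := by exact_mod_cast h1
  have h2 : ((s - 1 : ℕ) : ℝ) * Real.log 2 ≤ Real.log ((n : ℝ) + 1) := by
    rw [← Real.log_pow]
    exact Real.log_le_log (by positivity) (by linarith)
  have h3 := Real.log_two_gt_d9
  have h4 : Real.log 2 ≤ Real.log ((n : ℝ) + 1) := by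
    have : (128 : ℝ) ≤ n := by exact_mod_cast hn
    exact Real.log_le_log (by norm_num) (by linarith)
  have h5 : ((s : ℕ) : ℝ) = ((s - 1 : ℕ) : ℝ) + 1 := by
    rw [Nat.cast_sub (by omega)]
    simp
  have h6 : (0 : ℝ) ≤ ((s - 1 : ℕ) : ℝ) := Nat.cast_nonneg _
  have h7 : (s : ℝ) ≤ 3 * Real.log ((n : ℝ) + 1) := by nlinarith
  have h8 : (s : ℝ) ^ 2 ≤ (3 * Real.log ((n : ℝ) + 1)) ^ 2 := by gcongr
  push_cast
  nlinarith

theorem mainTheorem5 :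
    ∃ (prog : RAM.Cmd) (p : Polynomial ℕ) (c : ℝ),
      ∀ (G : NatGraph) (C : Finset ℕ) (k : ℤ) (w : List ℤ),
        IsPlanar G → IsWideDiamond G C → EncodesInput w G C k →
        ∃ (w' : List ℤ) (G' : NatGraph) (C' : Finset ℕ) (k' : ℤ),
          RAM.OutputsWithin prog w (p.eval (RAM.inputSize w)) w' ∧
          EncodesOutput w' G' k' ∧
          IsPlanar G' ∧
          (C' : Set ℕ) ⊆ G'.verts ∧
          numMinDS G k = numMinDS G' k' ∧
          G.deleteVerts (C : Set ℕ) = G'.deleteVerts (C' : Set ℕ) ∧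
          openNbhd G (C : Set ℕ) = openNbhd G' (C' : Set ℕ) ∧
          (C'.card : ℝ) ≤ c * Real.log ((C.card : ℝ) + 1) ^ 2 ∧
          k ≤ k' ∧
          (k' : ℝ) ≤ (k : ℝ) + c * Real.log ((C.card : ℝ) + 1) ^ 2 := by
  refine ⟨RAM.program, Polynomial.C 1000 * (Polynomial.X + 1) ^ 2, 1000, ?_⟩
  rintro G C k w hpl hwd ⟨_, _, ⟨_, _, ⟨V, hVnd, hV, rfl⟩, ⟨E, hEnd, hE, rfl⟩, rfl⟩,
    ⟨L, hLnd, hL, rfl⟩, hw⟩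
  obtain rfl : C = L.toFinset := by
    ext a
    rw [List.mem_toFinset, hL, Finset.mem_coe]
  have hcard : L.toFinset.card = L.length := List.toFinset_card_of_nodup hLnd
  obtain ⟨t, ht, τ, hτ, R, J, f, hplan, hout⟩ :=
    RAM.halts_program (V := V) (E := E) (k := k) hLnd hw
  have hrun : RAM.OutputsWithin RAM.program w
      ((Polynomial.C 1000 * (Polynomial.X + 1) ^ 2 : Polynomial ℕ).eval (RAM.inputSize w))
      (RAM.outputWord V E L f (k + J.card)) := by
    refine ⟨t, τ, ht.trans ?_, hτ, hout⟩
    have := RAM.length_le_inputSize w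
    simp only [Polynomial.eval_mul, Polynomial.eval_C, Polynomial.eval_pow, Polynomial.eval_add,
      Polynomial.eval_X, Polynomial.eval_one]
    gcongr
  rw [hcard]
  rcases hplan with ⟨hlt, rfl, rfl⟩ | ⟨hge, U, rest, h, hUL, hweight, hlen, hR⟩
  -- A small diamond is printed unchanged, with C' = C and k' = k.
  · refine ⟨_, G, L.toFinset, k + (∅ : Finset (ℕ × ℕ × ℕ × ℕ)).card, hrun, ?_, hpl, hwd.1,
      by simp, rfl, rfl, ?_, by simp, ?_⟩
    · refine ⟨_, ⟨_, _, ⟨V, hVnd, hV, rfl⟩, ⟨E, hEnd, hE, rfl⟩, rfl⟩, ?_⟩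
      simp [RAM.outputWord]
      rfl
    · rw [hcard]
      exact le_mul_log_sq_of_lt hlt
    · push_cast
      have : 0 ≤ 1000 * Real.log ((L.length : ℝ) + 1) ^ 2 := by positivity
      simpa using this
  · have hU : U ⊆ L := fun a ha => hUL ▸ List.mem_append_left _ ha
    obtain ⟨v, u, hG⟩ := IsGadget.of_isWideDiamond hwd
    have hn := h.isNaming_of_subset hU
    have hG' := hn.replace_isGadget hG
    have hfin : G.verts.Finite := (V.finite_toSet).subset fun a ha => (hV a).mpr ha
    have hbound := two_add_size_le_mul_log_sq hge
    have hUbound : (U.length : ℝ) ≤ 1000 * Real.log ((L.length : ℝ) + 1) ^ 2 :=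
      (Nat.cast_le.mpr hlen).trans hbound
    refine ⟨_, hn.replace G hG.subset, gadgetVerts R J legNode, k + J.card, hrun,
      RAM.encodesOutput_replace hVnd hV hEnd hE hLnd h hU hG.subset _, hn.replace_isPlanar hG hfin hpl,
      hG'.subset, hn.numMinDS_replace hG hfin (by omega) hR ?_ k, (hn.replace_deleteVerts hG.subset).symm,
      ?_, ?_, by simp, ?_⟩
    · rw [hcard, ← hweight]
      rfl
    · rw [hG.openNbhd_eq (Finset.card_pos.mp (by omega)), hG'.openNbhd_eq (Finset.card_pos.mp (by omega))]
    · rw [h.card_gadgetVerts]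
      exact hUbound
    -- The increase of k is the number of legs, which is at most the number of names used.
    · have hJ : (J.card : ℝ) ≤ U.length := by
        rw [h.length_eq]
        exact_mod_cast (by omega : J.card ≤ R.card + 3 * J.card)
      push_cast
      linarith

end
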